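/- **Theorem 2.2 (Bochner formula).** Let $\Sigma$ be a Riemann surface with a smooth Riemannian metric $ds^2_\Sigma$ conformal to its complex structure, and let $(M,J,h)$ be a Hermitian surface (a complex manifold of complex dimension $2$ with a smooth Hermitian metric), equipped with its Chern connection, the unique connection on $TM$ preserving $J$ and $h$ whose torsion has no $(1,1)$-part. Let $f:\Sigma\to M$ be a smooth Chern-harmonic map, i.e. $\operatorname{tr}\nabla df=0$, where $\nabla$ is induced by the Levi-Civita connection of $ds^2_\Sigma$ and the Chern connection of $h$ and the trace is taken with respect to $ds^2_\Sigma$. On an open set $U\subset\Sigma$ with $f(U)\subset V$, $V\subset M$ open, choose smooth local unitary coframes: $(1,0)$-forms $\varphi$ on $U$ and $\omega^1,\omega^2$ on $V$ with $$ds^2_\Sigma=\varphi\otimes\bar\varphi+\bar\varphi\otimes\varphi,\qquad h=\sum_i(\omega^i\otimes\overline{\omega^i}+\overline{\omega^i}\otimes\omega^i).$$ Below, repeated indices are summed over $1,2$. Define the real form $\rho$ and the Gaussian curvature $K$ of $ds^2_\Sigma$ by $d\varphi=-\sqrt{-1}\,\rho\wedge\varphi$, $d\rho=-\sqrt{-1}\,K\varphi\wedge\bar\varphi$.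 The connection forms ($\omega^j_i+\overline{\omega^i_j}=0$), torsion and curvature of the Chern connection satisfy $$d\omega^i=-\omega^i_j\wedge\omega^j+L^i_{jk}\,\omega^j\wedge\omega^k,\quad L^i_{jk}=-L^i_{kj},\qquad \Omega^i_j=d\omega^i_j+\omega^i_k\wedge\omega^k_j,$$ $$\Omega^i_j=R^i_{jk\ell}\,\omega^k\wedge\omega^\ell+R^i_{jk\bar\ell}\,\omega^k\wedge\overline{\omega^\ell}+R^i_{j\bar k\bar\ell}\,\overline{\omega^k}\wedge\overline{\omega^\ell},\quad R^i_{jk\ell}=-R^i_{j\ell k},\quad R^i_{j\bar k\bar\ell}=-R^i_{j\bar\ell\bar k},$$ and the covariant derivatives of the torsion are given by $$dL^i_{jk}+L^m_{jk}\omega^i_m-L^i_{mk}\omega^m_j-L^i_{jm}\omega^m_k=L^i_{jk\ell}\,\omega^\ell+L^i_{jk\bar\ell}\,\overline{\omega^\ell}.$$ Write $f^*\omega^i=a^i_1\varphi+a^i_{\bar1}\bar\varphi$ and $$a^i_{11}\varphi+a^i_{1\bar1}\bar\varphi=da^i_1-\sqrt{-1}\rho\,a^i_1+a^j_1f^*\omega^i_j,\qquad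 a^i_{\bar11}\varphi+a^i_{\bar1\bar1}\bar\varphi=da^i_{\bar1}+\sqrt{-1}\rho\,a^i_{\bar1}+a^j_{\bar1}f^*\omega^i_j,$$ and let $$\Omega^i_j/(\varphi\wedge\bar\varphi)=2R^i_{jk\ell}a^k_1a^\ell_{\bar1}+R^i_{jk\bar\ell}\big(a^k_1\overline{a^\ell_1}-a^k_{\bar1}\overline{a^\ell_{\bar1}}\big)+2R^i_{j\bar k\bar\ell}\,\overline{a^k_{\bar1}}\,\overline{a^\ell_1}$$ be the coefficient of $f^*\Omega^i_j$ with respect to $\varphi\wedge\bar\varphi$. Let $e(f)=\tfrac12\operatorname{tr}f^*h$ be the energy density (the trace taken with respect to $ds^2_\Sigma$), let $|A|^2=\sum_i\big(|a^i_{11}|^2+2|a^i_{1\bar1}|^2+|a^i_{\bar1\bar1}|^2\big)$, and let $\Delta$ be the Laplace–Beltrami operator of $ds^2_\Sigma$ (in a conformal coordinate $z=x+\sqrt{-1}\,y$ with $ds^2_\Sigma=G(dx^2+dy^2)$, $\Delta=G^{-1}(\partial_x^2+\partial_y^2)$). Then on $U$ one has $e(f)=\sum_i\big(|a^i_1|^2+|a^i_{\bar1}|^2\big)$,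 $|A|^2$ is half of the squared norm of $\nabla df$, and $$\begin{aligned}\Delta e(f)={}&2|A|^2+2K\,e(f)-2\,\overline{a^i_1}\,a^j_1\,\Omega^i_j/(\varphi\wedge\bar\varphi)+2\,a^i_{\bar1}\,\overline{a^j_{\bar1}}\,\Omega^j_i/(\varphi\wedge\bar\varphi)\\ &-4\operatorname{Re}\Big[a^i_1\big(\overline{L^i_{jk\ell}}\,\overline{a^\ell_1}+\overline{L^i_{jk\bar\ell}}\,a^\ell_{\bar1}\big)\overline{a^j_1}\,\overline{a^k_{\bar1}}+a^i_1\overline{L^i_{jk}}\big(\overline{a^j_{11}}\,\overline{a^k_{\bar1}}+\overline{a^j_1}\,\overline{a^k_{\bar11}}\big)\Big]\\ &+4\operatorname{Re}\Big[a^i_{\bar1}\big(\overline{L^i_{jk\ell}}\,\overline{a^\ell_{\bar1}}+\overline{L^i_{jk\bar\ell}}\,a^\ell_1\big)\overline{a^j_1}\,\overline{a^k_{\bar1}}+a^i_{\bar1}\overline{L^i_{jk}}\big(\overline{a^j_{1\bar1}}\,\overline{a^k_{\bar1}}+\overline{a^j_1}\,\overline{a^k_{\bar1\bar1}}\big)\Big].\end{aligned}$$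 -/

import Mathlib

open scoped Manifold ContDiff ComplexConjugate

noncomputable section

namespace ChernHarmonic

section RealForms

variable {E : Type*} [NormedAddCommGroup E] [NormedSpace ℝ E]
  {M : Type*} [TopologicalSpace M] [ChartedSpace E M]

/-- The exterior derivative of a complex-valued `1`-form `α` on a manifold, evaluated at `y` on the
tangent vectors `v`, `w`: pull `α` back by the inverse of the preferred chart at `y` and take
`dα(v, w) = ∂_v α(w) - ∂_w α(v)` there.  (The tangent space at `y` is the model space, read in the
preferred chart at `y`.) -/
def dForm (α : ∀ y : M, TangentSpace 𝓘(ℝ, E) y →L[ℝ] ℂ) (y : M)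
    (v w : TangentSpace 𝓘(ℝ, E) y) : ℂ :=
  let α' : E → E →L[ℝ] ℂ := fun u =>
    (α ((extChartAt 𝓘(ℝ, E) y).symm u)).comp
      (mfderiv 𝓘(ℝ, E) 𝓘(ℝ, E) (extChartAt 𝓘(ℝ, E) y).symm u)
  fderiv ℝ α' (extChartAt 𝓘(ℝ, E) y y) v w - fderiv ℝ α' (extChartAt 𝓘(ℝ, E) y y) w v

/-- The wedge product `(α ∧ β)(v, w) = α(v) β(w) - α(w) β(v)` of two `1`-forms at a point. -/
def wedge {T : Type*} (α β : T → ℂ) (v w : T) : ℂ := α v * β w - α w * β v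

end RealForms

section ComplexManifold

variable {E : Type*} [NormedAddCommGroup E] [NormedSpace ℝ E] [NormedSpace ℂ E]
  [IsScalarTower ℝ ℂ E] {M : Type*} [TopologicalSpace M] [ChartedSpace E M]

/-- A complex manifold is a smooth real manifold. -/
instance realManifold [IsManifold 𝓘(ℂ, E) ω M] : IsManifold 𝓘(ℝ, E) ∞ M := by
  apply isManifold_of_contDiffOn
  intro e e' he he'
  have h1 := (HasGroupoid.compatible (G := contDiffGroupoid ω 𝓘(ℂ, E)) he he')
  rw [contDiffGroupoid, mem_groupoid_of_pregroupoid] at h1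
  have h2 : ContDiffOn ℂ ω (𝓘(ℂ, E) ∘ (e.symm.trans e') ∘ 𝓘(ℂ, E).symm)
    (𝓘(ℂ, E).symm ⁻¹' (e.symm.trans e').source ∩ Set.range 𝓘(ℂ, E)) := h1.1
  exact (h2.restrict_scalars ℝ).of_le le_top

/-- Multiplication of a tangent vector by a complex number.  The charts of `M` are holomorphically
compatible, so this is the complex structure of the tangent spaces of the complex manifold `M`. -/
def csmul {y : M} (c : ℂ) (v : TangentSpace 𝓘(ℝ, E) y) : TangentSpace 𝓘(ℝ, E) y :=
  (c • (show E from v) : E)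

/-- The complex structure `J` on the tangent spaces. -/
def J {y : M} (v : TangentSpace 𝓘(ℝ, E) y) : TangentSpace 𝓘(ℝ, E) y := csmul Complex.I v

/-- The value `α(u')`, where `α` is extended complex linearly to the complexified tangent space and
`u' = (u - i J u) / 2` is the `(1,0)`-part of `u`. -/
def holPart {y : M} (α : TangentSpace 𝓘(ℝ, E) y → ℂ) (u : TangentSpace 𝓘(ℝ, E) y) : ℂ :=
  (α u - Complex.I * α (J u)) / 2

/-- The value `α(u'')`, where `α` is extended complex linearly to the complexified tangent space and
`u'' = (u + i J u) / 2` is the `(0,1)`-part of `u`. -/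
def antiPart {y : M} (α : TangentSpace 𝓘(ℝ, E) y → ℂ) (u : TangentSpace 𝓘(ℝ, E) y) : ℂ :=
  (α u + Complex.I * α (J u)) / 2

/-- `η(u', v')` for a `2`-form `η`. -/
def ev20 {y : M} (η : TangentSpace 𝓘(ℝ, E) y → TangentSpace 𝓘(ℝ, E) y → ℂ)
    (u v : TangentSpace 𝓘(ℝ, E) y) : ℂ :=
  holPart (fun a => holPart (fun b => η a b) v) u

/-- `η(u', v'')` for a `2`-form `η`. -/
def ev11 {y : M} (η : TangentSpace 𝓘(ℝ, E) y → TangentSpace 𝓘(ℝ, E) y → ℂ)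
    (u v : TangentSpace 𝓘(ℝ, E) y) : ℂ :=
  holPart (fun a => antiPart (fun b => η a b) v) u

/-- `η(u'', v'')` for a `2`-form `η`. -/
def ev02 {y : M} (η : TangentSpace 𝓘(ℝ, E) y → TangentSpace 𝓘(ℝ, E) y → ℂ)
    (u v : TangentSpace 𝓘(ℝ, E) y) : ℂ :=
  antiPart (fun a => antiPart (fun b => η a b) v) u

variable [IsManifold 𝓘(ℂ, E) ω M]

variable (E M) in
/-- A Hermitian metric on a complex manifold: a smooth Riemannian metric for which the complex
structure is an isometry.  In complex dimension one this is the same as a Riemannian metric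
conformal to the complex structure. -/
structure HermitianMetric extends
    Bundle.ContMDiffRiemannianMetric 𝓘(ℝ, E) ∞ E (fun y : M => TangentSpace 𝓘(ℝ, E) y) where
  inner_J : ∀ (y : M) (v w : TangentSpace 𝓘(ℝ, E) y), inner y (J v) (J w) = inner y v w

/-- For fixed `w`, the complex linear form `v ↦ (h(v, w) + i h(v, J w)) / 2`.  This is the
Hermitian form `H` with `h(v, w) = 2 Re H(v, w)`. -/
def HermitianMetric.herm (h : HermitianMetric E M) (y : M) (w : TangentSpace 𝓘(ℝ, E) y) :
    TangentSpace 𝓘(ℝ, E) y →L[ℝ] ℂ :=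
  (1 / 2 : ℂ) • (Complex.ofRealCLM.comp (h.inner y w) +
    Complex.I • Complex.ofRealCLM.comp (h.inner y (J w)))

/-- A smooth local unitary frame on the open set `domain`, indexed by `ι`.  A tangent vector `v` is
identified with its `(1,0)`-part, so that `h = ∑ i, (ω^i ⊗ conj ω^i + conj ω^i ⊗ ω^i)` for the dual
coframe `ω^i` (when the number of vectors is the complex dimension of the manifold). -/
structure UnitaryFrame (ι : Type) [DecidableEq ι] (h : HermitianMetric E M) where
  domain : Set M
  isOpen_domain : IsOpen domain
  vec : ι → ∀ y : M, TangentSpace 𝓘(ℝ, E) y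
  smooth : ∀ i, ContMDiffOn 𝓘(ℝ, E) 𝓘(ℝ, E).tangent ∞
    (fun y => (⟨y, vec i y⟩ : TangentBundle 𝓘(ℝ, E) M)) domain
  unitary : ∀ y ∈ domain, ∀ i j, h.herm y (vec j y) (vec i y) = if i = j then 1 else 0

namespace UnitaryFrame

variable {ι : Type} [DecidableEq ι] {h : HermitianMetric E M}

/-- The unitary coframe `ω^i` dual to the frame. -/
def dual (e : UnitaryFrame ι h) (i : ι) (y : M) : TangentSpace 𝓘(ℝ, E) y →L[ℝ] ℂ :=
  h.herm y (e.vec i y)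

/-- On its domain the frame is dual to `ω^i`. -/
theorem dual_vec (e : UnitaryFrame ι h) {y : M} (hy : y ∈ e.domain) (i j : ι) :
    e.dual i y (e.vec j y) = if i = j then 1 else 0 := by
  rw [dual, e.unitary y hy j i]
  simp only [eq_comm]

/-- The forms `ω^i` are of type `(1,0)`. -/
theorem dual_J (e : UnitaryFrame ι h) (i : ι) (y : M) (v : TangentSpace 𝓘(ℝ, E) y) :
    e.dual i y (J v) = Complex.I * e.dual i y v := by
  have hJJ : ∀ w : TangentSpace 𝓘(ℝ, E) y, J (J w) = -w := by
    intro w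
    change (Complex.I • (Complex.I • (show E from w)) : E) = -(show E from w)
    rw [smul_smul, Complex.I_mul_I, neg_one_smul]
  have h1 : h.inner y (e.vec i y) (J v) = -h.inner y (J (e.vec i y)) v := by
    have := h.inner_J y (e.vec i y) (J v)
    rw [hJJ, map_neg] at this
    rw [← this]
  have h2 : h.inner y (J (e.vec i y)) (J v) = h.inner y (e.vec i y) v := h.inner_J y _ _
  simp only [dual, HermitianMetric.herm, _root_.smul_apply,
    _root_.add_apply, ContinuousLinearMap.comp_apply, Complex.ofRealCLM_apply, h1, h2,
    smul_eq_mul, Complex.ofReal_neg]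
  linear_combination (-(1 / 2) * (h.inner y (J (e.vec i y)) v : ℂ)) * Complex.I_mul_I

variable [Fintype ι]

/-- The coefficients `B^i_{jk}` of `ω^j ∧ conj ω^k` in the `(1,1)`-part of `dω^i`. -/
def dDual11 (e : UnitaryFrame ι h) (i j k : ι) (y : M) : ℂ :=
  ev11 (dForm (e.dual i) y) (e.vec j y) (e.vec k y)

/-- The connection forms `ω^i_j = ∑ k, (B^i_{jk} conj ω^k - conj B^j_{ik} ω^k)` of the Chern
connection.  They are the only forms which are skew-Hermitian and for which the torsion
`dω^i + ∑ j, ω^i_j ∧ ω^j` has vanishing `(1,1)`-part. -/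
def conn (e : UnitaryFrame ι h) (i j : ι) (y : M) : TangentSpace 𝓘(ℝ, E) y →L[ℝ] ℂ :=
  ∑ k, (e.dDual11 i j k y • (Complex.conjCLE : ℂ →L[ℝ] ℂ).comp (e.dual k y) -
    conj (e.dDual11 j i k y) • e.dual k y)

/-- The torsion forms `Θ^i = dω^i + ∑ j, ω^i_j ∧ ω^j`. -/
def torsion (e : UnitaryFrame ι h) (i : ι) (y : M) (v w : TangentSpace 𝓘(ℝ, E) y) : ℂ :=
  dForm (e.dual i) y v w + ∑ j, wedge (e.conn i j y) (e.dual j y) v w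

/-- The curvature forms `Ω^i_j = dω^i_j + ∑ k, ω^i_k ∧ ω^k_j`. -/
def curv (e : UnitaryFrame ι h) (i j : ι) (y : M) (v w : TangentSpace 𝓘(ℝ, E) y) : ℂ :=
  dForm (e.conn i j) y v w + ∑ k, wedge (e.conn i k y) (e.conn k j y) v w

/-- The torsion coefficients: `Θ^i = ∑ j k, L^i_{jk} ω^j ∧ ω^k` and `L^i_{jk} = -L^i_{kj}`. -/
def L (e : UnitaryFrame ι h) (i j k : ι) (y : M) : ℂ :=
  ev20 (e.torsion i y) (e.vec j y) (e.vec k y) / 2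

/-- The covariant derivative of the torsion, as a `1`-form. -/
def covL (e : UnitaryFrame ι h) (i j k : ι) (y : M) (v : TangentSpace 𝓘(ℝ, E) y) : ℂ :=
  (show ℂ from mfderiv 𝓘(ℝ, E) 𝓘(ℝ, ℂ) (e.L i j k) y v) +
    ∑ m, (e.L m j k y * e.conn i m y v - e.L i m k y * e.conn m j y v -
      e.L i j m y * e.conn m k y v)

/-- `L^i_{jkl}`: the coefficient of `ω^l` in the covariant derivative of `L^i_{jk}`. -/
def Lhol (e : UnitaryFrame ι h) (i j k l : ι) (y : M) : ℂ :=
  holPart (e.covL i j k y) (e.vec l y)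

/-- `L^i_{jk \bar l}`: the coefficient of `conj ω^l` in the covariant derivative of `L^i_{jk}`. -/
def Lanti (e : UnitaryFrame ι h) (i j k l : ι) (y : M) : ℂ :=
  antiPart (e.covL i j k y) (e.vec l y)

/-- `R^i_{jkl}`, the coefficients of `ω^k ∧ ω^l` in `Ω^i_j`, skew in `k`, `l`. -/
def R20 (e : UnitaryFrame ι h) (i j k l : ι) (y : M) : ℂ :=
  ev20 (e.curv i j y) (e.vec k y) (e.vec l y) / 2

/-- `R^i_{jk \bar l}`, the coefficients of `ω^k ∧ conj ω^l` in `Ω^i_j`. -/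
def R11 (e : UnitaryFrame ι h) (i j k l : ι) (y : M) : ℂ :=
  ev11 (e.curv i j y) (e.vec k y) (e.vec l y)

/-- `R^i_{j \bar k \bar l}`, the coefficients of `conj ω^k ∧ conj ω^l` in `Ω^i_j`, skew in
`k`, `l`. -/
def R02 (e : UnitaryFrame ι h) (i j k l : ι) (y : M) : ℂ :=
  ev02 (e.curv i j y) (e.vec k y) (e.vec l y) / 2

/-- The connection forms are skew-Hermitian: the connection preserves the metric. -/
theorem conn_skew (e : UnitaryFrame ι h) (i j : ι) (y : M) (v : TangentSpace 𝓘(ℝ, E) y) :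
    e.conn j i y v + conj (e.conn i j y v) = 0 := by
  simp [conn]

/-- The torsion has vanishing `(1,1)`-part. -/
theorem torsion_ev11 (e : UnitaryFrame ι h) {y : M} (hy : y ∈ e.domain) (i j k : ι) :
    ev11 (e.torsion i y) (e.vec j y) (e.vec k y) = 0 := by
  have hd := e.dual_vec hy
  have hI : Complex.I ^ 2 = -1 := Complex.I_sq
  have hJ : ∀ m w, e.dual m y (J w) = Complex.I * e.dual m y w := fun m w => e.dual_J m y w
  have hcv : ∀ m l, e.conn i m y (e.vec l y) = e.dDual11 i m l y - conj (e.dDual11 m i l y) := by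
    intro m l
    simp [conn, hd, apply_ite]
  have hcJ : ∀ m l, e.conn i m y (J (e.vec l y)) =
      -Complex.I * e.dDual11 i m l y - Complex.I * conj (e.dDual11 m i l y) := by
    intro m l
    simp [conn, hd, hJ, apply_ite]
    ring
  have key : ev11 (e.torsion i y) (e.vec j y) (e.vec k y) = e.dDual11 i j k y +
      ∑ m, ev11 (wedge (e.conn i m y) (e.dual m y)) (e.vec j y) (e.vec k y) := by
    simp only [dDual11, ev11, holPart, antiPart, torsion, Finset.sum_add_distrib,
      Finset.sum_sub_distrib, ← Finset.sum_div, ← Finset.mul_sum]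
    ring
  have hw : ∀ m, ev11 (wedge (e.conn i m y) (e.dual m y)) (e.vec j y) (e.vec k y) =
      -e.dDual11 i m k y * if m = j then 1 else 0 := by
    intro m
    simp only [ev11, holPart, antiPart, wedge, hcv, hcJ, hJ, hd]
    generalize (if m = j then (1 : ℂ) else 0) = p
    generalize (if m = k then (1 : ℂ) else 0) = q
    ring_nf
    simp only [hI, show Complex.I ^ 4 = 1 from Complex.I_pow_four]
    ring
  rw [key]
  simp [hw]

end UnitaryFrame

end ComplexManifold

section Maps

variable {S : Type*} [TopologicalSpace S] [ChartedSpace ℂ S] [IsManifold 𝓘(ℂ, ℂ) ω S]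
  {E : Type*} [NormedAddCommGroup E] [NormedSpace ℝ E] [NormedSpace ℂ E]
  [IsScalarTower ℝ ℂ E]
  {M : Type*} [TopologicalSpace M] [ChartedSpace E M] [IsManifold 𝓘(ℂ, E) ω M]

/-- The trace of a bilinear map on `T_x S` with respect to the metric `g`.  The coordinate vectors
`1`, `i` of the preferred (holomorphic) chart at `x` are `g`-orthogonal and of equal length. -/
def trace (g : HermitianMetric ℂ S) {V : Type*} [AddCommGroup V] [Module ℝ V] {x : S}
    (B : TangentSpace 𝓘(ℝ, ℂ) x → TangentSpace 𝓘(ℝ, ℂ) x → V) : V :=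
  (g.inner x (1 : ℂ) (1 : ℂ))⁻¹ • (B (1 : ℂ) (1 : ℂ) + B Complex.I Complex.I)

/-- The Laplace-Beltrami operator of `g`.  In the preferred chart at `x`, which is holomorphic,
`g = G (dx² + dy²)` and the operator is `G⁻¹ (∂²/∂x² + ∂²/∂y²)`. -/
def laplaceBeltrami (g : HermitianMetric ℂ S) (u : S → ℝ) (x : S) : ℝ :=
  (g.inner x (1 : ℂ) (1 : ℂ))⁻¹ *
    Laplacian.laplacian (fun z : ℂ => u ((extChartAt 𝓘(ℝ, ℂ) x).symm z))
      (extChartAt 𝓘(ℝ, ℂ) x x)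

section Surface

variable {g : HermitianMetric ℂ S}

/-- The unitary coframe `φ` on the Riemann surface, `g = φ ⊗ conj φ + conj φ ⊗ φ`. -/
abbrev phi (ε : UnitaryFrame Unit g) (x : S) : TangentSpace 𝓘(ℝ, ℂ) x →L[ℝ] ℂ := ε.dual () x

/-- The connection form `ρ` on the Riemann surface: `dφ = -i ρ ∧ φ` and `conj ρ = ρ`. -/
def rho (ε : UnitaryFrame Unit g) (x : S) : TangentSpace 𝓘(ℝ, ℂ) x →L[ℝ] ℂ :=
  (-Complex.I) • ε.conn () () x

/-- The Gaussian curvature `K`, defined by `dρ = -i K φ ∧ conj φ` (here `i φ ∧ conj φ` is the area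
form).  The complex number of which the real part is taken is real. -/
def gaussK (ε : UnitaryFrame Unit g) (x : S) : ℝ :=
  (Complex.I * ev11 (dForm (rho ε) x) (ε.vec () x) (ε.vec () x)).re

/-- The form `ρ` is real. -/
theorem rho_real (ε : UnitaryFrame Unit g) (x : S) (v : TangentSpace 𝓘(ℝ, ℂ) x) :
    conj (rho ε x v) = rho ε x v := by
  have h1 := ε.conn_skew () () x v
  have h2 : conj (ε.conn () () x v) = - ε.conn () () x v := by linear_combination h1
  simp [rho, h2]

end Surface

/-- The energy density `e(f)`: half of the trace with respect to `g` of the pulled back metric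
`f^* h`. -/
def energyDensity (g : HermitianMetric ℂ S) (h : HermitianMetric E M) (f : S → M) (x : S) : ℝ :=
  trace g (x := x) (fun v w => h.inner (f x) (mfderiv 𝓘(ℝ, ℂ) 𝓘(ℝ, E) f x v)
    (mfderiv 𝓘(ℝ, ℂ) 𝓘(ℝ, E) f x w)) / 2

section Frames

variable {g : HermitianMetric ℂ S} {h : HermitianMetric E M} {ι : Type} [DecidableEq ι] [Fintype ι]

/-- The pull-back under `f` of a `1`-form at `f x`. -/
def pull (f : S → M) (x : S) (α : TangentSpace 𝓘(ℝ, E) (f x) → ℂ) (v : TangentSpace 𝓘(ℝ, ℂ) x) :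
    ℂ :=
  α (mfderiv 𝓘(ℝ, ℂ) 𝓘(ℝ, E) f x v)

/-- `a^i_1`, where `f^* ω^i = a^i_1 φ + a^i_{\bar 1} conj φ`. -/
def a1 (ε : UnitaryFrame Unit g) (e : UnitaryFrame ι h) (f : S → M) (i : ι) (x : S) : ℂ :=
  holPart (pull f x (e.dual i (f x))) (ε.vec () x)

/-- `a^i_{\bar 1}`, where `f^* ω^i = a^i_1 φ + a^i_{\bar 1} conj φ`. -/
def ab (ε : UnitaryFrame Unit g) (e : UnitaryFrame ι h) (f : S → M) (i : ι) (x : S) : ℂ :=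
  antiPart (pull f x (e.dual i (f x))) (ε.vec () x)

/-- The `1`-form `da^i_1 - i ρ a^i_1 + ∑ j, a^j_1 f^* ω^i_j`. -/
def Da1 (ε : UnitaryFrame Unit g) (e : UnitaryFrame ι h) (f : S → M) (i : ι) (x : S)
    (v : TangentSpace 𝓘(ℝ, ℂ) x) : ℂ :=
  (show ℂ from mfderiv 𝓘(ℝ, ℂ) 𝓘(ℝ, ℂ) (a1 ε e f i) x v) - Complex.I * rho ε x v * a1 ε e f i x +
    ∑ j, a1 ε e f j x * pull f x (e.conn i j (f x)) v

/-- The `1`-form `da^i_{\bar 1} + i ρ a^i_{\bar 1} + ∑ j, a^j_{\bar 1} f^* ω^i_j`. -/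
def Dab (ε : UnitaryFrame Unit g) (e : UnitaryFrame ι h) (f : S → M) (i : ι) (x : S)
    (v : TangentSpace 𝓘(ℝ, ℂ) x) : ℂ :=
  (show ℂ from mfderiv 𝓘(ℝ, ℂ) 𝓘(ℝ, ℂ) (ab ε e f i) x v) + Complex.I * rho ε x v * ab ε e f i x +
    ∑ j, ab ε e f j x * pull f x (e.conn i j (f x)) v

/-- `a^i_{11}`, the coefficient of `φ` in `Da1`. -/
def a11 (ε : UnitaryFrame Unit g) (e : UnitaryFrame ι h) (f : S → M) (i : ι) (x : S) : ℂ :=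
  holPart (Da1 ε e f i x) (ε.vec () x)

/-- `a^i_{1 \bar 1}`, the coefficient of `conj φ` in `Da1`. -/
def a1b (ε : UnitaryFrame Unit g) (e : UnitaryFrame ι h) (f : S → M) (i : ι) (x : S) : ℂ :=
  antiPart (Da1 ε e f i x) (ε.vec () x)

/-- `a^i_{\bar 1 1}`, the coefficient of `φ` in `Dab`. -/
def ab1 (ε : UnitaryFrame Unit g) (e : UnitaryFrame ι h) (f : S → M) (i : ι) (x : S) : ℂ :=
  holPart (Dab ε e f i x) (ε.vec () x)

/-- `a^i_{\bar 1 \bar 1}`, the coefficient of `conj φ` in `Dab`. -/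
def abb (ε : UnitaryFrame Unit g) (e : UnitaryFrame ι h) (f : S → M) (i : ι) (x : S) : ℂ :=
  antiPart (Dab ε e f i x) (ε.vec () x)

/-- The second fundamental form `∇df` at `x`, the covariant derivative of the section `df` of
`T^*S ⊗ f^{-1}TM` for the connection induced by the Levi-Civita connection of `g` and the Chern
connection of `h`: its component along the `i`-th vector of the frame is
`(Da1)(v) φ(w) + (Dab)(v) conj φ(w)`, where `v` is the direction of differentiation. -/
def nablaDf (ε : UnitaryFrame Unit g) (e : UnitaryFrame ι h) (f : S → M) (x : S)
    (v w : TangentSpace 𝓘(ℝ, ℂ) x) : TangentSpace 𝓘(ℝ, E) (f x) :=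
  ∑ i, csmul (Da1 ε e f i x v * phi ε x w + Dab ε e f i x v * conj (phi ε x w)) (e.vec i (f x))

/-- The squared norm of `∇df` with respect to `g` and `h`. -/
def normSqNablaDf (ε : UnitaryFrame Unit g) (e : UnitaryFrame ι h) (f : S → M) (x : S) : ℝ :=
  trace g (x := x) (fun v v' => trace g (x := x) (fun w w' =>
    h.inner (f x) (nablaDf ε e f x v w) (nablaDf ε e f x v' w')))

/-- `Ω^i_j / (φ ∧ conj φ)`: the coefficient of the pull-back of `Ω^i_j` with respect to the
`2`-form `φ ∧ conj φ`. -/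
def curvCoeff (ε : UnitaryFrame Unit g) (e : UnitaryFrame ι h) (f : S → M) (i j : ι) (x : S) : ℂ :=
  ∑ k, ∑ l, (2 * e.R20 i j k l (f x) * a1 ε e f k x * ab ε e f l x +
    e.R11 i j k l (f x) *
      (a1 ε e f k x * conj (a1 ε e f l x) - ab ε e f k x * conj (ab ε e f l x)) +
    2 * e.R02 i j k l (f x) * conj (ab ε e f k x) * conj (a1 ε e f l x))

/-- `|A|² = ∑ i, (|a^i_{11}|² + 2 |a^i_{1 \bar 1}|² + |a^i_{\bar 1 \bar 1}|²)`. -/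
def normSqA (ε : UnitaryFrame Unit g) (e : UnitaryFrame ι h) (f : S → M) (x : S) : ℝ :=
  ∑ i, (‖a11 ε e f i x‖ ^ 2 + 2 * ‖a1b ε e f i x‖ ^ 2 + ‖abb ε e f i x‖ ^ 2)

end Frames

/-- A smooth map `f` from a Riemann surface to a Hermitian surface is Chern-harmonic if
`tr ∇df = 0`, where `∇df` is computed in local unitary frames (it does not depend on them). -/
def IsChernHarmonic {M : Type*} [TopologicalSpace M] [ChartedSpace (EuclideanSpace ℂ (Fin 2)) M]
    [IsManifold 𝓘(ℂ, EuclideanSpace ℂ (Fin 2)) ω M]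
    (g : HermitianMetric ℂ S) (h : HermitianMetric (EuclideanSpace ℂ (Fin 2)) M) (f : S → M) :
    Prop :=
  ContMDiff 𝓘(ℝ, ℂ) 𝓘(ℝ, EuclideanSpace ℂ (Fin 2)) ∞ f ∧
  ∀ (ε : UnitaryFrame Unit g) (e : UnitaryFrame (Fin 2) h), Set.MapsTo f ε.domain e.domain →
    ∀ x ∈ ε.domain, trace g (nablaDf ε e f x) = 0

end Maps

end ChernHarmonic

end

open ChernHarmonic

noncomputable section

/-! In a conformal coordinate `z` write `φ = λ dz`, so that the metric has conformal factor `2|λ|²`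
and the Laplacian is `(2|λ|²)⁻¹ · 4 ∂_{\bar z} ∂_z`. In unitary frames `df` becomes two sections:
`a_1`, a section of `f⁻¹TM` with connection twisted by `-iρ`, and `a_{\bar 1}`, with connection
twisted by `+iρ`. The energy density is the sum of their squared lengths (`energyDensity_eq`).

For a section `s` of a unitary bundle, `∂_{\bar z} ∂_z |s|²` is `|∇_z s|² + |∇_{\bar z} s|²` plus
the pairings of `s` with the mixed second derivatives, one in each order
(`laplacian_normSq_section`). The Ricci identity trades one order for the other at the cost of a
curvature term (`hol_anti_ricci`). So for each of the two sections a single mixed second derivative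
has to be found. The twist by `ρ` contributes the Gaussian curvature, the rest of the curvature is
`f^* Ω` (`curvature_theta`).

Two facts make that derivative computable. The Chern torsion is purely of type `(2,0)`, and pulling
the first structure equation back by `f` gives `a_{\bar 1 1} - a_{1 \bar 1} = 2W` with `W^i =
L^i_{jk} a^j_1 a^k_{\bar 1}` (`ab1_sub_a1b`). Harmonicity says that `a_{\bar 1 1} + a_{1 \bar 1} =
0` (`dual_trace_nablaDf`). Hence `a_{\bar 1 1} = W` and `a_{1 \bar 1} = -W`: the mixed first
covariant derivatives are algebraic in `df` and the torsion.

It remains to differentiate `W` once. The opposite twists of `a_1` and `a_{\bar 1}` cancel in the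
product, so `W` is a section of the untwisted `f⁻¹TM`, and the Leibniz rule (`leibniz_torsion`)
produces the covariant derivative of `L`. The equation `dφ = -iρ ∧ φ` says `∂_{\bar z} λ = -iρ_{\bar
z} λ` (`anti_fderiv_coframeCoeff`), so the factors `λ`, `conj λ` pass through the derivative and
absorb the remaining twist (`hol_anti_of_anti_eq`, `anti_hol_of_hol_eq`). For `a_1` the
`(0,1)`-derivative is taken before the `(1,0)`-derivative and for `a_{\bar 1}` the order is
reversed, which accounts for the opposite signs of both the curvature and the torsion terms.

On a manifold, `dForm` at a point is computed in the preferred chart at that very point. Its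
independence of the chart (`dForm_chart`) is needed before the connection and torsion coefficients
can be differentiated; after that the argument takes place on an open subset of `ℂ`. -/

namespace ChernHarmonic

/-! ### Exterior derivatives and covariant derivatives on a normed space. -/

section ExteriorDerivative

variable {E : Type*} [NormedAddCommGroup E] [NormedSpace ℝ E]
  {F : Type*} [NormedAddCommGroup F] [NormedSpace ℝ F]

/-- The exterior derivative of a complex-valued `1`-form on a normed space. -/
def extD (α : E → E →L[ℝ] ℂ) (u v w : E) : ℂ := fderiv ℝ α u v w - fderiv ℝ α u w v

theorem extD_congr {α β : E → E →L[ℝ] ℂ} {u : E} (h : α =ᶠ[nhds u] β) (v w : E) :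
    extD α u v w = extD β u v w := by
  simp only [extD, h.fderiv_eq]

/-- The exterior derivative commutes with pull-backs. -/
theorem extD_pullback {G : E → F} {α : F → F →L[ℝ] ℂ} {u : E} (hG : ContDiffAt ℝ 2 G u)
    (hα : DifferentiableAt ℝ α (G u)) (v w : E) :
    extD (fun z => (α (G z)).comp (fderiv ℝ G z)) u v w =
      extD α (G u) (fderiv ℝ G u v) (fderiv ℝ G u w) := by
  have h1 : HasFDerivAt G (fderiv ℝ G u) u := (hG.differentiableAt (by norm_num)).hasFDerivAt
  have h2 : HasFDerivAt (fderiv ℝ G) (fderiv ℝ (fderiv ℝ G) u) u :=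
    ((hG.fderiv_right (m := 1) (by norm_num)).differentiableAt (by norm_num)).hasFDerivAt
  have h3 : HasFDerivAt (fun z => α (G z)) ((fderiv ℝ α (G u)).comp (fderiv ℝ G u)) u :=
    hα.hasFDerivAt.comp u h1
  have h4 := h3.clm_comp h2
  have hs : fderiv ℝ (fderiv ℝ G) u v w = fderiv ℝ (fderiv ℝ G) u w v :=
    (hG.isSymmSndFDerivAt (by simp)).eq v w
  simp only [extD, h4.fderiv]
  simp [hs]

/-- Applied to `ρ`, this shows that the complex number whose real part defines `gaussK` is real. -/
theorem extD_real {α : E → E →L[ℝ] ℂ} {u : E} (hα : DifferentiableAt ℝ α u)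
    (h : ∀ᶠ z in nhds u, ∀ v, conj (α z v) = α z v) (v w : E) :
    conj (extD α u v w) = extD α u v w := by
  have key : ∀ a b, conj (fderiv ℝ α u a b) = fderiv ℝ α u a b := by
    intro a b
    have h1 : HasFDerivAt (fun z => α z b) ((fderiv ℝ α u).flip b) u := by
      simpa using hα.hasFDerivAt.clm_apply (hasFDerivAt_const b u)
    have h2 : HasFDerivAt (fun z => conj (α z b))
        ((Complex.conjCLE : ℂ →L[ℝ] ℂ).comp ((fderiv ℝ α u).flip b)) u :=
      (Complex.conjCLE : ℂ →L[ℝ] ℂ).hasFDerivAt.comp u h1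
    have h3 : (fun z => conj (α z b)) =ᶠ[nhds u] fun z => α z b := h.mono fun z hz => hz b
    have h4 := (h2.congr_of_eventuallyEq h3.symm).unique h1
    simpa using congrArg (fun L => L a) h4
  simp [extD, key]

variable {ι : Type*} [Fintype ι]

/-- The covariant derivative `ds^i + ∑ j, s^j θ^i_j` of a section. -/
def covD (s : ι → E → ℂ) (θ : ι → ι → E → E →L[ℝ] ℂ) (i : ι) (z : E) : E →L[ℝ] ℂ :=
  fderiv ℝ (s i) z + ∑ j, s j z • θ i j z

theorem differentiableAt_covD {s : ι → E → ℂ} {θ : ι → ι → E → E →L[ℝ] ℂ} {z : E}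
    (hs : ∀ i, ContDiffAt ℝ 2 (s i) z) (hθ : ∀ i j, DifferentiableAt ℝ (θ i j) z) (i : ι) :
    DifferentiableAt ℝ (covD s θ i) z := by
  have h2 : ∀ i, DifferentiableAt ℝ (fderiv ℝ (s i)) z := fun i =>
    (((hs i).fderiv_right (m := 1) (by norm_num)).differentiableAt (by norm_num))
  have h1 : ∀ i, DifferentiableAt ℝ (s i) z := fun i => (hs i).differentiableAt (by norm_num)
  unfold covD
  exact (h2 i).add (DifferentiableAt.fun_sum fun j _ => (h1 j).smul (hθ i j))

/-- The Ricci identity: the exterior covariant derivative of `covD s θ` is given by the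
curvature. -/
theorem extD_covD {s : ι → E → ℂ} {θ : ι → ι → E → E →L[ℝ] ℂ} {z : E}
    (hs : ∀ i, ContDiffAt ℝ 2 (s i) z) (hθ : ∀ i j, DifferentiableAt ℝ (θ i j) z) (i : ι)
    (v w : E) :
    extD (covD s θ i) z v w + ∑ j, wedge (θ i j z) (covD s θ j z) v w =
      ∑ j, s j z * (extD (θ i j) z v w + ∑ k, wedge (θ i k z) (θ k j z) v w) := by
  have h2 : ∀ i, HasFDerivAt (fderiv ℝ (s i)) (fderiv ℝ (fderiv ℝ (s i)) z) z := fun i =>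
    (((hs i).fderiv_right (m := 1) (by norm_num)).differentiableAt (by norm_num)).hasFDerivAt
  have h1 : ∀ i, HasFDerivAt (s i) (fderiv ℝ (s i) z) z := fun i =>
    ((hs i).differentiableAt (by norm_num)).hasFDerivAt
  -- `d(ds^i) = 0`, so only derivatives of the terms `s^j θ^i_j` survive.
  have hsy : fderiv ℝ (fderiv ℝ (s i)) z v w = fderiv ℝ (fderiv ℝ (s i)) z w v :=
    ((hs i).isSymmSndFDerivAt (by simp)).eq v w
  have hD : HasFDerivAt (covD s θ i) _ z := (h2 i).add
    (HasFDerivAt.fun_sum (u := Finset.univ) fun j _ => (h1 j).smul (hθ i j).hasFDerivAt)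
  have hx : extD (covD s θ i) z v w = ∑ j, (s j z * extD (θ i j) z v w +
      (fderiv ℝ (s j) z v * θ i j z w - fderiv ℝ (s j) z w * θ i j z v)) := by
    rw [extD, hD.fderiv]
    simp only [_root_.add_apply, _root_.sum_apply,
      _root_.smul_apply, ContinuousLinearMap.smulRight_apply, hsy, smul_eq_mul,
      add_sub_add_left_eq_sub, ← Finset.sum_sub_distrib, extD]
    exact Finset.sum_congr rfl fun j _ => by ring
  -- The products `ds^j ∧ θ^i_j` occur here with the sign opposite to that in `hx`; what is left is
  -- `θ ∧ θ`.
  have hw : ∑ j, wedge (θ i j z) (covD s θ j z) v w =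
      ∑ j, (-(fderiv ℝ (s j) z v * θ i j z w - fderiv ℝ (s j) z w * θ i j z v) +
        s j z * ∑ k, wedge (θ i k z) (θ k j z) v w) := by
    rw [Finset.sum_add_distrib]
    simp only [Finset.mul_sum]
    rw [Finset.sum_comm, ← Finset.sum_add_distrib]
    refine Finset.sum_congr rfl fun j _ => ?_
    simp only [wedge, covD, _root_.add_apply, _root_.sum_apply,
      _root_.smul_apply, smul_eq_mul, mul_add, mul_sub, Finset.sum_sub_distrib,
      Finset.mul_sum]
    simp only [mul_left_comm (s _ z)]
    ring
  rw [hx, hw, ← Finset.sum_add_distrib]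
  exact Finset.sum_congr rfl fun j _ => by ring

end ExteriorDerivative

/-! ### Wirtinger calculus on `ℂ` and the Laplacian of the squared length of a section. -/

section ComplexPlane

/-- The coefficient of `dz` in a real linear form on `ℂ`. -/
def hol : (ℂ →L[ℝ] ℂ) →L[ℝ] ℂ :=
  (1 / 2 : ℂ) • (ContinuousLinearMap.apply ℝ ℂ (1 : ℂ) -
    Complex.I • ContinuousLinearMap.apply ℝ ℂ Complex.I)

/-- The coefficient of `conj dz` in a real linear form on `ℂ`. -/
def anti : (ℂ →L[ℝ] ℂ) →L[ℝ] ℂ :=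
  (1 / 2 : ℂ) • (ContinuousLinearMap.apply ℝ ℂ (1 : ℂ) +
    Complex.I • ContinuousLinearMap.apply ℝ ℂ Complex.I)

theorem hol_apply (ℓ : ℂ →L[ℝ] ℂ) : hol ℓ = (ℓ 1 - Complex.I * ℓ Complex.I) / 2 := by
  simp [hol]; ring

theorem anti_apply (ℓ : ℂ →L[ℝ] ℂ) : anti ℓ = (ℓ 1 + Complex.I * ℓ Complex.I) / 2 := by
  simp [anti]; ring

theorem hol_smul (c : ℂ) (ℓ : ℂ →L[ℝ] ℂ) : hol (c • ℓ) = c * hol ℓ := by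
  simp [hol_apply]; ring

theorem anti_smul (c : ℂ) (ℓ : ℂ →L[ℝ] ℂ) : anti (c • ℓ) = c * anti ℓ := by
  simp [anti_apply]; ring

theorem apply_eq_hol_anti (ℓ : ℂ →L[ℝ] ℂ) (v : ℂ) : ℓ v = hol ℓ * v + anti ℓ * conj v := by
  have h : ℓ v = v.re * ℓ 1 + v.im * ℓ Complex.I := by
    conv_lhs => rw [show v = v.re • (1 : ℂ) + v.im • Complex.I by
      simp [Complex.re_add_im]]
    rw [map_add, map_smul, map_smul]; simp
  have h1 : (v : ℂ) = v.re + v.im * Complex.I := (Complex.re_add_im v).symm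
  have h2 : conj v = v.re - v.im * Complex.I := by
    apply Complex.ext <;> simp
  rw [h, hol_apply, anti_apply, h2]
  linear_combination (-(ℓ 1 - Complex.I * ℓ Complex.I) / 2) * h1 +
    (v.im * ℓ Complex.I) * Complex.I_sq

theorem conj_hol {ℓ ℓ' : ℂ →L[ℝ] ℂ} (h : ∀ v, ℓ' v = conj (ℓ v)) : hol ℓ' = conj (anti ℓ) := by
  simp [hol_apply, anti_apply, h, map_ofNat, sub_eq_add_neg]

theorem conj_anti {ℓ ℓ' : ℂ →L[ℝ] ℂ} (h : ∀ v, ℓ' v = conj (ℓ v)) : anti ℓ' = conj (hol ℓ) := by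
  simp [hol_apply, anti_apply, h, map_ofNat]

/-- The coefficient of `dz ∧ conj dz` in `α ∧ β`. -/
theorem wedge_one_I (α β : ℂ →L[ℝ] ℂ) :
    Complex.I / 2 * wedge α β 1 Complex.I = hol α * anti β - anti α * hol β := by
  simp only [wedge, hol_apply, anti_apply]
  ring

/-- The `dz ∧ conj dz` coefficient of `dα` is `∂_z` of the `conj dz` part minus `∂_{\bar z}` of the
`dz` part. The factor `i/2` is there because `dz ∧ conj dz` has the value `-2i` on `(1, i)`. -/
theorem extD_one_I {α : ℂ → ℂ →L[ℝ] ℂ} {z : ℂ} (hα : DifferentiableAt ℝ α z) :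
    Complex.I / 2 * extD α z 1 Complex.I =
      hol (fderiv ℝ (fun u => anti (α u)) z) - anti (fderiv ℝ (fun u => hol (α u)) z) := by
  have h1 : fderiv ℝ (fun u => anti (α u)) z = anti.comp (fderiv ℝ α z) :=
    (anti.hasFDerivAt.comp z hα.hasFDerivAt).fderiv
  have h2 : fderiv ℝ (fun u => hol (α u)) z = hol.comp (fderiv ℝ α z) :=
    (hol.hasFDerivAt.comp z hα.hasFDerivAt).fderiv
  rw [h1, h2]
  simp only [hol_apply, anti_apply, ContinuousLinearMap.comp_apply, extD]
  ring

/-- This is `Δ = 4 ∂_{\bar z} ∂_z`. The real function is replaced by a complex-valued one so that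
`|s|²` can be differentiated as the product `s * conj s`. -/
theorem laplacian_eq_anti_hol {u : ℂ → ℝ} {U : ℂ → ℂ} {z : ℂ} (hu : ∀ᶠ w in nhds z, (u w : ℂ) = U w)
    (hU : ContDiffAt ℝ 2 U z) :
    (Laplacian.laplacian u z : ℂ) = 4 * anti (fderiv ℝ (fun w => hol (fderiv ℝ U w)) z) := by
  have hu' : ContDiffAt ℝ 2 u z := by
    have h1 : ContDiffAt ℝ 2 (fun w => (U w).re) z :=
      Complex.reCLM.contDiff.contDiffAt.comp z hU
    refine h1.congr_of_eventuallyEq (hu.mono fun w hw => ?_)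
    simp [← hw]
  have h1 : (Laplacian.laplacian u z : ℂ) = Laplacian.laplacian U z := by
    have h2 := hu'.laplacian_CLM_comp_left (l := Complex.ofRealCLM)
    have h3 : (Complex.ofRealCLM ∘ u) =ᶠ[nhds z] U := hu
    have h4 := (InnerProductSpace.laplacian_congr_nhds h3).self_of_nhds
    rw [← h4, h2]; simp
  have hd : DifferentiableAt ℝ (fderiv ℝ U) z :=
    (hU.fderiv_right (m := 1) (by norm_num)).differentiableAt (by norm_num)
  have h2 : fderiv ℝ (fun u => hol (fderiv ℝ U u)) z = hol.comp (fderiv ℝ (fderiv ℝ U) z) :=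
    (hol.hasFDerivAt.comp z hd.hasFDerivAt).fderiv
  have hsy : fderiv ℝ (fderiv ℝ U) z 1 Complex.I = fderiv ℝ (fderiv ℝ U) z Complex.I 1 :=
    (hU.isSymmSndFDerivAt (by simp)).eq _ _
  rw [h1, InnerProductSpace.laplacian_eq_iteratedFDeriv_complexPlane, h2]
  simp only [iteratedFDeriv_two_apply, hol_apply, anti_apply, ContinuousLinearMap.comp_apply,
    Matrix.cons_val_zero, Matrix.cons_val_one, hsy]
  linear_combination (fderiv ℝ (fderiv ℝ U) z Complex.I Complex.I) * Complex.I_sq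

variable {ι : Type*} [Fintype ι]

/-- The Bochner formula for the squared length of a section of a unitary bundle over a domain
in `ℂ`. -/
theorem laplacian_normSq_section {s : ι → ℂ → ℂ} {θ : ι → ι → ℂ → ℂ →L[ℝ] ℂ} {z : ℂ}
    (hs : ∀ i, ContDiffAt ℝ 2 (s i) z) (hθ : ∀ i j, DifferentiableAt ℝ (θ i j) z)
    (hskew : ∀ᶠ w in nhds z, ∀ i j v, θ j i w v + conj (θ i j w v) = 0) :
    (Laplacian.laplacian (fun w => ∑ i, ‖s i w‖ ^ 2) z : ℂ) =
      4 * ∑ i, (((‖hol (covD s θ i z)‖ ^ 2 + ‖anti (covD s θ i z)‖ ^ 2 : ℝ) : ℂ) +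
        (anti (fderiv ℝ (fun w => hol (covD s θ i w)) z) +
          ∑ j, hol (covD s θ j z) * anti (θ i j z)) * conj (s i z) +
        s i z * conj (hol (fderiv ℝ (fun w => anti (covD s θ i w)) z) +
          ∑ j, anti (covD s θ j z) * hol (θ i j z))) := by
  set D := covD s θ with hDdef
  have hc : ContDiff ℝ 2 (fun c : ℂ => conj c) := Complex.conjCLE.contDiff
  have hsc : ∀ i, ContDiffAt ℝ 2 (fun w => conj (s i w)) z := fun i =>
    hc.contDiffAt.comp z (hs i)
  have hDd : ∀ i, DifferentiableAt ℝ (D i) z := differentiableAt_covD hs hθ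
  have hU : ContDiffAt ℝ 2 (fun w => ∑ i, s i w * conj (s i w)) z :=
    ContDiffAt.sum fun i _ => (hs i).mul (hsc i)
  rw [laplacian_eq_anti_hol (U := fun w => ∑ i, s i w * conj (s i w)) ?_ hU]
  swap
  · refine Filter.Eventually.of_forall fun w => ?_
    simp [Complex.mul_conj, Complex.normSq_eq_norm_sq]
  congr 1
  have hfs : ∀ w, (∀ i, DifferentiableAt ℝ (s i) w) →
      ∀ i, HasFDerivAt (fun w => conj (s i w)) ((Complex.conjCLE : ℂ →L[ℝ] ℂ).comp
        (fderiv ℝ (s i) w)) w := fun w hw i =>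
    (Complex.conjCLE : ℂ →L[ℝ] ℂ).hasFDerivAt.comp w (hw i).hasFDerivAt
  have hds : ∀ᶠ w in nhds z, ∀ i, DifferentiableAt ℝ (s i) w := by
    rw [Filter.eventually_all]
    exact fun i => ((hs i).eventually (by simp)).mono fun w hw => hw.differentiableAt (by norm_num)
  -- Skew-Hermitian connection forms: the `(0,1)`-part is minus the conjugate transpose of the
  -- `(1,0)`-part.
  have hanti : ∀ w, (∀ i j v, θ j i w v + conj (θ i j w v) = 0) → ∀ i j,
      anti (θ i j w) = - conj (hol (θ j i w)) := by
    intro w hw i j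
    have : ∀ v, θ i j w v = - conj (θ j i w v) := fun v => by
      linear_combination hw j i v
    simp only [hol_apply, anti_apply, this]
    simp [map_ofNat]; ring
  -- The connection is metric, so ordinary derivatives of `|s|²` may be replaced by covariant ones.
  -- The identity is needed on a neighbourhood because it is differentiated again.
  have first : (fun w => hol (fderiv ℝ (fun w => ∑ i, s i w * conj (s i w)) w)) =ᶠ[nhds z]
      fun w => ∑ i, (hol (D i w) * conj (s i w) + s i w * conj (anti (D i w))) := by
    filter_upwards [hds, hskew] with w hw hsk
    have h1 := HasFDerivAt.fun_sum (u := Finset.univ) fun i _ =>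
      (hw i).hasFDerivAt.fun_mul (hfs w hw i)
    rw [h1.fderiv]
    have hsw : ∀ i, hol (fderiv ℝ (s i) w) = hol (D i w) - ∑ j, s j w * hol (θ i j w) := by
      intro i; simp [hDdef, covD, map_sum, hol_smul]
    have hsw' : ∀ i, anti (fderiv ℝ (s i) w) = anti (D i w) - ∑ j, s j w * anti (θ i j w) := by
      intro i; simp [hDdef, covD, map_sum, anti_smul]
    have hcj : ∀ i, hol ((Complex.conjCLE : ℂ →L[ℝ] ℂ).comp (fderiv ℝ (s i) w)) =
        conj (anti (fderiv ℝ (s i) w)) := fun i => conj_hol fun v => rfl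
    simp only [map_sum, map_add, hol_smul, hcj, hsw, hsw', map_sub, map_mul, hanti w hsk,
      map_neg, Complex.conj_conj, mul_sub, Finset.mul_sum, Finset.sum_add_distrib,
      Finset.sum_sub_distrib, mul_neg, Finset.sum_neg_distrib]
    rw [Finset.sum_comm (f := fun i j => conj (s i w) * (s j w * hol (θ i j w)))]
    simp only [mul_left_comm (conj (s _ w)) (s _ w)]
    simp only [mul_comm (conj (s _ w))]
    ring
  have hhol : ∀ i, HasFDerivAt (fun w => hol (D i w)) (hol.comp (fderiv ℝ (D i) z)) z := fun i =>
    hol.hasFDerivAt.comp z (hDd i).hasFDerivAt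
  have hant : ∀ i, HasFDerivAt (fun w => anti (D i w)) (anti.comp (fderiv ℝ (D i) z)) z := fun i =>
    anti.hasFDerivAt.comp z (hDd i).hasFDerivAt
  have hantc : ∀ i, HasFDerivAt (fun w => conj (anti (D i w)))
      ((Complex.conjCLE : ℂ →L[ℝ] ℂ).comp (anti.comp (fderiv ℝ (D i) z))) z := fun i =>
    (Complex.conjCLE : ℂ →L[ℝ] ℂ).hasFDerivAt.comp z (hant i)
  have hz := hds.self_of_nhds
  have hsz : ∀ i, hol (fderiv ℝ (s i) z) = hol (D i z) - ∑ j, s j z * hol (θ i j z) := by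
    intro i; simp [hDdef, covD, map_sum, hol_smul]
  have hsz' : ∀ i, anti (fderiv ℝ (s i) z) = anti (D i z) - ∑ j, s j z * anti (θ i j z) := by
    intro i; simp [hDdef, covD, map_sum, anti_smul]
  have hA : ∀ i, anti ((Complex.conjCLE : ℂ →L[ℝ] ℂ).comp (fderiv ℝ (s i) z)) =
      conj (hol (fderiv ℝ (s i) z)) := fun i => conj_anti fun v => rfl
  have hB : ∀ i, anti ((Complex.conjCLE : ℂ →L[ℝ] ℂ).comp (anti.comp (fderiv ℝ (D i) z))) =
      conj (hol (anti.comp (fderiv ℝ (D i) z))) := fun i => conj_anti fun v => rfl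
  have h2 := HasFDerivAt.fun_sum (u := Finset.univ) fun i _ =>
    ((hhol i).fun_mul (hfs z hz i)).fun_add ((hz i).hasFDerivAt.fun_mul (hantc i))
  rw [first.fderiv_eq, h2.fderiv]
  simp only [(hhol _).fderiv, (hant _).fderiv, map_sum, map_add, anti_smul, hA, hB, hsz, hsz',
    map_sub, map_mul, hanti z hskew.self_of_nhds, mul_sub, mul_add,
    Finset.sum_add_distrib, Finset.sum_sub_distrib, Finset.mul_sum, Finset.sum_mul, add_mul,
    Complex.ofReal_add, Complex.ofReal_pow, ← Complex.conj_mul', mul_neg, Finset.sum_neg_distrib,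
    neg_mul]
  -- Transposing the double sums matches the connection terms coming from `s` with those coming from
  -- `conj s`.
  rw [Finset.sum_comm (f := fun i j => hol (D i z) * (conj (s j z) * conj (hol (θ i j z)))),
    Finset.sum_comm (f := fun i j => s i z * (conj (anti (D j z)) * conj (hol (θ i j z))))]
  have e1 : ∀ i j, conj (anti (D i z)) * (s j z * conj (hol (θ j i z))) =
    s j z * (conj (anti (D i z)) * conj (hol (θ j i z))) := fun i j => by ring
  have e2 : ∀ i j, hol (D j z) * (conj (s i z) * conj (hol (θ j i z))) =
    hol (D j z) * conj (hol (θ j i z)) * conj (s i z) := fun i j => by ring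
  have e3 : ∀ i, hol (D i z) * conj (hol (D i z)) = conj (hol (D i z)) * hol (D i z) :=
    fun i => by ring
  have e4 : ∀ i, conj (s i z) * anti (hol.comp (fderiv ℝ (D i) z)) =
    anti (hol.comp (fderiv ℝ (D i) z)) * conj (s i z) := fun i => by ring
  simp only [e1, e2, e3, e4]
  ring

end ComplexPlane

/-! ### One-forms, maps and exterior derivatives read in preferred charts. -/

section Charts

variable {E : Type*} [NormedAddCommGroup E] [NormedSpace ℝ E]
  {M : Type*} [TopologicalSpace M] [ChartedSpace E M]
  {E' : Type*} [NormedAddCommGroup E'] [NormedSpace ℝ E']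
  {N : Type*} [TopologicalSpace N] [ChartedSpace E' N]

/-- The derivative at `u` of the inverse of the preferred chart at `y₀`. -/
def chartInv (y₀ : M) (u : E) : E →L[ℝ] E :=
  mfderiv 𝓘(ℝ, E) 𝓘(ℝ, E) (extChartAt 𝓘(ℝ, E) y₀).symm u

/-- The derivative at `y` of the preferred chart at `y₀`. -/
def chartD (y₀ y : M) : E →L[ℝ] E :=
  mfderiv 𝓘(ℝ, E) 𝓘(ℝ, E) (extChartAt 𝓘(ℝ, E) y₀) y

/-- A `1`-form read in the preferred chart at `y₀`. -/
def chartForm (y₀ : M) (α : ∀ y : M, TangentSpace 𝓘(ℝ, E) y →L[ℝ] ℂ) (u : E) : E →L[ℝ] ℂ :=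
  (show E →L[ℝ] ℂ from α ((extChartAt 𝓘(ℝ, E) y₀).symm u)).comp (chartInv y₀ u)

/-- The pull-back of a `1`-form. -/
def pullForm (f : N → M) (α : ∀ y : M, TangentSpace 𝓘(ℝ, E) y →L[ℝ] ℂ) (x : N) :
    TangentSpace 𝓘(ℝ, E') x →L[ℝ] ℂ :=
  (α (f x)).comp (mfderiv 𝓘(ℝ, E') 𝓘(ℝ, E) f x)

theorem pullForm_id (α : ∀ y : M, TangentSpace 𝓘(ℝ, E) y →L[ℝ] ℂ) : pullForm (id : M → M) α = α := by
  funext y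
  rw [pullForm, mfderiv_id]
  rfl

/-- A map read in the preferred charts at `x₀` and `y₀`. -/
def chartMap (x₀ : N) (y₀ : M) (f : N → M) (z : E') : E :=
  extChartAt 𝓘(ℝ, E) y₀ (f ((extChartAt 𝓘(ℝ, E') x₀).symm z))

variable [IsManifold 𝓘(ℝ, E) ∞ M] [IsManifold 𝓘(ℝ, E') ∞ N]

theorem mdifferentiableAt_extChartAt_symm {y₀ : M} {u : E}
    (hu : u ∈ (extChartAt 𝓘(ℝ, E) y₀).target) :
    MDifferentiableAt 𝓘(ℝ, E) 𝓘(ℝ, E) (extChartAt 𝓘(ℝ, E) y₀).symm u := by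
  have h := mdifferentiableWithinAt_extChartAt_symm (I := 𝓘(ℝ, E)) (x := y₀) hu
  simpa [mdifferentiableWithinAt_univ] using h

theorem chartD_chartInv {y₀ : M} {u : E} (hu : u ∈ (extChartAt 𝓘(ℝ, E) y₀).target) (v : E) :
    chartD y₀ ((extChartAt 𝓘(ℝ, E) y₀).symm u) (chartInv y₀ u v) = v := by
  have h := mfderiv_extChartAt_comp_mfderivWithin_extChartAt_symm (I := 𝓘(ℝ, E)) hu
  rw [ModelWithCorners.Boundaryless.range_eq_univ, mfderivWithin_univ] at h
  exact congrArg (fun L : E →L[ℝ] E => L v) h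

theorem chartInv_chartD {y₀ : M} {u : E} (hu : u ∈ (extChartAt 𝓘(ℝ, E) y₀).target) (v : E) :
    chartInv y₀ u (chartD y₀ ((extChartAt 𝓘(ℝ, E) y₀).symm u) v) = v := by
  have h := mfderivWithin_extChartAt_symm_comp_mfderiv_extChartAt (I := 𝓘(ℝ, E)) hu
  rw [ModelWithCorners.Boundaryless.range_eq_univ, mfderivWithin_univ] at h
  exact congrArg (fun L : E →L[ℝ] E => L v) h

/-- The tangent space at `y` is by convention read in the preferred chart at `y`, so no change of
coordinates occurs at the base point. -/
theorem chartInv_self (y : M) (v : E) :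
    chartInv y (extChartAt 𝓘(ℝ, E) y y) v = v := by
  have h := mfderivWithin_range_extChartAt_symm (I := 𝓘(ℝ, E)) (x := y)
  rw [ModelWithCorners.Boundaryless.range_eq_univ, mfderivWithin_univ] at h
  exact congrArg (fun L : E →L[ℝ] E => L v) h

/-- Chain rule for two factorisations of one map: near `z`, the inverse chart at `y₀` after
`chartMap` agrees with `f` after the inverse chart at `x₀`. -/
theorem chartInv_fderiv_chartMap {f : N → M} {x₀ : N} {y₀ : M} {z : E'}
    (hz : z ∈ (extChartAt 𝓘(ℝ, E') x₀).target)
    (hf : MDifferentiableAt 𝓘(ℝ, E') 𝓘(ℝ, E) f ((extChartAt 𝓘(ℝ, E') x₀).symm z))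
    (hy : f ((extChartAt 𝓘(ℝ, E') x₀).symm z) ∈ (extChartAt 𝓘(ℝ, E) y₀).source) (v : E') :
    chartInv y₀ (chartMap x₀ y₀ f z) (fderiv ℝ (chartMap x₀ y₀ f) z v) =
      (show E from mfderiv 𝓘(ℝ, E') 𝓘(ℝ, E) f ((extChartAt 𝓘(ℝ, E') x₀).symm z)
        (chartInv x₀ z v)) := by
  have h1 : MDifferentiableAt 𝓘(ℝ, E') 𝓘(ℝ, E') (extChartAt 𝓘(ℝ, E') x₀).symm z :=
    mdifferentiableAt_extChartAt_symm hz
  have h2 : MDifferentiableAt 𝓘(ℝ, E') 𝓘(ℝ, E) (f ∘ (extChartAt 𝓘(ℝ, E') x₀).symm) z :=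
    hf.comp z h1
  have h3 : MDifferentiableAt 𝓘(ℝ, E) 𝓘(ℝ, E) (extChartAt 𝓘(ℝ, E) y₀)
      (f ((extChartAt 𝓘(ℝ, E') x₀).symm z)) :=
    mdifferentiableAt_extChartAt (by rwa [← extChartAt_source 𝓘(ℝ, E)])
  have h4 : MDifferentiableAt 𝓘(ℝ, E') 𝓘(ℝ, E) (chartMap x₀ y₀ f) z := h3.comp z h2
  have h5 : MDifferentiableAt 𝓘(ℝ, E) 𝓘(ℝ, E) (extChartAt 𝓘(ℝ, E) y₀).symm
      (chartMap x₀ y₀ f z) :=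
    mdifferentiableAt_extChartAt_symm ((extChartAt 𝓘(ℝ, E) y₀).map_source hy)
  have e1 := mfderiv_comp z h5 h4
  have e2 := mfderiv_comp z hf h1
  have hev : (extChartAt 𝓘(ℝ, E) y₀).symm ∘ chartMap x₀ y₀ f =ᶠ[nhds z]
      f ∘ (extChartAt 𝓘(ℝ, E') x₀).symm := by
    filter_upwards [h2.continuousAt.preimage_mem_nhds
      ((isOpen_extChartAt_source (I := 𝓘(ℝ, E)) y₀).mem_nhds hy)] with w hw
    exact (extChartAt 𝓘(ℝ, E) y₀).left_inv hw
  have e3 := hev.mfderiv_eq (I := 𝓘(ℝ, E')) (I' := 𝓘(ℝ, E))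
  rw [mfderiv_eq_fderiv] at e1
  exact (congrArg (fun L : E' →L[ℝ] E => L v) e1).symm.trans
    ((congrArg (fun L : E' →L[ℝ] E => L v) e3).trans (congrArg (fun L : E' →L[ℝ] E => L v) e2))

theorem chartForm_pullForm {f : N → M} {x₀ : N} {y₀ : M} {z : E'}
    (α : ∀ y : M, TangentSpace 𝓘(ℝ, E) y →L[ℝ] ℂ)
    (hz : z ∈ (extChartAt 𝓘(ℝ, E') x₀).target)
    (hf : MDifferentiableAt 𝓘(ℝ, E') 𝓘(ℝ, E) f ((extChartAt 𝓘(ℝ, E') x₀).symm z))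
    (hy : f ((extChartAt 𝓘(ℝ, E') x₀).symm z) ∈ (extChartAt 𝓘(ℝ, E) y₀).source) :
    chartForm x₀ (pullForm f α) z =
      (chartForm y₀ α (chartMap x₀ y₀ f z)).comp (fderiv ℝ (chartMap x₀ y₀ f) z) := by
  ext v
  have h := chartInv_fderiv_chartMap hz hf hy v
  -- All tangent spaces are the model space. Forgetting the dependence on the point lets `hl`
  -- rewrite the base point without a transport.
  let A : M → E →L[ℝ] ℂ := α
  have hl : (extChartAt 𝓘(ℝ, E) y₀).symm (chartMap x₀ y₀ f z) =
    f ((extChartAt 𝓘(ℝ, E') x₀).symm z) := (extChartAt 𝓘(ℝ, E) y₀).left_inv hy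
  change A (f ((extChartAt 𝓘(ℝ, E') x₀).symm z)) (show E from mfderiv 𝓘(ℝ, E') 𝓘(ℝ, E) f
      ((extChartAt 𝓘(ℝ, E') x₀).symm z) (chartInv x₀ z v)) =
    A ((extChartAt 𝓘(ℝ, E) y₀).symm (chartMap x₀ y₀ f z))
      (chartInv y₀ (chartMap x₀ y₀ f z) (fderiv ℝ (chartMap x₀ y₀ f) z v))
  rw [hl, h]

theorem contDiffAt_chartMap {f : N → M} (hf : ContMDiff 𝓘(ℝ, E') 𝓘(ℝ, E) ∞ f) {x₀ : N} {y₀ : M}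
    {z : E'} (hz : z ∈ (extChartAt 𝓘(ℝ, E') x₀).target)
    (hy : f ((extChartAt 𝓘(ℝ, E') x₀).symm z) ∈ (extChartAt 𝓘(ℝ, E) y₀).source) :
    ContDiffAt ℝ ∞ (chartMap x₀ y₀ f : E' → E) z := by
  rw [← contMDiffAt_iff_contDiffAt]
  have h1 : ContMDiffAt 𝓘(ℝ, E') 𝓘(ℝ, E') ∞ (extChartAt 𝓘(ℝ, E') x₀).symm z :=
    (contMDiffOn_extChartAt_symm (I := 𝓘(ℝ, E')) x₀).contMDiffAt
      ((isOpen_extChartAt_target (I := 𝓘(ℝ, E')) x₀).mem_nhds hz)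
  have h2 : ContMDiffAt 𝓘(ℝ, E) 𝓘(ℝ, E) ∞ (extChartAt 𝓘(ℝ, E) y₀)
      (f ((extChartAt 𝓘(ℝ, E') x₀).symm z)) :=
    contMDiffAt_extChartAt' (by rwa [← extChartAt_source 𝓘(ℝ, E)])
  exact h2.comp z ((hf _).comp z h1)

theorem eventually_chartForm_pullForm {f : N → M} (hf : ContMDiff 𝓘(ℝ, E') 𝓘(ℝ, E) ∞ f) {x₀ : N}
    {y₀ : M} (α : ∀ y : M, TangentSpace 𝓘(ℝ, E) y →L[ℝ] ℂ)
    (hy : f x₀ ∈ (extChartAt 𝓘(ℝ, E) y₀).source) :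
    chartForm x₀ (pullForm f α) =ᶠ[nhds (extChartAt 𝓘(ℝ, E') x₀ x₀)] fun z =>
      (chartForm y₀ α (chartMap x₀ y₀ f z)).comp (fderiv ℝ (chartMap x₀ y₀ f) z) := by
  have hc : ContinuousAt (f ∘ (extChartAt 𝓘(ℝ, E') x₀).symm) (extChartAt 𝓘(ℝ, E') x₀ x₀) :=
    hf.continuous.continuousAt.comp (continuousAt_extChartAt_symm x₀)
  filter_upwards [extChartAt_target_mem_nhds (I := 𝓘(ℝ, E')) x₀, hc.preimage_mem_nhds
    ((isOpen_extChartAt_source (I := 𝓘(ℝ, E)) y₀).mem_nhds (by simpa using hy))] with z hz hz'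
  exact chartForm_pullForm α hz ((hf _).mdifferentiableAt (by simp)) hz'

/-- The exterior derivative of a pull-back, computed in an arbitrary chart of the target. -/
theorem dForm_pullForm_chart {f : N → M} (hf : ContMDiff 𝓘(ℝ, E') 𝓘(ℝ, E) ∞ f) {x₀ : N}
    {y₀ : M} {α : ∀ y : M, TangentSpace 𝓘(ℝ, E) y →L[ℝ] ℂ}
    (hy : f x₀ ∈ (extChartAt 𝓘(ℝ, E) y₀).source)
    (hα : DifferentiableAt ℝ (chartForm y₀ α) (extChartAt 𝓘(ℝ, E) y₀ (f x₀)))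
    (v w : TangentSpace 𝓘(ℝ, E') x₀) :
    dForm (pullForm f α) x₀ v w = extD (chartForm y₀ α) (extChartAt 𝓘(ℝ, E) y₀ (f x₀))
      (chartD y₀ (f x₀) (mfderiv 𝓘(ℝ, E') 𝓘(ℝ, E) f x₀ v))
      (chartD y₀ (f x₀) (mfderiv 𝓘(ℝ, E') 𝓘(ℝ, E) f x₀ w)) := by
  have hx : (extChartAt 𝓘(ℝ, E') x₀).symm (extChartAt 𝓘(ℝ, E') x₀ x₀) = x₀ :=
    extChartAt_to_inv x₀
  have hz := mem_extChartAt_target (I := 𝓘(ℝ, E')) x₀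
  have hz' : f ((extChartAt 𝓘(ℝ, E') x₀).symm (extChartAt 𝓘(ℝ, E') x₀ x₀)) ∈
    (extChartAt 𝓘(ℝ, E) y₀).source := by rwa [hx]
  have hm : chartMap x₀ y₀ f (extChartAt 𝓘(ℝ, E') x₀ x₀) = extChartAt 𝓘(ℝ, E) y₀ (f x₀) := by
    rw [chartMap, hx]
  -- The derivative with values in the fixed model space, so that the base point may be rewritten by
  -- `hx`.
  let D : N → E' → E := fun p b => mfderiv 𝓘(ℝ, E') 𝓘(ℝ, E) f p b
  have hD : ∀ a : E', fderiv ℝ (chartMap x₀ y₀ f) (extChartAt 𝓘(ℝ, E') x₀ x₀) a =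
      chartD y₀ (f x₀) (D x₀ a) := by
    intro a
    have h1 := chartInv_fderiv_chartMap hz ((hf _).mdifferentiableAt (by simp)) hz' a
    rw [chartInv_self, hm] at h1
    have h2 := chartD_chartInv ((extChartAt 𝓘(ℝ, E) y₀).map_source hy)
      (fderiv ℝ (chartMap x₀ y₀ f) (extChartAt 𝓘(ℝ, E') x₀ x₀) a)
    change _ = D _ a at h1
    rw [hx] at h1
    rw [h1, (extChartAt 𝓘(ℝ, E) y₀).left_inv hy] at h2
    exact h2.symm
  have key : ∀ a b : E', extD (chartForm x₀ (pullForm f α)) (extChartAt 𝓘(ℝ, E') x₀ x₀) a b =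
      extD (chartForm y₀ α) (extChartAt 𝓘(ℝ, E) y₀ (f x₀)) (chartD y₀ (f x₀) (D x₀ a))
        (chartD y₀ (f x₀) (D x₀ b)) := by
    intro a b
    rw [extD_congr (eventually_chartForm_pullForm hf α hy),
      extD_pullback ((contDiffAt_chartMap hf hz hz').of_le (WithTop.coe_le_coe.2 le_top))
        (by rwa [hm]), hm, hD, hD]
  exact key v w

/-- The exterior derivative can be computed in any chart. -/
theorem dForm_chart {y₀ y : M} {α : ∀ y : M, TangentSpace 𝓘(ℝ, E) y →L[ℝ] ℂ}
    (hy : y ∈ (extChartAt 𝓘(ℝ, E) y₀).source)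
    (hα : DifferentiableAt ℝ (chartForm y₀ α) (extChartAt 𝓘(ℝ, E) y₀ y))
    (v w : TangentSpace 𝓘(ℝ, E) y) :
    dForm α y v w = extD (chartForm y₀ α) (extChartAt 𝓘(ℝ, E) y₀ y)
      (chartD y₀ y v) (chartD y₀ y w) := by
  -- A change of chart is the identity map read in two different charts.
  have h := dForm_pullForm_chart (f := (id : M → M)) contMDiff_id hy hα v w
  rw [pullForm_id, mfderiv_id] at h
  exact h

/-- The exterior derivative commutes with pull-backs. -/
theorem dForm_pullForm {f : N → M} (hf : ContMDiff 𝓘(ℝ, E') 𝓘(ℝ, E) ∞ f) {x : N}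
    {α : ∀ y : M, TangentSpace 𝓘(ℝ, E) y →L[ℝ] ℂ}
    (hα : DifferentiableAt ℝ (chartForm (f x) α) (extChartAt 𝓘(ℝ, E) (f x) (f x)))
    (v w : TangentSpace 𝓘(ℝ, E') x) :
    dForm (pullForm f α) x v w = dForm α (f x) (mfderiv 𝓘(ℝ, E') 𝓘(ℝ, E) f x v)
      (mfderiv 𝓘(ℝ, E') 𝓘(ℝ, E) f x w) := by
  rw [dForm_pullForm_chart hf (mem_extChartAt_source _) hα, dForm_chart (mem_extChartAt_source _) hα]

end Charts

/-! ### Smooth vector fields and metrics in a fixed chart. -/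

section SmoothSections

variable {E : Type*} [NormedAddCommGroup E] [NormedSpace ℝ E]
  {M : Type*} [TopologicalSpace M] [ChartedSpace E M] [IsManifold 𝓘(ℝ, E) ∞ M]

/-- The link between smoothness of sections of the tangent bundle, phrased with trivializations, and
smoothness of their components in the chart at `y₀`. -/
theorem trivializationAt_apply_snd {y₀ y : M} (hy : y ∈ (extChartAt 𝓘(ℝ, E) y₀).source)
    (v : TangentSpace 𝓘(ℝ, E) y) :
    ((trivializationAt E (TangentSpace 𝓘(ℝ, E)) y₀) ⟨y, v⟩).2 = chartD (E := E) y₀ y v := by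
  have hy' : y ∈ (chartAt E y₀).source := by rwa [← extChartAt_source 𝓘(ℝ, E)]
  have h := TangentBundle.continuousLinearMapAt_trivializationAt (I := 𝓘(ℝ, E)) hy'
  have h2 := congrArg (fun L : E →L[ℝ] E => L v) h
  refine Eq.trans ?_ h2
  have hb : y ∈ (trivializationAt E (TangentSpace 𝓘(ℝ, E)) y₀).baseSet := by
    simpa using hy'
  exact (congrFun (Bundle.Trivialization.coe_linearMapAt_of_mem (R := ℝ) _ hb) v).symm

omit [IsManifold 𝓘(ℝ, E) ∞ M] in
theorem eventually_extChartAt_symm_mem {y₀ : M} {u : E} (hu : u ∈ (extChartAt 𝓘(ℝ, E) y₀).target) :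
    ∀ᶠ w in nhds u, w ∈ (extChartAt 𝓘(ℝ, E) y₀).target :=
  (isOpen_extChartAt_target (I := 𝓘(ℝ, E)) y₀).mem_nhds hu

theorem contMDiffAt_extChartAt_symm {y₀ : M} {u : E} (hu : u ∈ (extChartAt 𝓘(ℝ, E) y₀).target) :
    ContMDiffAt 𝓘(ℝ, E) 𝓘(ℝ, E) ∞ (extChartAt 𝓘(ℝ, E) y₀).symm u :=
  (contMDiffOn_extChartAt_symm (I := 𝓘(ℝ, E)) y₀).contMDiffAt
    ((isOpen_extChartAt_target (I := 𝓘(ℝ, E)) y₀).mem_nhds hu)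

theorem contMDiffAt_tangentBundle_iff {y₀ : M} {u : E}
    (hu : u ∈ (extChartAt 𝓘(ℝ, E) y₀).target)
    (s : ∀ w : E, TangentSpace 𝓘(ℝ, E) ((extChartAt 𝓘(ℝ, E) y₀).symm w)) :
    ContMDiffAt 𝓘(ℝ, E) 𝓘(ℝ, E).tangent ∞
      (fun w => (⟨(extChartAt 𝓘(ℝ, E) y₀).symm w, s w⟩ : TangentBundle 𝓘(ℝ, E) M)) u ↔
    ContDiffAt ℝ ∞ (fun w => chartD (E := E) y₀ ((extChartAt 𝓘(ℝ, E) y₀).symm w) (s w)) u := by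
  have hsrc := (extChartAt 𝓘(ℝ, E) y₀).map_target hu
  have hy' : (extChartAt 𝓘(ℝ, E) y₀).symm u ∈ (chartAt E y₀).source := by
    rwa [← extChartAt_source 𝓘(ℝ, E)]
  have h := Bundle.Trivialization.contMDiffAt_iff (IM := 𝓘(ℝ, E)) (IB := 𝓘(ℝ, E)) (n := ∞)
    (e := trivializationAt E (TangentSpace 𝓘(ℝ, E)) y₀)
    (f := fun w => (⟨(extChartAt 𝓘(ℝ, E) y₀).symm w, s w⟩ : TangentBundle 𝓘(ℝ, E) M))
    (x₀ := u) (by simpa [Bundle.Trivialization.mem_source] using hy')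
  refine h.trans ?_
  rw [and_iff_right (contMDiffAt_extChartAt_symm hu), contMDiffAt_iff_contDiffAt]
  have hev : (fun w => ((trivializationAt E (TangentSpace 𝓘(ℝ, E)) y₀)
      ⟨(extChartAt 𝓘(ℝ, E) y₀).symm w, s w⟩).2) =ᶠ[nhds u]
      fun w => chartD (E := E) y₀ ((extChartAt 𝓘(ℝ, E) y₀).symm w) (s w) :=
    (eventually_extChartAt_symm_mem hu).mono fun w hw =>
      trivializationAt_apply_snd ((extChartAt 𝓘(ℝ, E) y₀).map_target hw) _
  exact ⟨fun h => h.congr_of_eventuallyEq hev.symm, fun h => h.congr_of_eventuallyEq hev⟩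

theorem contMDiffAt_section_comp_symm {y₀ : M} {u : E}
    (hu : u ∈ (extChartAt 𝓘(ℝ, E) y₀).target) {X : ∀ y : M, TangentSpace 𝓘(ℝ, E) y}
    (hX : ContMDiffAt 𝓘(ℝ, E) 𝓘(ℝ, E).tangent ∞
      (fun y => (⟨y, X y⟩ : TangentBundle 𝓘(ℝ, E) M)) ((extChartAt 𝓘(ℝ, E) y₀).symm u)) :
    ContMDiffAt 𝓘(ℝ, E) 𝓘(ℝ, E).tangent ∞
      (fun w => (⟨(extChartAt 𝓘(ℝ, E) y₀).symm w, X ((extChartAt 𝓘(ℝ, E) y₀).symm w)⟩ :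
        TangentBundle 𝓘(ℝ, E) M)) u :=
  hX.comp u (contMDiffAt_extChartAt_symm hu)

/-- A smooth vector field is smooth in the preferred chart at `y₀`. -/
theorem contDiffAt_chartD_section {y₀ : M} {u : E}
    (hu : u ∈ (extChartAt 𝓘(ℝ, E) y₀).target) {X : ∀ y : M, TangentSpace 𝓘(ℝ, E) y}
    (hX : ContMDiffAt 𝓘(ℝ, E) 𝓘(ℝ, E).tangent ∞
      (fun y => (⟨y, X y⟩ : TangentBundle 𝓘(ℝ, E) M)) ((extChartAt 𝓘(ℝ, E) y₀).symm u)) :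
    ContDiffAt ℝ ∞ (fun w => chartD (E := E) y₀ ((extChartAt 𝓘(ℝ, E) y₀).symm w)
      (X ((extChartAt 𝓘(ℝ, E) y₀).symm w))) u :=
  (contMDiffAt_tangentBundle_iff hu _).1 (contMDiffAt_section_comp_symm hu hX)

theorem contDiffAt_inner_chartInv
    (h : Bundle.ContMDiffRiemannianMetric 𝓘(ℝ, E) ∞ E (fun y : M => TangentSpace 𝓘(ℝ, E) y))
    {y₀ : M} {u : E} (hu : u ∈ (extChartAt 𝓘(ℝ, E) y₀).target)
    {X : ∀ y : M, TangentSpace 𝓘(ℝ, E) y}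
    (hX : ContMDiffAt 𝓘(ℝ, E) 𝓘(ℝ, E).tangent ∞
      (fun y => (⟨y, X y⟩ : TangentBundle 𝓘(ℝ, E) M)) ((extChartAt 𝓘(ℝ, E) y₀).symm u)) (v : E) :
    ContDiffAt ℝ ∞ (fun w => h.inner ((extChartAt 𝓘(ℝ, E) y₀).symm w)
      (X ((extChartAt 𝓘(ℝ, E) y₀).symm w)) (chartInv y₀ w v)) u := by
  have h2 : ContMDiffAt 𝓘(ℝ, E) 𝓘(ℝ, E).tangent ∞
      (fun w => (⟨(extChartAt 𝓘(ℝ, E) y₀).symm w, chartInv y₀ w v⟩ :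
        TangentBundle 𝓘(ℝ, E) M)) u := by
    -- A coordinate vector field has constant components in its own chart, hence is smooth.
    refine (contMDiffAt_tangentBundle_iff hu (fun w => chartInv y₀ w v)).2 ?_
    refine (contDiffAt_const (c := v)).congr_of_eventuallyEq ?_
    exact (eventually_extChartAt_symm_mem hu).mono fun w hw => chartD_chartInv hw v
  have h1 := contMDiffAt_section_comp_symm hu hX
  have hg : ContMDiffAt 𝓘(ℝ, E) (𝓘(ℝ, E).prod 𝓘(ℝ, E →L[ℝ] E →L[ℝ] ℝ)) ∞
      (fun w => Bundle.TotalSpace.mk' (E →L[ℝ] E →L[ℝ] ℝ)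
        (E := fun y : M => TangentSpace 𝓘(ℝ, E) y →L[ℝ] TangentSpace 𝓘(ℝ, E) y →L[ℝ] ℝ) ((extChartAt 𝓘(ℝ, E) y₀).symm w)
        (h.inner ((extChartAt 𝓘(ℝ, E) y₀).symm w))) u :=
    ContMDiffAt.comp u (h.contMDiff _) (contMDiffAt_extChartAt_symm hu)
  have h3 : ContMDiffAt 𝓘(ℝ, E) (𝓘(ℝ, E).prod 𝓘(ℝ)) ∞
      (fun w => Bundle.TotalSpace.mk' ℝ (E := Bundle.Trivial M ℝ) ((extChartAt 𝓘(ℝ, E) y₀).symm w)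
        (h.inner ((extChartAt 𝓘(ℝ, E) y₀).symm w) (X ((extChartAt 𝓘(ℝ, E) y₀).symm w))
          (chartInv y₀ w v))) u :=
    ContMDiffAt.clm_bundle_apply₂ (F₁ := E) (F₂ := E) hg h1 h2
  rw [Bundle.contMDiffAt_totalSpace] at h3
  exact h3.2.contDiffAt

end SmoothSections

/-! ### Compatibility of the complex structure with the charts. -/

section HolomorphicCharts

variable {E : Type*} [NormedAddCommGroup E] [NormedSpace ℝ E] [NormedSpace ℂ E]
  [IsScalarTower ℝ ℂ E] {M : Type*} [TopologicalSpace M] [ChartedSpace E M]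
  [IsManifold 𝓘(ℂ, E) ω M]

/-- The inverse chart is complex differentiable, and its real derivative is the complex one with
scalars restricted. This is where holomorphy of the atlas enters: `J` is multiplication by `i` in
every chart. -/
theorem chartInv_csmul {y₀ : M} {u : E} (hu : u ∈ (extChartAt 𝓘(ℝ, E) y₀).target) (c : ℂ) (v : E) :
    chartInv y₀ u (c • v) = c • chartInv y₀ u v := by
  have hu' : u ∈ (extChartAt 𝓘(ℂ, E) y₀).target := hu
  have h1 := mdifferentiableWithinAt_extChartAt_symm (I := 𝓘(ℂ, E)) hu'
  rw [ModelWithCorners.Boundaryless.range_eq_univ, mdifferentiableWithinAt_univ] at h1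
  have h2 := h1.hasMFDerivAt
  have h3 : HasMFDerivAt 𝓘(ℝ, E) 𝓘(ℝ, E) (extChartAt 𝓘(ℝ, E) y₀).symm u
      ((show E →L[ℂ] E from mfderiv 𝓘(ℂ, E) 𝓘(ℂ, E)
        (extChartAt 𝓘(ℂ, E) y₀).symm u).restrictScalars ℝ) :=
    ⟨h2.1, HasFDerivWithinAt.restrictScalars ℝ h2.2⟩
  have h4 : chartInv y₀ u = (show E →L[ℂ] E from mfderiv 𝓘(ℂ, E) 𝓘(ℂ, E)
        (extChartAt 𝓘(ℂ, E) y₀).symm u).restrictScalars ℝ := h3.mfderiv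
  rw [h4]
  exact map_smul (show E →L[ℂ] E from mfderiv 𝓘(ℂ, E) 𝓘(ℂ, E)
        (extChartAt 𝓘(ℂ, E) y₀).symm u) c v

theorem chartD_csmul {y₀ : M} {u : E} (hu : u ∈ (extChartAt 𝓘(ℝ, E) y₀).target) (c : ℂ) (v : E) :
    chartD y₀ ((extChartAt 𝓘(ℝ, E) y₀).symm u) (c • v) =
      c • chartD y₀ ((extChartAt 𝓘(ℝ, E) y₀).symm u) v := by
  have h := chartInv_csmul hu c (chartD y₀ ((extChartAt 𝓘(ℝ, E) y₀).symm u) v)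
  rw [chartInv_chartD hu] at h
  rw [← h, chartD_chartInv hu]

end HolomorphicCharts

/-! ### Smooth dependence of forms and their exterior derivatives on the point. -/

section SmoothForms

variable {E : Type*} [NormedAddCommGroup E] [NormedSpace ℝ E]
  {M : Type*} [TopologicalSpace M] [ChartedSpace E M] [IsManifold 𝓘(ℝ, E) ∞ M]

omit [IsManifold 𝓘(ℝ, E) ∞ M] in
theorem contDiffAt_extD {α : E → E →L[ℝ] ℂ} {a b : E → E} {u : E} (hα : ContDiffAt ℝ ∞ α u)
    (ha : ContDiffAt ℝ ∞ a u) (hb : ContDiffAt ℝ ∞ b u) :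
    ContDiffAt ℝ ∞ (fun w => extD α w (a w) (b w)) u := by
  have h1 : ContDiffAt ℝ ∞ (fderiv ℝ α) u := hα.fderiv_right (by rfl)
  exact ((h1.clm_apply ha).clm_apply hb).sub ((h1.clm_apply hb).clm_apply ha)

theorem apply_eq_chartForm {y₀ : M} {u : E} (hu : u ∈ (extChartAt 𝓘(ℝ, E) y₀).target)
    (α : ∀ y : M, TangentSpace 𝓘(ℝ, E) y →L[ℝ] ℂ)
    (v : TangentSpace 𝓘(ℝ, E) ((extChartAt 𝓘(ℝ, E) y₀).symm u)) :
    α ((extChartAt 𝓘(ℝ, E) y₀).symm u) v =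
      chartForm y₀ α u (chartD (E := E) y₀ ((extChartAt 𝓘(ℝ, E) y₀).symm u) v) :=
  (congrArg (fun w : E => (show E →L[ℝ] ℂ from α ((extChartAt 𝓘(ℝ, E) y₀).symm u)) w)
    (chartInv_chartD hu v)).symm

theorem contDiffAt_form_apply {y₀ : M} {u : E} (hu : u ∈ (extChartAt 𝓘(ℝ, E) y₀).target)
    {α : ∀ y : M, TangentSpace 𝓘(ℝ, E) y →L[ℝ] ℂ} {a : ∀ y : M, TangentSpace 𝓘(ℝ, E) y}
    (hα : ContDiffAt ℝ ∞ (chartForm y₀ α) u)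
    (ha : ContDiffAt ℝ ∞ (fun w => chartD (E := E) y₀ ((extChartAt 𝓘(ℝ, E) y₀).symm w)
      (a ((extChartAt 𝓘(ℝ, E) y₀).symm w))) u) :
    ContDiffAt ℝ ∞ (fun w => α ((extChartAt 𝓘(ℝ, E) y₀).symm w)
      (a ((extChartAt 𝓘(ℝ, E) y₀).symm w))) u :=
  (hα.clm_apply ha).congr_of_eventuallyEq
    ((eventually_extChartAt_symm_mem hu).mono fun _ hw => apply_eq_chartForm hw α _)

/-- `dForm` uses a chart that moves with the point. Freezing the chart at `y₀` exhibits its values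
as smooth functions of `u`. -/
theorem dForm_symm {y₀ : M} {u : E} (hu : u ∈ (extChartAt 𝓘(ℝ, E) y₀).target)
    {α : ∀ y : M, TangentSpace 𝓘(ℝ, E) y →L[ℝ] ℂ} (hα : DifferentiableAt ℝ (chartForm y₀ α) u)
    (v w : TangentSpace 𝓘(ℝ, E) ((extChartAt 𝓘(ℝ, E) y₀).symm u)) :
    dForm α ((extChartAt 𝓘(ℝ, E) y₀).symm u) v w = extD (chartForm y₀ α) u
      (chartD (E := E) y₀ ((extChartAt 𝓘(ℝ, E) y₀).symm u) v)
      (chartD (E := E) y₀ ((extChartAt 𝓘(ℝ, E) y₀).symm u) w) := by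
  have hr := (extChartAt 𝓘(ℝ, E) y₀).right_inv hu
  have h := dForm_chart (α := α) ((extChartAt 𝓘(ℝ, E) y₀).map_target hu) (by rwa [hr]) v w
  rw [h, hr]

theorem contDiffAt_dForm_apply {y₀ : M} {u : E} (hu : u ∈ (extChartAt 𝓘(ℝ, E) y₀).target)
    {α : ∀ y : M, TangentSpace 𝓘(ℝ, E) y →L[ℝ] ℂ} {a b : ∀ y : M, TangentSpace 𝓘(ℝ, E) y}
    (hα : ContDiffAt ℝ ∞ (chartForm y₀ α) u)
    (ha : ContDiffAt ℝ ∞ (fun w => chartD (E := E) y₀ ((extChartAt 𝓘(ℝ, E) y₀).symm w)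
      (a ((extChartAt 𝓘(ℝ, E) y₀).symm w))) u)
    (hb : ContDiffAt ℝ ∞ (fun w => chartD (E := E) y₀ ((extChartAt 𝓘(ℝ, E) y₀).symm w)
      (b ((extChartAt 𝓘(ℝ, E) y₀).symm w))) u) :
    ContDiffAt ℝ ∞ (fun w => dForm α ((extChartAt 𝓘(ℝ, E) y₀).symm w)
      (a ((extChartAt 𝓘(ℝ, E) y₀).symm w)) (b ((extChartAt 𝓘(ℝ, E) y₀).symm w))) u := by
  refine (contDiffAt_extD hα ha hb).congr_of_eventuallyEq ?_
  filter_upwards [eventually_extChartAt_symm_mem hu,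
    (hα.of_le (m := 1) (WithTop.coe_le_coe.2 le_top)).eventually (by simp)] with w hw hw'
  exact dForm_symm hw (hw'.differentiableAt (by norm_num)) _ _

end SmoothForms

/-! ### Smoothness of the coframe, the connection forms and the torsion. -/

section SmoothFrames

variable {E : Type*} [NormedAddCommGroup E] [NormedSpace ℝ E] [NormedSpace ℂ E]
  [IsScalarTower ℝ ℂ E] {M : Type*} [TopologicalSpace M] [ChartedSpace E M]
  [IsManifold 𝓘(ℂ, E) ω M]

theorem chartD_J {y₀ : M} {u : E} (hu : u ∈ (extChartAt 𝓘(ℝ, E) y₀).target)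
    (v : TangentSpace 𝓘(ℝ, E) ((extChartAt 𝓘(ℝ, E) y₀).symm u)) :
    chartD (E := E) y₀ ((extChartAt 𝓘(ℝ, E) y₀).symm u) (J v) =
      Complex.I • chartD (E := E) y₀ ((extChartAt 𝓘(ℝ, E) y₀).symm u) v :=
  chartD_csmul hu Complex.I v

theorem contDiffAt_J {y₀ : M} {u : E} (hu : u ∈ (extChartAt 𝓘(ℝ, E) y₀).target)
    {a : ∀ y : M, TangentSpace 𝓘(ℝ, E) y}
    (ha : ContDiffAt ℝ ∞ (fun w => chartD (E := E) y₀ ((extChartAt 𝓘(ℝ, E) y₀).symm w)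
      (a ((extChartAt 𝓘(ℝ, E) y₀).symm w))) u) :
    ContDiffAt ℝ ∞ (fun w => chartD (E := E) y₀ ((extChartAt 𝓘(ℝ, E) y₀).symm w)
      (J (a ((extChartAt 𝓘(ℝ, E) y₀).symm w)))) u :=
  (ha.const_smul Complex.I).congr_of_eventuallyEq
    ((eventually_extChartAt_symm_mem hu).mono fun _ hw => chartD_J hw _)

omit [IsScalarTower ℝ ℂ E] [IsManifold 𝓘(ℂ, E) ω M] in
theorem J_J {y : M} (v : TangentSpace 𝓘(ℝ, E) y) : J (J v) = -v := by
  change (Complex.I • (Complex.I • (show E from v)) : E) = -(show E from v)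
  rw [smul_smul, Complex.I_mul_I, neg_one_smul]

theorem HermitianMetric.inner_J_left (h : HermitianMetric E M) (y : M)
    (v w : TangentSpace 𝓘(ℝ, E) y) : h.inner y (J v) w = -h.inner y v (J w) := by
  have := h.inner_J y v (J w)
  rw [J_J, map_neg] at this
  rw [← this, neg_neg]

namespace UnitaryFrame

variable {ι : Type} [DecidableEq ι] {h : HermitianMetric E M}

/-- The part of the model space on which the frame is defined, read in the preferred chart
at `y₀`. -/
def chartDomain (e : UnitaryFrame ι h) (y₀ : M) : Set E :=
  (extChartAt 𝓘(ℝ, E) y₀).target ∩ (extChartAt 𝓘(ℝ, E) y₀).symm ⁻¹' e.domain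

theorem isOpen_chartDomain (e : UnitaryFrame ι h) (y₀ : M) : IsOpen (e.chartDomain y₀) :=
  (continuousOn_extChartAt_symm (I := 𝓘(ℝ, E)) y₀).isOpen_inter_preimage
    (isOpen_extChartAt_target (I := 𝓘(ℝ, E)) y₀) e.isOpen_domain

theorem mem_chartDomain_self (e : UnitaryFrame ι h) {y : M} (hy : y ∈ e.domain) :
    extChartAt 𝓘(ℝ, E) y y ∈ e.chartDomain y :=
  ⟨mem_extChartAt_target y, by simpa using hy⟩

theorem contMDiffAt_vec (e : UnitaryFrame ι h) (i : ι) {y : M} (hy : y ∈ e.domain) :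
    ContMDiffAt 𝓘(ℝ, E) 𝓘(ℝ, E).tangent ∞
      (fun y => (⟨y, e.vec i y⟩ : TangentBundle 𝓘(ℝ, E) M)) y :=
  (e.smooth i).contMDiffAt (e.isOpen_domain.mem_nhds hy)

theorem contDiffAt_vec (e : UnitaryFrame ι h) (i : ι) {y₀ : M} {u : E}
    (hu : u ∈ e.chartDomain y₀) :
    ContDiffAt ℝ ∞ (fun w => chartD (E := E) y₀ ((extChartAt 𝓘(ℝ, E) y₀).symm w)
      (e.vec i ((extChartAt 𝓘(ℝ, E) y₀).symm w))) u :=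
  contDiffAt_chartD_section hu.1 (e.contMDiffAt_vec i hu.2)

theorem dual_apply (e : UnitaryFrame ι h) (i : ι) (y : M) (v : TangentSpace 𝓘(ℝ, E) y) :
    e.dual i y v = 1 / 2 * (h.inner y (e.vec i y) v -
      Complex.I * (h.inner y (e.vec i y) (J v) : ℝ)) := by
  simp [dual, HermitianMetric.herm, h.inner_J_left]
  ring

variable [FiniteDimensional ℝ E]

/-- The real part of the coframe, read in the preferred chart at `y₀`. -/
def innerChart (e : UnitaryFrame ι h) (i : ι) (y₀ : M) (v u : E) : ℝ :=
  h.inner ((extChartAt 𝓘(ℝ, E) y₀).symm u) (e.vec i ((extChartAt 𝓘(ℝ, E) y₀).symm u))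
    (chartInv y₀ u v)

omit [FiniteDimensional ℝ E] in
theorem chartForm_dual_apply (e : UnitaryFrame ι h) (i : ι) {y₀ : M} {u : E}
    (hu : u ∈ (extChartAt 𝓘(ℝ, E) y₀).target) (v : E) :
    chartForm y₀ (e.dual i) u v = (1 / 2 : ℂ) * (Complex.ofRealCLM (e.innerChart i y₀ v u) -
      Complex.I * Complex.ofRealCLM (e.innerChart i y₀ (Complex.I • v) u)) := by
  have h1 : e.innerChart i y₀ (Complex.I • v) u =
      h.inner ((extChartAt 𝓘(ℝ, E) y₀).symm u) (e.vec i ((extChartAt 𝓘(ℝ, E) y₀).symm u))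
        (J (show TangentSpace 𝓘(ℝ, E) ((extChartAt 𝓘(ℝ, E) y₀).symm u) from chartInv y₀ u v)) :=
    congrArg (fun t : E => h.inner ((extChartAt 𝓘(ℝ, E) y₀).symm u)
      (e.vec i ((extChartAt 𝓘(ℝ, E) y₀).symm u)) t) (chartInv_csmul hu Complex.I v)
  have h2 := e.dual_apply i ((extChartAt 𝓘(ℝ, E) y₀).symm u)
    (show TangentSpace 𝓘(ℝ, E) ((extChartAt 𝓘(ℝ, E) y₀).symm u) from chartInv y₀ u v)
  rw [← h1] at h2
  exact h2

omit [FiniteDimensional ℝ E] in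
theorem contDiffAt_dual_apply (e : UnitaryFrame ι h) (i : ι) {y₀ : M} {w : E}
    (hw : w ∈ e.chartDomain y₀) (v : E) :
    ContDiffAt ℝ ∞ (fun w => chartForm y₀ (e.dual i) w v) w := by
  have h1 : ∀ v, ContDiffAt ℝ ∞ (e.innerChart i y₀ v) w := fun v =>
    contDiffAt_inner_chartInv h.toContMDiffRiemannianMetric hw.1 (e.contMDiffAt_vec i hw.2) v
  have hev : (fun w => chartForm y₀ (e.dual i) w v) =ᶠ[nhds w] _ :=
    (eventually_extChartAt_symm_mem hw.1).mono fun w hw => e.chartForm_dual_apply i hw v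
  refine ContDiffAt.congr_of_eventuallyEq ?_ hev
  have h2 := fun v => Complex.ofRealCLM.contDiff.contDiffAt.comp w (h1 v)
  exact contDiffAt_const.mul ((h2 v).sub (contDiffAt_const.mul (h2 (Complex.I • v))))

/-- In finite dimension, smoothness of a map into linear forms may be tested on each fixed vector.
-/
theorem contDiffAt_dual (e : UnitaryFrame ι h) (i : ι) {y₀ : M} {u : E}
    (hu : u ∈ e.chartDomain y₀) : ContDiffAt ℝ ∞ (chartForm y₀ (e.dual i)) u := by
  have hs : ContDiffOn ℝ ∞ (chartForm y₀ (e.dual i)) (e.chartDomain y₀) :=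
    contDiffOn_clm_apply.2 fun v w hw => (e.contDiffAt_dual_apply i hw v).contDiffWithinAt
  exact hs.contDiffAt ((e.isOpen_chartDomain y₀).mem_nhds hu)

theorem contDiffAt_dDual11 (e : UnitaryFrame ι h) (i j k : ι) {y₀ : M} {u : E}
    (hu : u ∈ e.chartDomain y₀) :
    ContDiffAt ℝ ∞ (fun w => e.dDual11 i j k ((extChartAt 𝓘(ℝ, E) y₀).symm w)) u := by
  have hα := e.contDiffAt_dual i hu
  have ha := e.contDiffAt_vec j hu
  have hb := e.contDiffAt_vec k hu
  -- The `(1,1)`-part is a combination of four values of `dForm`, on the frame vectors and their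
  -- images under `J`.
  have h1 := contDiffAt_dForm_apply hu.1 hα ha hb
  have h2 := contDiffAt_dForm_apply hu.1 hα (b := fun y => J (e.vec k y)) ha
    (contDiffAt_J hu.1 hb)
  have h3 := contDiffAt_dForm_apply hu.1 hα (a := fun y => J (e.vec j y))
    (contDiffAt_J hu.1 ha) hb
  have h4 := contDiffAt_dForm_apply hu.1 hα (a := fun y => J (e.vec j y))
    (b := fun y => J (e.vec k y)) (contDiffAt_J hu.1 ha) (contDiffAt_J hu.1 hb)
  simp only [dDual11, ev11, holPart, antiPart]
  fun_prop

variable [Fintype ι]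

omit [FiniteDimensional ℝ E] in
theorem conn_apply (e : UnitaryFrame ι h) (i j : ι) (y : M) (v : TangentSpace 𝓘(ℝ, E) y) :
    e.conn i j y v = ∑ k, (e.dDual11 i j k y * conj (e.dual k y v) -
      conj (e.dDual11 j i k y) * e.dual k y v) := by
  simp [conn]

theorem contDiffAt_conn (e : UnitaryFrame ι h) (i j : ι) {y₀ : M} {u : E}
    (hu : u ∈ e.chartDomain y₀) : ContDiffAt ℝ ∞ (chartForm y₀ (e.conn i j)) u := by
  have key : chartForm y₀ (e.conn i j) = fun w => ∑ k,
      (e.dDual11 i j k ((extChartAt 𝓘(ℝ, E) y₀).symm w) •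
        (Complex.conjCLE : ℂ →L[ℝ] ℂ).comp (chartForm y₀ (e.dual k) w) -
      conj (e.dDual11 j i k ((extChartAt 𝓘(ℝ, E) y₀).symm w)) • chartForm y₀ (e.dual k) w) := by
    funext w
    ext v
    rw [_root_.sum_apply]
    exact e.conn_apply i j _ _
  rw [key]
  refine ContDiffAt.sum fun k _ => ?_
  have h1 := e.contDiffAt_dual k hu
  have h2 := (Complex.conjCLE : ℂ →L[ℝ] ℂ).contDiff.contDiffAt.comp u
    (e.contDiffAt_dDual11 j i k hu)
  exact ((e.contDiffAt_dDual11 i j k hu).smul (contDiffAt_const.clm_comp h1)).sub (h2.smul h1)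

theorem contDiffAt_torsion_apply (e : UnitaryFrame ι h) (i : ι) {y₀ : M} {u : E}
    (hu : u ∈ e.chartDomain y₀) {a b : ∀ y : M, TangentSpace 𝓘(ℝ, E) y}
    (ha : ContDiffAt ℝ ∞ (fun w => chartD (E := E) y₀ ((extChartAt 𝓘(ℝ, E) y₀).symm w)
      (a ((extChartAt 𝓘(ℝ, E) y₀).symm w))) u)
    (hb : ContDiffAt ℝ ∞ (fun w => chartD (E := E) y₀ ((extChartAt 𝓘(ℝ, E) y₀).symm w)
      (b ((extChartAt 𝓘(ℝ, E) y₀).symm w))) u) :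
    ContDiffAt ℝ ∞ (fun w => e.torsion i ((extChartAt 𝓘(ℝ, E) y₀).symm w)
      (a ((extChartAt 𝓘(ℝ, E) y₀).symm w)) (b ((extChartAt 𝓘(ℝ, E) y₀).symm w))) u := by
  refine (contDiffAt_dForm_apply hu.1 (e.contDiffAt_dual i hu) ha hb).add
    (ContDiffAt.sum fun j _ => ?_)
  have hc := e.contDiffAt_conn i j hu
  have hd := e.contDiffAt_dual j hu
  exact ((contDiffAt_form_apply hu.1 hc ha).mul (contDiffAt_form_apply hu.1 hd hb)).sub
    ((contDiffAt_form_apply hu.1 hc hb).mul (contDiffAt_form_apply hu.1 hd ha))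

theorem contDiffAt_L (e : UnitaryFrame ι h) (i j k : ι) {y₀ : M} {u : E}
    (hu : u ∈ e.chartDomain y₀) :
    ContDiffAt ℝ ∞ (fun w => e.L i j k ((extChartAt 𝓘(ℝ, E) y₀).symm w)) u := by
  have ha := e.contDiffAt_vec j hu
  have hb := e.contDiffAt_vec k hu
  have h1 := e.contDiffAt_torsion_apply i hu ha hb
  have h2 := e.contDiffAt_torsion_apply i hu (b := fun y => J (e.vec k y)) ha
    (contDiffAt_J hu.1 hb)
  have h3 := e.contDiffAt_torsion_apply i hu (a := fun y => J (e.vec j y))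
    (contDiffAt_J hu.1 ha) hb
  have h4 := e.contDiffAt_torsion_apply i hu (a := fun y => J (e.vec j y))
    (b := fun y => J (e.vec k y)) (contDiffAt_J hu.1 ha) (contDiffAt_J hu.1 hb)
  simp only [L, ev20, holPart]
  fun_prop

theorem mdifferentiableAt_L (e : UnitaryFrame ι h) (i j k : ι) {y : M} (hy : y ∈ e.domain) :
    MDifferentiableAt 𝓘(ℝ, E) 𝓘(ℝ, ℂ) (e.L i j k) y := by
  have h1 := ((e.contDiffAt_L i j k (e.mem_chartDomain_self hy)).differentiableAt
    (by simp)).mdifferentiableAt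
  have h2 := MDifferentiableAt.comp y h1 (mdifferentiableAt_extChartAt (mem_chart_source E y))
  refine h2.congr_of_eventuallyEq ?_
  filter_upwards [extChartAt_source_mem_nhds (I := 𝓘(ℝ, E)) y] with w hw
  simp only [Function.comp_apply, (extChartAt 𝓘(ℝ, E) y).left_inv hw]

end UnitaryFrame

end SmoothFrames

/-! ### Real alternating two-forms as plain functions. -/

section TwoForms

variable {T : Type*} [AddCommGroup T] [Module ℝ T]

/-- Real bilinear alternating functions. -/
structure IsTwoForm (η : T → T → ℂ) : Prop where
  add_left : ∀ a b w, η (a + b) w = η a w + η b w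
  smul_left : ∀ (r : ℝ) a w, η (r • a) w = r * η a w
  skew : ∀ a b, η a b = -η b a

theorem IsTwoForm.add_right {η : T → T → ℂ} (hη : IsTwoForm η) (v a b : T) :
    η v (a + b) = η v a + η v b := by
  rw [hη.skew, hη.add_left, hη.skew a v, hη.skew b v]; ring

theorem IsTwoForm.smul_right {η : T → T → ℂ} (hη : IsTwoForm η) (r : ℝ) (v a : T) :
    η v (r • a) = r * η v a := by
  rw [hη.skew, hη.smul_left, hη.skew a v]; ring

theorem IsTwoForm.add {η η' : T → T → ℂ} (hη : IsTwoForm η) (hη' : IsTwoForm η') :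
    IsTwoForm (fun v w => η v w + η' v w) where
  add_left a b w := by rw [hη.add_left, hη'.add_left]; ring
  smul_left r a w := by rw [hη.smul_left, hη'.smul_left]; ring
  skew a b := by rw [hη.skew, hη'.skew]; ring

theorem IsTwoForm.sum {ι : Type*} {s : Finset ι} {η : ι → T → T → ℂ}
    (hη : ∀ i, IsTwoForm (η i)) : IsTwoForm (fun v w => ∑ i ∈ s, η i v w) where
  add_left a b w := by simp only [(hη _).add_left, Finset.sum_add_distrib]
  smul_left r a w := by simp only [(hη _).smul_left, Finset.mul_sum]
  skew a b := by
    rw [← Finset.sum_neg_distrib]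
    exact Finset.sum_congr rfl fun i _ => (hη i).skew a b

theorem isTwoForm_wedge [TopologicalSpace T] (α β : T →L[ℝ] ℂ) : IsTwoForm (wedge α β) where
  add_left a b w := by simp only [wedge, map_add]; ring
  smul_left r a w := by simp only [wedge, map_smul, Complex.real_smul]; ring
  skew a b := by simp only [wedge]; ring

end TwoForms

/-! ### Type decomposition of one- and two-forms. -/

section TangentSpaces

variable {E : Type*} [NormedAddCommGroup E] [NormedSpace ℝ E]
  {M : Type*} [TopologicalSpace M] [ChartedSpace E M]

theorem isTwoForm_extD (α : E → E →L[ℝ] ℂ) (u : E) : IsTwoForm (extD α u) where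
  add_left a b w := by simp only [extD, map_add, _root_.add_apply]; ring
  smul_left r a w := by
    simp only [extD, map_smul, _root_.smul_apply, Complex.real_smul]; ring
  skew a b := by simp only [extD]; ring

theorem isTwoForm_dForm (α : ∀ y : M, TangentSpace 𝓘(ℝ, E) y →L[ℝ] ℂ) (y : M) :
    IsTwoForm (dForm α y) :=
  isTwoForm_extD (chartForm y α) _

variable [NormedSpace ℂ E] [IsScalarTower ℝ ℂ E]

theorem csmul_eq {y : M} (c : ℂ) (v : TangentSpace 𝓘(ℝ, E) y) :
    csmul c v = c.re • v + c.im • J v := by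
  change (c • (show E from v) : E) = c.re • (show E from v) +
    c.im • (Complex.I • (show E from v) : E)
  conv_lhs => rw [← Complex.re_add_im c]
  rw [add_smul, mul_smul]
  congr 1
  · exact (algebraMap_smul ℂ c.re (show E from v))
  · exact (algebraMap_smul ℂ c.im (Complex.I • (show E from v) : E))

-- A `(1,0)`-form `β` vanishes on `(0,1)`-vectors, hence so does `α ∧ β` on pairs of them.
omit [IsScalarTower ℝ ℂ E] in
theorem ev02_wedge_eq_zero {y : M} {α β : TangentSpace 𝓘(ℝ, E) y → ℂ}
    (hβ : ∀ v, β (J v) = Complex.I * β v) (u v : TangentSpace 𝓘(ℝ, E) y) :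
    ev02 (wedge α β) u v = 0 := by
  simp only [ev02, antiPart, wedge, hβ]
  linear_combination ((α u * β v + Complex.I * α (J u) * β v - α v * β u -
    Complex.I * α (J v) * β u) / 4) * Complex.I_sq

/-- A real linear form is determined by its `(1,0)`- and `(0,1)`-parts. -/
theorem apply_csmul {y : M} {α : TangentSpace 𝓘(ℝ, E) y → ℂ}
    (hadd : ∀ a b, α (a + b) = α a + α b) (hsmul : ∀ (r : ℝ) a, α (r • a) = r * α a) (c : ℂ)
    (v : TangentSpace 𝓘(ℝ, E) y) :
    α (csmul c v) = holPart α v * c + antiPart α v * conj c := by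
  have h2 : conj c = c.re - c.im * Complex.I := by apply Complex.ext <;> simp
  rw [csmul_eq, hadd, hsmul, hsmul, holPart, antiPart, h2]
  linear_combination (-(α v - Complex.I * α (J v)) / 2) * (Complex.re_add_im c).symm +
    (c.im * α (J v)) * Complex.I_sq

-- The expression is four times `dα` on the `(0,1)`-parts of `v` and `w`. If all `α z` are complex
-- linear, then so is the derivative of `α` in its form argument, and in each term of `dα` that
-- argument is a `(0,1)`-vector.
omit [IsScalarTower ℝ ℂ E] in
theorem extD_complexLinear {α : E → E →L[ℝ] ℂ} {u : E} (hα : DifferentiableAt ℝ α u)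
    (hI : ∀ᶠ z in nhds u, ∀ b, α z (Complex.I • b) = Complex.I * α z b) (v w : E) :
    extD α u v w + Complex.I * extD α u v (Complex.I • w) + Complex.I *
      (extD α u (Complex.I • v) w + Complex.I * extD α u (Complex.I • v) (Complex.I • w)) = 0 := by
  have key : ∀ a b : E, fderiv ℝ α u a (Complex.I • b) = Complex.I * fderiv ℝ α u a b := by
    intro a b
    have h1 : ∀ c : E, HasFDerivAt (fun z => α z c) ((fderiv ℝ α u).flip c) u := fun c => by
      simpa using hα.hasFDerivAt.clm_apply (hasFDerivAt_const c u)
    have h2 : (fun z => α z (Complex.I • b)) =ᶠ[nhds u] fun z => Complex.I * α z b :=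
      hI.mono fun z hz => hz b
    have h3 := ((h1 (Complex.I • b)).congr_of_eventuallyEq h2.symm).unique
      ((h1 b).const_mul Complex.I)
    simpa using congrArg (fun L => L a) h3
  simp only [extD, key]
  linear_combination (fderiv ℝ α u v w - fderiv ℝ α u w v + Complex.I *
    fderiv ℝ α u (Complex.I • v) w - Complex.I * fderiv ℝ α u (Complex.I • w) v) * Complex.I_sq

theorem chartForm_I_smul [IsManifold 𝓘(ℂ, E) ω M]
    {α : ∀ y : M, TangentSpace 𝓘(ℝ, E) y →L[ℝ] ℂ}
    (hα : ∀ y (v : TangentSpace 𝓘(ℝ, E) y), α y (J v) = Complex.I * α y v) {y₀ : M} {u : E}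
    (hu : u ∈ (extChartAt 𝓘(ℝ, E) y₀).target) (b : E) :
    chartForm y₀ α u (Complex.I • b) = Complex.I * chartForm y₀ α u b := by
  have h1 := hα _ (show TangentSpace 𝓘(ℝ, E) ((extChartAt 𝓘(ℝ, E) y₀).symm u) from chartInv y₀ u b)
  refine Eq.trans ?_ h1
  exact congrArg (fun t : E => (show E →L[ℝ] ℂ from α ((extChartAt 𝓘(ℝ, E) y₀).symm u)) t)
    (chartInv_csmul hu Complex.I b)

/-- The exterior derivative of a `(1,0)`-form has no `(0,2)`-part. -/
theorem ev02_dForm_eq_zero [IsManifold 𝓘(ℂ, E) ω M]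
    {α : ∀ y : M, TangentSpace 𝓘(ℝ, E) y →L[ℝ] ℂ}
    (hα : ∀ y (v : TangentSpace 𝓘(ℝ, E) y), α y (J v) = Complex.I * α y v) {y : M}
    (hd : DifferentiableAt ℝ (chartForm y α) (extChartAt 𝓘(ℝ, E) y y))
    (v w : TangentSpace 𝓘(ℝ, E) y) : ev02 (dForm α y) v w = 0 := by
  have h := extD_complexLinear hd ((eventually_extChartAt_symm_mem
    (mem_extChartAt_target (I := 𝓘(ℝ, E)) y)).mono fun z hz => chartForm_I_smul hα hz) v w
  have h' : dForm α y v w + Complex.I * dForm α y v (J w) + Complex.I *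
      (dForm α y (J v) w + Complex.I * dForm α y (J v) (J w)) = 0 := h
  simp only [ev02, antiPart]
  linear_combination h' / 4

end TangentSpaces

/-! ### Expansions in a unitary coframe and the type of the torsion. -/

namespace UnitaryFrame

variable {E : Type*} [NormedAddCommGroup E] [NormedSpace ℝ E] [NormedSpace ℂ E]
  [IsScalarTower ℝ ℂ E] {M : Type*} [TopologicalSpace M] [ChartedSpace E M]
  [IsManifold 𝓘(ℂ, E) ω M] {ι : Type} [DecidableEq ι] {h : HermitianMetric E M}

theorem dual_csmul (e : UnitaryFrame ι h) (i : ι) (y : M) (c : ℂ)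
    (v : TangentSpace 𝓘(ℝ, E) y) : e.dual i y (csmul c v) = c * e.dual i y v := by
  rw [csmul_eq, map_add, map_smul, map_smul, dual_J, Complex.real_smul, Complex.real_smul]
  linear_combination e.dual i y v * Complex.re_add_im c

variable [Fintype ι] [FiniteDimensional ℝ E]

/-- A tangent vector is determined by the values of the coframe. -/
theorem sum_csmul_vec (e : UnitaryFrame ι h) (hcard : Fintype.card ι = Module.finrank ℂ E) {y : M}
    (hy : y ∈ e.domain) (v : TangentSpace 𝓘(ℝ, E) y) :
    ∑ i, csmul (e.dual i y v) (e.vec i y) = v := by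
  have : FiniteDimensional ℂ E := FiniteDimensional.right ℝ ℂ E
  -- The coframe as one complex linear map: onto by duality with the frame, hence injective by
  -- equality of dimensions.
  let Φ : E →ₗ[ℂ] (ι → ℂ) :=
    { toFun := fun v i => e.dual i y v
      map_add' := fun v w => funext fun i => map_add (e.dual i y) v w
      map_smul' := fun c v => funext fun i => e.dual_csmul i y c v }
  have hΦ : ∀ c : ι → ℂ, ∀ j, e.dual j y (∑ i, csmul (c i) (e.vec i y)) = c j := by
    intro c j
    rw [map_sum]
    simp [dual_csmul, e.dual_vec hy]
  have hs : Function.Surjective Φ := fun c => ⟨_, funext (hΦ c)⟩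
  have hi : Function.Injective Φ :=
    (LinearMap.injective_iff_surjective_of_finrank_eq_finrank (by simp [hcard])).2 hs
  exact hi (funext fun j => hΦ _ j)

/-- The Hermitian metric in terms of the coframe. -/
theorem inner_eq (e : UnitaryFrame ι h) (hcard : Fintype.card ι = Module.finrank ℂ E) {y : M}
    (hy : y ∈ e.domain) (v w : TangentSpace 𝓘(ℝ, E) y) :
    h.inner y v w = 2 * (∑ i, e.dual i y v * conj (e.dual i y w)).re := by
  -- The factor 2 reflects `h = 2 Re H`, where `H` is the Hermitian form for which the frame is
  -- unitary.
  have hre : ∀ i (v : TangentSpace 𝓘(ℝ, E) y), h.inner y (e.vec i y) v = 2 * (e.dual i y v).re := by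
    intro i v
    rw [dual_apply]
    simp
  have him : ∀ i (v : TangentSpace 𝓘(ℝ, E) y),
      h.inner y (J (e.vec i y)) v = 2 * (e.dual i y v).im := by
    intro i v
    rw [dual_apply, h.inner_J_left]
    simp
  conv_lhs => rw [← e.sum_csmul_vec hcard hy v]
  rw [map_sum, _root_.sum_apply, Complex.re_sum, Finset.mul_sum]
  refine Finset.sum_congr rfl fun i _ => ?_
  rw [csmul_eq, map_add, map_smul, map_smul, _root_.add_apply, _root_.smul_apply,
    _root_.smul_apply, hre, him]
  simp
  ring

/-- Expand the vector in the frame and split each term by `apply_csmul`. Linearity is a hypothesis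
on a bare function because `Da1`, `Dab` and `covL` are not bundled as linear maps. -/
theorem form_eq_sum (e : UnitaryFrame ι h) (hcard : Fintype.card ι = Module.finrank ℂ E) {y : M}
    (hy : y ∈ e.domain) {α : TangentSpace 𝓘(ℝ, E) y → ℂ}
    (hadd : ∀ a b, α (a + b) = α a + α b) (hsmul : ∀ (r : ℝ) a, α (r • a) = r * α a)
    (v : TangentSpace 𝓘(ℝ, E) y) :
    α v = ∑ i, (holPart α (e.vec i y) * e.dual i y v +
      antiPart α (e.vec i y) * conj (e.dual i y v)) := by
  let A : TangentSpace 𝓘(ℝ, E) y →+ ℂ := AddMonoidHom.mk' α hadd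
  conv_lhs => rw [← e.sum_csmul_vec hcard hy v]
  change A _ = _
  rw [map_sum]
  exact Finset.sum_congr rfl fun i _ => apply_csmul hadd hsmul _ _

/-- `form_eq_sum` is used in each argument. By skew-symmetry the block of type `(0,1),(1,0)` is
minus the transpose of the `(1,1)` block, and the two combine into `ω^k ∧ conj ω^l`. -/
theorem twoForm_eq_sum (e : UnitaryFrame ι h) (hcard : Fintype.card ι = Module.finrank ℂ E) {y : M}
    (hy : y ∈ e.domain) {η : TangentSpace 𝓘(ℝ, E) y → TangentSpace 𝓘(ℝ, E) y → ℂ}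
    (hη : IsTwoForm η) (v w : TangentSpace 𝓘(ℝ, E) y) :
    η v w = ∑ k, ∑ l, (ev20 η (e.vec k y) (e.vec l y) * e.dual k y v * e.dual l y w +
      ev11 η (e.vec k y) (e.vec l y) *
        (e.dual k y v * conj (e.dual l y w) - e.dual k y w * conj (e.dual l y v)) +
      ev02 η (e.vec k y) (e.vec l y) * conj (e.dual k y v) * conj (e.dual l y w)) := by
  have h1 : ∀ a, η a w = ∑ l, (holPart (η a) (e.vec l y) * e.dual l y w +
      antiPart (η a) (e.vec l y) * conj (e.dual l y w)) := fun a =>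
    e.form_eq_sum hcard hy (hη.add_right a) (fun r b => hη.smul_right r a b) w
  have h2 := e.form_eq_sum hcard hy (α := fun a => η a w) (fun a b => hη.add_left a b w)
    (fun r a => hη.smul_left r a w) v
  have hsw : ∀ k l, antiPart (fun a => holPart (η a) (e.vec l y)) (e.vec k y) =
      -ev11 η (e.vec l y) (e.vec k y) := by
    intro k l
    simp only [ev11, antiPart, holPart]
    rw [hη.skew (e.vec k y) (e.vec l y), hη.skew (e.vec k y) (J (e.vec l y)),
      hη.skew (J (e.vec k y)) (e.vec l y), hη.skew (J (e.vec k y)) (J (e.vec l y))]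
    ring
  have hh : ∀ k, holPart (fun a => η a w) (e.vec k y) =
      ∑ l, (ev20 η (e.vec k y) (e.vec l y) * e.dual l y w +
        ev11 η (e.vec k y) (e.vec l y) * conj (e.dual l y w)) := by
    intro k
    rw [holPart, h1, h1, Finset.mul_sum, ← Finset.sum_sub_distrib, Finset.sum_div]
    refine Finset.sum_congr rfl fun l _ => ?_
    simp only [ev20, ev11, holPart, antiPart]
    ring
  have ha : ∀ k, antiPart (fun a => η a w) (e.vec k y) =
      ∑ l, (-ev11 η (e.vec l y) (e.vec k y) * e.dual l y w +
        ev02 η (e.vec k y) (e.vec l y) * conj (e.dual l y w)) := by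
    intro k
    rw [antiPart, h1, h1, Finset.mul_sum, ← Finset.sum_add_distrib, Finset.sum_div]
    refine Finset.sum_congr rfl fun l _ => ?_
    rw [← hsw k l]
    simp only [ev02, holPart, antiPart]
    ring
  rw [h2]
  simp only [hh, ha, Finset.sum_mul, Finset.sum_add_distrib, add_mul, mul_sub,
    Finset.sum_sub_distrib]
  rw [Finset.sum_comm (f := fun k l => -ev11 η (e.vec l y) (e.vec k y) * e.dual l y w *
    conj (e.dual k y v))]
  simp only [neg_mul, Finset.sum_neg_distrib]
  have e1 : ∀ k l, ev20 η (e.vec k y) (e.vec l y) * e.dual l y w * e.dual k y v =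
    ev20 η (e.vec k y) (e.vec l y) * e.dual k y v * e.dual l y w := fun k l => by ring
  have e2 : ∀ k l, ev11 η (e.vec k y) (e.vec l y) * conj (e.dual l y w) * e.dual k y v =
    ev11 η (e.vec k y) (e.vec l y) * (e.dual k y v * conj (e.dual l y w)) := fun k l => by ring
  have e3 : ∀ k l, ev11 η (e.vec k y) (e.vec l y) * e.dual k y w * conj (e.dual l y v) =
    ev11 η (e.vec k y) (e.vec l y) * (e.dual k y w * conj (e.dual l y v)) := fun k l => by ring
  have e4 : ∀ k l, ev02 η (e.vec k y) (e.vec l y) * conj (e.dual l y w) * conj (e.dual k y v) =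
    ev02 η (e.vec k y) (e.vec l y) * conj (e.dual k y v) * conj (e.dual l y w) :=
    fun k l => by ring
  simp only [e1, e2, e3, e4]
  ring

omit [FiniteDimensional ℝ E] in
theorem isTwoForm_torsion (e : UnitaryFrame ι h) (i : ι) (y : M) : IsTwoForm (e.torsion i y) :=
  (isTwoForm_dForm _ y).add (IsTwoForm.sum fun _ => isTwoForm_wedge _ _)

omit [FiniteDimensional ℝ E] in
theorem isTwoForm_curv (e : UnitaryFrame ι h) (i j : ι) (y : M) : IsTwoForm (e.curv i j y) :=
  (isTwoForm_dForm _ y).add (IsTwoForm.sum fun _ => isTwoForm_wedge _ _)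

omit [Fintype ι] in
theorem ev02_dForm_dual (e : UnitaryFrame ι h) (i : ι) {y : M} (hy : y ∈ e.domain)
    (v w : TangentSpace 𝓘(ℝ, E) y) : ev02 (dForm (e.dual i) y) v w = 0 :=
  ev02_dForm_eq_zero (e.dual_J i)
    ((e.contDiffAt_dual i (e.mem_chartDomain_self hy)).differentiableAt (by simp)) v w

/-- Integrability of the complex structure: `dω^i` has no `(0,2)`-part, and a wedge product with a
`(1,0)`-form has none either. Together with `torsion_ev11` only the `(2,0)`-part remains. -/
theorem ev02_torsion (e : UnitaryFrame ι h) (i : ι) {y : M} (hy : y ∈ e.domain)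
    (v w : TangentSpace 𝓘(ℝ, E) y) : ev02 (e.torsion i y) v w = 0 := by
  have h1 := e.ev02_dForm_dual i hy v w
  have h2 : ∀ j, ev02 (wedge (e.conn i j y) (e.dual j y)) v w = 0 := fun j =>
    ev02_wedge_eq_zero (e.dual_J j y) v w
  have h3 : ev02 (e.torsion i y) v w = ev02 (dForm (e.dual i) y) v w +
      ∑ j, ev02 (wedge (e.conn i j y) (e.dual j y)) v w := by
    simp only [ev02, antiPart, torsion, Finset.sum_add_distrib, ← Finset.sum_div,
      ← Finset.mul_sum]
    ring
  rw [h3, h1, zero_add]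
  exact Finset.sum_eq_zero fun j _ => h2 j

/-- The torsion is `∑ L ω ∧ ω`. -/
theorem torsion_eq_sum (e : UnitaryFrame ι h) (hcard : Fintype.card ι = Module.finrank ℂ E)
    (i : ι) {y : M} (hy : y ∈ e.domain) (v w : TangentSpace 𝓘(ℝ, E) y) :
    e.torsion i y v w = 2 * ∑ j, ∑ k, e.L i j k y * e.dual j y v * e.dual k y w := by
  rw [e.twoForm_eq_sum hcard hy (e.isTwoForm_torsion i y), Finset.mul_sum]
  refine Finset.sum_congr rfl fun j _ => ?_
  rw [Finset.mul_sum]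
  refine Finset.sum_congr rfl fun k _ => ?_
  rw [e.torsion_ev11 hy, e.ev02_torsion i hy, L]
  ring

omit [FiniteDimensional ℝ E] in
theorem L_skew (e : UnitaryFrame ι h) (i j k : ι) (y : M) : e.L i k j y = -e.L i j k y := by
  have hη := e.isTwoForm_torsion i y
  simp only [L, ev20, holPart]
  rw [hη.skew (e.vec k y), hη.skew (e.vec k y), hη.skew (J (e.vec k y)), hη.skew (J (e.vec k y))]
  ring

end UnitaryFrame

/-! ### Leibniz rule, sums and conjugates for exterior derivatives. -/

section FlatForms

variable {E : Type*} [NormedAddCommGroup E] [NormedSpace ℝ E]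

theorem extD_smul {a : E → ℂ} {α : E → E →L[ℝ] ℂ} {u : E} (ha : DifferentiableAt ℝ a u)
    (hα : DifferentiableAt ℝ α u) (v w : E) :
    extD (fun z => a z • α z) u v w = a u * extD α u v w + wedge (fderiv ℝ a u) (α u) v w := by
  have h := ha.hasFDerivAt.smul hα.hasFDerivAt
  have h' : fderiv ℝ (fun z => a z • α z) u = _ := h.fderiv
  simp only [extD, h', wedge, _root_.add_apply, _root_.smul_apply,
    ContinuousLinearMap.smulRight_apply, smul_eq_mul]
  ring

theorem extD_add {α β : E → E →L[ℝ] ℂ} {u : E} (hα : DifferentiableAt ℝ α u)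
    (hβ : DifferentiableAt ℝ β u) (v w : E) :
    extD (fun z => α z + β z) u v w = extD α u v w + extD β u v w := by
  have h' : fderiv ℝ (fun z => α z + β z) u = _ := (hα.hasFDerivAt.add hβ.hasFDerivAt).fderiv
  simp only [extD, h', _root_.add_apply]
  ring

theorem extD_conj {α : E → E →L[ℝ] ℂ} {u : E} (hα : DifferentiableAt ℝ α u) (v w : E) :
    extD (fun z => (Complex.conjCLE : ℂ →L[ℝ] ℂ).comp (α z)) u v w = conj (extD α u v w) := by
  have h := (hasFDerivAt_const (Complex.conjCLE : ℂ →L[ℝ] ℂ) u).clm_comp hα.hasFDerivAt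
  simp only [extD, h.fderiv]
  simp

end FlatForms

/-! ### Derivatives of functions and pulled-back forms in charts. -/

section ChartDerivatives

variable {E : Type*} [NormedAddCommGroup E] [NormedSpace ℝ E]
  {M : Type*} [TopologicalSpace M] [ChartedSpace E M] [IsManifold 𝓘(ℝ, E) ∞ M]

theorem fderiv_comp_extChartAt_symm {y₀ : M} {u : E} (hu : u ∈ (extChartAt 𝓘(ℝ, E) y₀).target)
    {F : M → ℂ} (hF : MDifferentiableAt 𝓘(ℝ, E) 𝓘(ℝ, ℂ) F ((extChartAt 𝓘(ℝ, E) y₀).symm u)) (v : E) :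
    fderiv ℝ (fun w => F ((extChartAt 𝓘(ℝ, E) y₀).symm w)) u v =
      mfderiv 𝓘(ℝ, E) 𝓘(ℝ, ℂ) F ((extChartAt 𝓘(ℝ, E) y₀).symm u) (chartInv y₀ u v) := by
  have h := mfderiv_comp u hF (mdifferentiableAt_extChartAt_symm hu)
  rw [mfderiv_eq_fderiv] at h
  exact congrArg (fun L : E →L[ℝ] ℂ => L v) h

theorem mdifferentiableAt_of_chart {y₀ y : M} (hy : y ∈ (extChartAt 𝓘(ℝ, E) y₀).source)
    {F : M → ℂ} (hF : DifferentiableAt ℝ (fun w => F ((extChartAt 𝓘(ℝ, E) y₀).symm w))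
      (extChartAt 𝓘(ℝ, E) y₀ y)) : MDifferentiableAt 𝓘(ℝ, E) 𝓘(ℝ, ℂ) F y := by
  have h2 := MDifferentiableAt.comp y hF.mdifferentiableAt
    (mdifferentiableAt_extChartAt (I := 𝓘(ℝ, E)) (x := y₀) (by rwa [← extChartAt_source 𝓘(ℝ, E)]))
  refine h2.congr_of_eventuallyEq ?_
  filter_upwards [(isOpen_extChartAt_source (I := 𝓘(ℝ, E)) y₀).mem_nhds hy] with w hw
  simp only [Function.comp_apply, (extChartAt 𝓘(ℝ, E) y₀).left_inv hw]

theorem fderiv_chart_self {y : M} {F : M → ℂ}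
    (hF : MDifferentiableAt 𝓘(ℝ, E) 𝓘(ℝ, ℂ) F y) (v : E) :
    fderiv ℝ (fun w => F ((extChartAt 𝓘(ℝ, E) y).symm w)) (extChartAt 𝓘(ℝ, E) y y) v =
      (show E →L[ℝ] ℂ from mfderiv 𝓘(ℝ, E) 𝓘(ℝ, ℂ) F y) v := by
  have hy : (extChartAt 𝓘(ℝ, E) y).symm (extChartAt 𝓘(ℝ, E) y y) = y := extChartAt_to_inv y
  let D : M → E → ℂ := fun p v => mfderiv 𝓘(ℝ, E) 𝓘(ℝ, ℂ) F p v
  have h := fderiv_comp_extChartAt_symm (mem_extChartAt_target y) (by rwa [hy]) v (F := F)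
  rw [chartInv_self] at h
  change _ = D _ v at h
  rwa [hy] at h

theorem chartForm_self (α : ∀ y : M, TangentSpace 𝓘(ℝ, E) y →L[ℝ] ℂ) (y : M) (v : E) :
    chartForm y α (extChartAt 𝓘(ℝ, E) y y) v = (show E →L[ℝ] ℂ from α y) v := by
  have hy : (extChartAt 𝓘(ℝ, E) y).symm (extChartAt 𝓘(ℝ, E) y y) = y := extChartAt_to_inv y
  let A : M → E →L[ℝ] ℂ := α
  change A ((extChartAt 𝓘(ℝ, E) y).symm (extChartAt 𝓘(ℝ, E) y y))
    (chartInv y (extChartAt 𝓘(ℝ, E) y y) v) = A y v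
  rw [chartInv_self, hy]

/-- The differential of a complex-valued function, as a `1`-form. -/
def dFun (F : M → ℂ) (y : M) : TangentSpace 𝓘(ℝ, E) y →L[ℝ] ℂ :=
  mfderiv 𝓘(ℝ, E) 𝓘(ℝ, ℂ) F y

variable {E' : Type*} [NormedAddCommGroup E'] [NormedSpace ℝ E']
  {N : Type*} [TopologicalSpace N] [ChartedSpace E' N] [IsManifold 𝓘(ℝ, E') ∞ N]

theorem contDiffAt_chartForm_pullForm {f : N → M} (hf : ContMDiff 𝓘(ℝ, E') 𝓘(ℝ, E) ∞ f) {x₀ : N}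
    {y₀ : M} {α : ∀ y : M, TangentSpace 𝓘(ℝ, E) y →L[ℝ] ℂ} {z : E'}
    (hz : z ∈ (extChartAt 𝓘(ℝ, E') x₀).target)
    (hy : f ((extChartAt 𝓘(ℝ, E') x₀).symm z) ∈ (extChartAt 𝓘(ℝ, E) y₀).source)
    (hα : ContDiffAt ℝ ∞ (chartForm y₀ α) (chartMap x₀ y₀ f z)) :
    ContDiffAt ℝ ∞ (chartForm x₀ (pullForm f α)) z := by
  have hc : ContinuousAt (f ∘ (extChartAt 𝓘(ℝ, E') x₀).symm) z :=
    hf.continuous.continuousAt.comp (contMDiffAt_extChartAt_symm hz).continuousAt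
  have hF := contDiffAt_chartMap hf hz hy
  have h1 : ContDiffAt ℝ ∞ (fun w => (chartForm y₀ α (chartMap x₀ y₀ f w)).comp
      (fderiv ℝ (chartMap x₀ y₀ f) w)) z :=
    (ContDiffAt.comp z hα hF).clm_comp (hF.fderiv_right (by rfl))
  refine h1.congr_of_eventuallyEq ?_
  filter_upwards [eventually_extChartAt_symm_mem hz, hc.preimage_mem_nhds
    ((isOpen_extChartAt_source (I := 𝓘(ℝ, E)) y₀).mem_nhds hy)] with w hw hw'
  exact chartForm_pullForm α hw ((hf _).mdifferentiableAt (by simp)) hw'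

end ChartDerivatives

/-! ### The coframe on the Riemann surface and the components of `df` and `∇df`. -/

section Surfaces

variable {S : Type*} [TopologicalSpace S] [ChartedSpace ℂ S] [IsManifold 𝓘(ℂ, ℂ) ω S]
  {g : HermitianMetric ℂ S}

theorem form_eq_phi (ε : UnitaryFrame Unit g) {x : S} (hx : x ∈ ε.domain)
    {α : TangentSpace 𝓘(ℝ, ℂ) x → ℂ}
    (hadd : ∀ a b, α (a + b) = α a + α b) (hsmul : ∀ (r : ℝ) a, α (r • a) = r * α a)
    (v : TangentSpace 𝓘(ℝ, ℂ) x) :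
    α v = holPart α (ε.vec () x) * phi ε x v + antiPart α (ε.vec () x) * conj (phi ε x v) := by
  have h := ε.form_eq_sum (by simp) hx hadd hsmul v
  simpa using h

/-- With a single index the skew torsion coefficient vanishes. So on a Riemann surface the Chern
connection is torsion-free, that is, the Levi-Civita connection. -/
theorem dForm_phi (ε : UnitaryFrame Unit g) {x : S} (hx : x ∈ ε.domain)
    (v w : TangentSpace 𝓘(ℝ, ℂ) x) :
    dForm (ε.dual ()) x v w = -Complex.I * wedge (rho ε x) (phi ε x) v w := by
  have h := ε.torsion_eq_sum (by simp) () hx v w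
  have hL : ε.L () () () x = 0 := by
    have := ε.L_skew () () () x
    linear_combination this / 2
  have hr : ∀ a, ε.conn () () x a = Complex.I * rho ε x a := by
    intro a
    simp only [rho, _root_.smul_apply, smul_eq_mul]
    linear_combination (ε.conn () () x a) * Complex.I_sq
  simp only [UnitaryFrame.torsion, Finset.univ_unique, Finset.sum_singleton, PUnit.default_eq_unit,
    hL, zero_mul, mul_zero, wedge, hr] at h
  simp only [wedge]
  linear_combination h

theorem phi_vec (ε : UnitaryFrame Unit g) {x : S} (hx : x ∈ ε.domain) :
    phi ε x (ε.vec () x) = 1 := by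
  simpa using ε.dual_vec hx () ()

variable {E : Type*} [NormedAddCommGroup E] [NormedSpace ℝ E] [NormedSpace ℂ E]
  [IsScalarTower ℝ ℂ E] [FiniteDimensional ℝ E]
  {M : Type*} [TopologicalSpace M] [ChartedSpace E M] [IsManifold 𝓘(ℂ, E) ω M]
  {h : HermitianMetric E M} {ι : Type} [DecidableEq ι]

omit [FiniteDimensional ℝ E] in
theorem pullForm_dual (ε : UnitaryFrame Unit g) (e : UnitaryFrame ι h) (f : S → M) (i : ι) {x : S}
    (hx : x ∈ ε.domain) (v : TangentSpace 𝓘(ℝ, ℂ) x) :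
    pullForm f (e.dual i) x v = a1 ε e f i x * phi ε x v + ab ε e f i x * conj (phi ε x v) :=
  form_eq_phi ε hx (α := fun v => pullForm f (e.dual i) x v) (fun a b => map_add _ a b)
    (fun r a => by rw [map_smul, Complex.real_smul]) v

theorem contDiffAt_pullForm_dual {f : S → M} (hf : ContMDiff 𝓘(ℝ, ℂ) 𝓘(ℝ, E) ∞ f)
    (ε : UnitaryFrame Unit g) (e : UnitaryFrame ι h) (hfr : Set.MapsTo f ε.domain e.domain) (i : ι)
    {x₀ : S} {z : ℂ} (hz : z ∈ ε.chartDomain x₀) :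
    ContDiffAt ℝ ∞ (chartForm x₀ (pullForm f (e.dual i))) z :=
  contDiffAt_chartForm_pullForm hf hz.1 (mem_extChartAt_source _)
    (e.contDiffAt_dual i (e.mem_chartDomain_self (hfr hz.2)))

theorem contDiffAt_a1 {f : S → M} (hf : ContMDiff 𝓘(ℝ, ℂ) 𝓘(ℝ, E) ∞ f)
    (ε : UnitaryFrame Unit g) (e : UnitaryFrame ι h) (hfr : Set.MapsTo f ε.domain e.domain) (i : ι)
    {x₀ : S} {z : ℂ} (hz : z ∈ ε.chartDomain x₀) :
    ContDiffAt ℝ ∞ (fun w => a1 ε e f i ((extChartAt 𝓘(ℝ, ℂ) x₀).symm w)) z := by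
  have hα := contDiffAt_pullForm_dual hf ε e hfr i hz
  have ha := ε.contDiffAt_vec () hz
  have h1 := contDiffAt_form_apply hz.1 hα ha
  have h2 := contDiffAt_form_apply hz.1 (a := fun y => J (ε.vec () y)) hα (contDiffAt_J hz.1 ha)
  exact (h1.sub (contDiffAt_const.mul h2)).div_const 2

theorem contDiffAt_ab {f : S → M} (hf : ContMDiff 𝓘(ℝ, ℂ) 𝓘(ℝ, E) ∞ f)
    (ε : UnitaryFrame Unit g) (e : UnitaryFrame ι h) (hfr : Set.MapsTo f ε.domain e.domain) (i : ι)
    {x₀ : S} {z : ℂ} (hz : z ∈ ε.chartDomain x₀) :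
    ContDiffAt ℝ ∞ (fun w => ab ε e f i ((extChartAt 𝓘(ℝ, ℂ) x₀).symm w)) z := by
  have hα := contDiffAt_pullForm_dual hf ε e hfr i hz
  have ha := ε.contDiffAt_vec () hz
  have h1 := contDiffAt_form_apply hz.1 hα ha
  have h2 := contDiffAt_form_apply hz.1 (a := fun y => J (ε.vec () y)) hα (contDiffAt_J hz.1 ha)
  exact (h1.add (contDiffAt_const.mul h2)).div_const 2

theorem mdifferentiableAt_a1 {f : S → M} (hf : ContMDiff 𝓘(ℝ, ℂ) 𝓘(ℝ, E) ∞ f)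
    (ε : UnitaryFrame Unit g) (e : UnitaryFrame ι h) (hfr : Set.MapsTo f ε.domain e.domain) (i : ι)
    {x : S} (hx : x ∈ ε.domain) : MDifferentiableAt 𝓘(ℝ, ℂ) 𝓘(ℝ, ℂ) (a1 ε e f i) x :=
  mdifferentiableAt_of_chart (mem_extChartAt_source x)
    ((contDiffAt_a1 hf ε e hfr i (ε.mem_chartDomain_self hx)).differentiableAt (by simp))

theorem mdifferentiableAt_ab {f : S → M} (hf : ContMDiff 𝓘(ℝ, ℂ) 𝓘(ℝ, E) ∞ f)
    (ε : UnitaryFrame Unit g) (e : UnitaryFrame ι h) (hfr : Set.MapsTo f ε.domain e.domain) (i : ι)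
    {x : S} (hx : x ∈ ε.domain) : MDifferentiableAt 𝓘(ℝ, ℂ) 𝓘(ℝ, ℂ) (ab ε e f i) x :=
  mdifferentiableAt_of_chart (mem_extChartAt_source x)
    ((contDiffAt_ab hf ε e hfr i (ε.mem_chartDomain_self hx)).differentiableAt (by simp))

variable [Fintype ι]

omit [FiniteDimensional ℝ E] in
theorem Da1_apply (ε : UnitaryFrame Unit g) (e : UnitaryFrame ι h) (f : S → M) (i : ι) (x : S)
    (v : TangentSpace 𝓘(ℝ, ℂ) x) :
    Da1 ε e f i x v = dFun (a1 ε e f i) x v - Complex.I * rho ε x v * a1 ε e f i x +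
      ∑ j, a1 ε e f j x * pullForm f (e.conn i j) x v := rfl

omit [FiniteDimensional ℝ E] in
theorem Dab_apply (ε : UnitaryFrame Unit g) (e : UnitaryFrame ι h) (f : S → M) (i : ι) (x : S)
    (v : TangentSpace 𝓘(ℝ, ℂ) x) :
    Dab ε e f i x v = dFun (ab ε e f i) x v + Complex.I * rho ε x v * ab ε e f i x +
      ∑ j, ab ε e f j x * pullForm f (e.conn i j) x v := rfl

omit [FiniteDimensional ℝ E] in
theorem Da1_eq (ε : UnitaryFrame Unit g) (e : UnitaryFrame ι h) (f : S → M) (i : ι) {x : S}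
    (hx : x ∈ ε.domain) (v : TangentSpace 𝓘(ℝ, ℂ) x) :
    Da1 ε e f i x v = a11 ε e f i x * phi ε x v + a1b ε e f i x * conj (phi ε x v) := by
  refine form_eq_phi ε hx (fun a b => ?_) (fun r a => ?_) v
  · simp only [Da1_apply, map_add, mul_add, Finset.sum_add_distrib]
    ring
  · simp only [Da1_apply, map_smul, Complex.real_smul, mul_left_comm _ (r : ℂ), ← Finset.mul_sum]
    ring

omit [FiniteDimensional ℝ E] in
theorem Dab_eq (ε : UnitaryFrame Unit g) (e : UnitaryFrame ι h) (f : S → M) (i : ι) {x : S}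
    (hx : x ∈ ε.domain) (v : TangentSpace 𝓘(ℝ, ℂ) x) :
    Dab ε e f i x v = ab1 ε e f i x * phi ε x v + abb ε e f i x * conj (phi ε x v) := by
  refine form_eq_phi ε hx (fun a b => ?_) (fun r a => ?_) v
  · simp only [Dab_apply, map_add, mul_add, Finset.sum_add_distrib]
    ring
  · simp only [Dab_apply, map_smul, Complex.real_smul, mul_left_comm _ (r : ℂ), ← Finset.mul_sum]
    ring

end Surfaces

/-! ### The first structure equation along `f`, traces and norms. -/

section StructureEquation

variable {S : Type*} [TopologicalSpace S] [ChartedSpace ℂ S] [IsManifold 𝓘(ℂ, ℂ) ω S]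
  {g : HermitianMetric ℂ S}
  {E : Type*} [NormedAddCommGroup E] [NormedSpace ℝ E] [NormedSpace ℂ E]
  [IsScalarTower ℝ ℂ E] [FiniteDimensional ℝ E]
  {M : Type*} [TopologicalSpace M] [ChartedSpace E M] [IsManifold 𝓘(ℂ, E) ω M]
  {h : HermitianMetric E M} {ι : Type} [DecidableEq ι]

/-- Leibniz rule for `f^* ω^i = a^i_1 φ + a^i_{\bar 1} conj φ`, with `dφ = -iρ ∧ φ` inserted. -/
theorem dForm_pullForm_dual {f : S → M} (hf : ContMDiff 𝓘(ℝ, ℂ) 𝓘(ℝ, E) ∞ f)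
    (ε : UnitaryFrame Unit g) (e : UnitaryFrame ι h) (hfr : Set.MapsTo f ε.domain e.domain) (i : ι)
    {x : S} (hx : x ∈ ε.domain) (v w : TangentSpace 𝓘(ℝ, ℂ) x) :
    dForm (pullForm f (e.dual i)) x v w =
      a1 ε e f i x * (-Complex.I * wedge (rho ε x) (phi ε x) v w) +
      wedge (dFun (a1 ε e f i) x) (phi ε x) v w +
      (ab ε e f i x * conj (-Complex.I * wedge (rho ε x) (phi ε x) v w) +
      wedge (dFun (ab ε e f i) x) (fun a => conj (phi ε x a)) v w) := by
  have hz := ε.mem_chartDomain_self hx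
  have hev : chartForm x (pullForm f (e.dual i)) =ᶠ[nhds (extChartAt 𝓘(ℝ, ℂ) x x)] fun z =>
      a1 ε e f i ((extChartAt 𝓘(ℝ, ℂ) x).symm z) • chartForm x (ε.dual ()) z +
      ab ε e f i ((extChartAt 𝓘(ℝ, ℂ) x).symm z) •
        (Complex.conjCLE : ℂ →L[ℝ] ℂ).comp (chartForm x (ε.dual ()) z) := by
    filter_upwards [(ε.isOpen_chartDomain x).mem_nhds hz] with z hz
    ext v
    exact pullForm_dual ε e f i hz.2 (chartInv x z v)
  have dA := (contDiffAt_a1 hf ε e hfr i hz).differentiableAt (by simp)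
  have dB := (contDiffAt_ab hf ε e hfr i hz).differentiableAt (by simp)
  have dΦ := (ε.contDiffAt_dual () hz).differentiableAt (by simp)
  have dΦ' : DifferentiableAt ℝ (fun z => (Complex.conjCLE : ℂ →L[ℝ] ℂ).comp
      (chartForm x (ε.dual ()) z)) (extChartAt 𝓘(ℝ, ℂ) x x) :=
    (differentiableAt_const _).clm_comp dΦ
  have hxx : (extChartAt 𝓘(ℝ, ℂ) x).symm (extChartAt 𝓘(ℝ, ℂ) x x) = x := extChartAt_to_inv x
  have key : ∀ v w : ℂ, extD (chartForm x (pullForm f (e.dual i))) (extChartAt 𝓘(ℝ, ℂ) x x) v w =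
      a1 ε e f i x * extD (chartForm x (ε.dual ())) (extChartAt 𝓘(ℝ, ℂ) x x) v w +
      wedge (show ℂ →L[ℝ] ℂ from dFun (a1 ε e f i) x) (show ℂ →L[ℝ] ℂ from phi ε x) v w +
      (ab ε e f i x * conj (extD (chartForm x (ε.dual ())) (extChartAt 𝓘(ℝ, ℂ) x x) v w) +
      wedge (show ℂ →L[ℝ] ℂ from dFun (ab ε e f i) x)
        (fun a => conj ((show ℂ →L[ℝ] ℂ from phi ε x) a)) v w) := by
    intro v w
    rw [extD_congr hev, extD_add (dA.fun_smul dΦ) (dB.fun_smul dΦ'), extD_smul dA dΦ, extD_smul dB dΦ',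
      extD_conj dΦ, hxx]
    simp only [wedge, ContinuousLinearMap.comp_apply, chartForm_self,
      fderiv_chart_self (mdifferentiableAt_a1 hf ε e hfr i hx),
      fderiv_chart_self (mdifferentiableAt_ab hf ε e hfr i hx)]
    rfl
  have h1 := key v w
  have h2 : extD (chartForm x (ε.dual ())) (extChartAt 𝓘(ℝ, ℂ) x x) v w = _ := dForm_phi ε hx v w
  rw [h2] at h1
  exact h1

variable [Fintype ι]

/-- The first structure equation along `f`. -/
theorem wedge_Da1_add_wedge_Dab (hcard : Fintype.card ι = Module.finrank ℂ E)
    {f : S → M} (hf : ContMDiff 𝓘(ℝ, ℂ) 𝓘(ℝ, E) ∞ f)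
    (ε : UnitaryFrame Unit g) (e : UnitaryFrame ι h) (hfr : Set.MapsTo f ε.domain e.domain) (i : ι)
    {x : S} (hx : x ∈ ε.domain) (v w : TangentSpace 𝓘(ℝ, ℂ) x) :
    wedge (Da1 ε e f i x) (phi ε x) v w +
      wedge (Dab ε e f i x) (fun a => conj (phi ε x a)) v w =
    2 * ∑ j, ∑ k, e.L i j k (f x) * pullForm f (e.dual j) x v * pullForm f (e.dual k) x w := by
  have h1 := dForm_pullForm_dual hf ε e hfr i hx v w
  have h2 := dForm_pullForm (α := e.dual i) hf (x := x) ((e.contDiffAt_dual i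
    (e.mem_chartDomain_self (hfr hx))).differentiableAt (by simp)) v w
  have h3 := e.torsion_eq_sum hcard i (hfr hx) (mfderiv 𝓘(ℝ, ℂ) 𝓘(ℝ, E) f x v)
    (mfderiv 𝓘(ℝ, ℂ) 𝓘(ℝ, E) f x w)
  -- The equation `dω^i + ω^i_j ∧ ω^j = L^i_{jk} ω^j ∧ ω^k`, pulled back by `f`.
  have h4 : dForm (pullForm f (e.dual i)) x v w + ∑ j, (pullForm f (e.conn i j) x v *
      pullForm f (e.dual j) x w - pullForm f (e.conn i j) x w * pullForm f (e.dual j) x v) =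
      2 * ∑ j, ∑ k, e.L i j k (f x) * pullForm f (e.dual j) x v * pullForm f (e.dual k) x w := by
    rw [h2]; exact h3
  rw [← h4, h1]
  have hr := rho_real ε x
  simp only [wedge, Da1_apply, Dab_apply, pullForm_dual ε e f _ hx, map_mul, map_sub, map_neg,
    Complex.conj_I, hr, mul_add, Finset.sum_add_distrib, Finset.sum_sub_distrib, add_mul,
    Finset.sum_mul]
  have e1 : ∀ (c : ι → ℂ) (a : ι → ℂ) (p : ℂ), ∑ j, c j * (a j * p) = ∑ j, a j * c j * p :=
    fun c a p => Finset.sum_congr rfl fun j _ => by ring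
  simp only [e1]
  ring

theorem sum_skew_mul {n : Type*} [Fintype n] {L : n → n → ℂ} (hL : ∀ j k, L k j = -L j k)
    (p q : n → ℂ) : ∑ j, ∑ k, L j k * q j * p k = -∑ j, ∑ k, L j k * p j * q k := by
  rw [Finset.sum_comm, ← Finset.sum_neg_distrib]
  refine Finset.sum_congr rfl fun j _ => ?_
  rw [← Finset.sum_neg_distrib]
  refine Finset.sum_congr rfl fun k _ => ?_
  rw [hL]; ring

/-- `a^i_{\bar 1 1} - a^i_{1 \bar 1}` in terms of the torsion. -/
theorem ab1_sub_a1b (hcard : Fintype.card ι = Module.finrank ℂ E)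
    {f : S → M} (hf : ContMDiff 𝓘(ℝ, ℂ) 𝓘(ℝ, E) ∞ f)
    (ε : UnitaryFrame Unit g) (e : UnitaryFrame ι h) (hfr : Set.MapsTo f ε.domain e.domain) (i : ι)
    {x : S} (hx : x ∈ ε.domain) :
    ab1 ε e f i x - a1b ε e f i x =
      2 * ∑ j, ∑ k, e.L i j k (f x) * a1 ε e f j x * ab ε e f k x := by
  -- On this pair `φ` takes the values `1` and `i`; both sides acquire the factor `-2i`, and
  -- `a^i_{11}`, `a^i_{\bar 1 \bar 1}` drop out.
  have h1 := wedge_Da1_add_wedge_Dab hcard hf ε e hfr i hx (ε.vec () x) (J (ε.vec () x))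
  have hv := phi_vec ε hx
  have hJ : phi ε x (J (ε.vec () x)) = Complex.I := by
    have := ε.dual_J () x (ε.vec () x)
    rw [hv, mul_one] at this
    exact this
  have hs := sum_skew_mul (fun j k => e.L_skew i j k (f x)) (fun j => a1 ε e f j x)
    (fun j => ab ε e f j x)
  have hs1 := sum_skew_mul (fun j k => e.L_skew i j k (f x)) (fun j => a1 ε e f j x)
    (fun j => a1 ε e f j x)
  have hs2 := sum_skew_mul (fun j k => e.L_skew i j k (f x)) (fun j => ab ε e f j x)
    (fun j => ab ε e f j x)
  have hsum : ∑ j, ∑ k, e.L i j k (f x) * (a1 ε e f j x + ab ε e f j x) *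
      (a1 ε e f k x * Complex.I - ab ε e f k x * Complex.I) =
      -2 * Complex.I * ∑ j, ∑ k, e.L i j k (f x) * a1 ε e f j x * ab ε e f k x := by
    have e1 : ∀ j k, e.L i j k (f x) * (a1 ε e f j x + ab ε e f j x) *
      (a1 ε e f k x * Complex.I - ab ε e f k x * Complex.I) =
      Complex.I * (e.L i j k (f x) * a1 ε e f j x * a1 ε e f k x) -
      Complex.I * (e.L i j k (f x) * a1 ε e f j x * ab ε e f k x) +
      Complex.I * (e.L i j k (f x) * ab ε e f j x * a1 ε e f k x) -
      Complex.I * (e.L i j k (f x) * ab ε e f j x * ab ε e f k x) := fun j k => by ring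
    simp only [e1, Finset.sum_add_distrib, Finset.sum_sub_distrib, ← Finset.mul_sum]
    linear_combination Complex.I * hs + Complex.I / 2 * hs1 - Complex.I / 2 * hs2
  simp only [wedge, Da1_eq ε e f i hx, Dab_eq ε e f i hx, pullForm_dual ε e f _ hx, hv, hJ, map_one,
    mul_one, Complex.conj_I, mul_neg, ← sub_eq_add_neg, hsum] at h1
  linear_combination (Complex.I / 2) * h1 + (ab1 ε e f i x - a1b ε e f i x -
    2 * ∑ j, ∑ k, e.L i j k (f x) * a1 ε e f j x * ab ε e f k x) * Complex.I_sq

omit [FiniteDimensional ℝ E] in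
theorem dual_nablaDf (ε : UnitaryFrame Unit g) (e : UnitaryFrame ι h) {f : S → M} {x : S}
    (hy : f x ∈ e.domain) (i : ι) (v w : TangentSpace 𝓘(ℝ, ℂ) x) :
    e.dual i (f x) (nablaDf ε e f x v w) =
      Da1 ε e f i x v * phi ε x w + Dab ε e f i x v * conj (phi ε x w) := by
  rw [nablaDf, map_sum]
  simp [UnitaryFrame.dual_csmul, e.dual_vec hy]

/-- The coordinate vector `∂/∂x` of the preferred chart. -/
def coordOne (x : S) : TangentSpace 𝓘(ℝ, ℂ) x := (1 : ℂ)

/-- The coordinate vector `∂/∂y` of the preferred chart. -/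
def coordI (x : S) : TangentSpace 𝓘(ℝ, ℂ) x := Complex.I

/-- The coefficient of `dz` in the unitary coframe. -/
def phiOne (ε : UnitaryFrame Unit g) (x : S) : ℂ := phi ε x (coordOne x)

/-- The conformal factor is `2|λ|²`, since `φ ⊗ conj φ + conj φ ⊗ φ` counts `|φ|²` twice. -/
theorem inner_coordOne (ε : UnitaryFrame Unit g) {x : S} (hx : x ∈ ε.domain) :
    g.inner x (coordOne x) (coordOne x) = 2 * ‖phiOne ε x‖ ^ 2 := by
  rw [ε.inner_eq (by simp) hx, Finset.univ_unique, Finset.sum_singleton, Complex.mul_conj,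
    Complex.ofReal_re, Complex.normSq_eq_norm_sq]
  rfl

theorem phi_coordI (ε : UnitaryFrame Unit g) (x : S) :
    phi ε x (coordI x) = Complex.I * phiOne ε x := by
  have h2 : coordI x = J (coordOne x) := (mul_one Complex.I).symm
  rw [h2]
  exact ε.dual_J () x _

theorem phiOne_ne_zero (ε : UnitaryFrame Unit g) {x : S} (hx : x ∈ ε.domain) :
    phiOne ε x ≠ 0 := by
  intro h0
  have h2 := g.pos x (coordOne x) (one_ne_zero (α := ℂ))
  rw [inner_coordOne ε hx, h0] at h2
  simp at h2

theorem trace_eq (ε : UnitaryFrame Unit g) {V : Type*} [AddCommGroup V] [Module ℝ V] {x : S}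
    (hx : x ∈ ε.domain) (B : TangentSpace 𝓘(ℝ, ℂ) x → TangentSpace 𝓘(ℝ, ℂ) x → V) :
    trace g B = (2 * ‖phiOne ε x‖ ^ 2)⁻¹ •
      (B (coordOne x) (coordOne x) + B (coordI x) (coordI x)) := by
  rw [← inner_coordOne ε hx]
  rfl

-- `φ ⊗ φ` and `conj φ ⊗ conj φ` are trace-free because `φ(∂_y) = i φ(∂_x)`, and each mixed product
-- has trace one. Hence Chern-harmonicity reads `a^i_{1 \bar 1} + a^i_{\bar 1 1} = 0`.
omit [FiniteDimensional ℝ E] in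
theorem dual_trace_nablaDf (ε : UnitaryFrame Unit g) (e : UnitaryFrame ι h) {f : S → M} {x : S}
    (hx : x ∈ ε.domain) (hy : f x ∈ e.domain) (i : ι) :
    e.dual i (f x) (trace g (nablaDf ε e f x)) = a1b ε e f i x + ab1 ε e f i x := by
  have h0 := phiOne_ne_zero ε hx
  have hI := phi_coordI ε x
  have h1 : phi ε x (coordOne x) = phiOne ε x := rfl
  rw [trace_eq ε hx, map_smul, map_add, dual_nablaDf ε e hy, dual_nablaDf ε e hy,
    Da1_eq ε e f i hx, Dab_eq ε e f i hx, Da1_eq ε e f i hx, Dab_eq ε e f i hx, hI, h1]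
  simp only [Complex.real_smul, map_mul, Complex.conj_I]
  generalize phiOne ε x = p at *
  have hn : ((‖p‖ : ℝ) : ℂ) ^ 2 = p * conj p := (Complex.mul_conj' p).symm
  have hc : conj p ≠ 0 := by simpa using h0
  push_cast
  rw [hn]
  field_simp
  ring_nf
  simp only [Complex.I_sq]
  ring

/-- The cross terms contain `c²` and `(ic)² = -c²` and cancel. All traces of squared norms are
computed from this identity. -/
theorem normSq_add_normSq_I (c a b : ℂ) :
    ‖a * c + b * conj c‖ ^ 2 + ‖a * (Complex.I * c) + b * conj (Complex.I * c)‖ ^ 2 =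
      2 * ‖c‖ ^ 2 * (‖a‖ ^ 2 + ‖b‖ ^ 2) := by
  apply Complex.ofReal_injective
  push_cast
  simp only [← Complex.mul_conj', map_add, map_mul, map_neg, Complex.conj_I, Complex.conj_conj]
  ring_nf
  simp only [Complex.I_sq]
  ring

theorem energyDensity_eq (hcard : Fintype.card ι = Module.finrank ℂ E)
    (ε : UnitaryFrame Unit g) (e : UnitaryFrame ι h) {f : S → M} {x : S}
    (hx : x ∈ ε.domain) (hy : f x ∈ e.domain) :
    energyDensity g h f x = ∑ i, (‖a1 ε e f i x‖ ^ 2 + ‖ab ε e f i x‖ ^ 2) := by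
  have h0 : ‖phiOne ε x‖ ≠ 0 := by simpa using phiOne_ne_zero ε hx
  have h1 : phi ε x (coordOne x) = phiOne ε x := rfl
  have hin : ∀ v, h.inner (f x) (mfderiv 𝓘(ℝ, ℂ) 𝓘(ℝ, E) f x v)
      (mfderiv 𝓘(ℝ, ℂ) 𝓘(ℝ, E) f x v) = 2 * ∑ i, ‖a1 ε e f i x * phi ε x v +
        ab ε e f i x * conj (phi ε x v)‖ ^ 2 := by
    intro v
    rw [e.inner_eq hcard hy, Complex.re_sum]
    congr 1
    refine Finset.sum_congr rfl fun i _ => ?_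
    rw [← pullForm_dual ε e f i hx, Complex.mul_conj, Complex.ofReal_re, Complex.normSq_eq_norm_sq]
    rfl
  rw [energyDensity, trace_eq ε hx, hin, hin, h1, phi_coordI, ← mul_add, ← Finset.sum_add_distrib]
  simp only [normSq_add_normSq_I, ← Finset.mul_sum, smul_eq_mul]
  field_simp

/-- `normSq_add_normSq_I` is applied once for each of the two arguments of `∇df`; the factor 2 is
that of `h = 2 Re H`. -/
theorem normSqNablaDf_eq (hcard : Fintype.card ι = Module.finrank ℂ E)
    (ε : UnitaryFrame Unit g) (e : UnitaryFrame ι h) {f : S → M} {x : S}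
    (hx : x ∈ ε.domain) (hy : f x ∈ e.domain) :
    normSqNablaDf ε e f x = 2 * ∑ i, (‖a11 ε e f i x‖ ^ 2 + ‖a1b ε e f i x‖ ^ 2 +
      (‖ab1 ε e f i x‖ ^ 2 + ‖abb ε e f i x‖ ^ 2)) := by
  have h0 : ‖phiOne ε x‖ ≠ 0 := by simpa using phiOne_ne_zero ε hx
  have h1 : phi ε x (coordOne x) = phiOne ε x := rfl
  have hin : ∀ v w, h.inner (f x) (nablaDf ε e f x v w) (nablaDf ε e f x v w) =
      2 * ∑ i, ‖Da1 ε e f i x v * phi ε x w + Dab ε e f i x v * conj (phi ε x w)‖ ^ 2 := by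
    intro v w
    rw [e.inner_eq hcard hy, Complex.re_sum]
    congr 1
    refine Finset.sum_congr rfl fun i _ => ?_
    rw [dual_nablaDf ε e hy, Complex.mul_conj, Complex.ofReal_re, Complex.normSq_eq_norm_sq]
  have htr : ∀ v, trace g (x := x) (fun w w' => h.inner (f x) (nablaDf ε e f x v w)
      (nablaDf ε e f x v w')) = 2 * ∑ i, (‖Da1 ε e f i x v‖ ^ 2 + ‖Dab ε e f i x v‖ ^ 2) := by
    intro v
    rw [trace_eq ε hx, hin, hin, h1, phi_coordI, ← mul_add, ← Finset.sum_add_distrib]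
    simp only [normSq_add_normSq_I, ← Finset.mul_sum, smul_eq_mul]
    field_simp
  rw [normSqNablaDf, trace_eq ε hx, htr, htr, ← mul_add, ← Finset.sum_add_distrib]
  have e1 : ∀ i, ‖Da1 ε e f i x (coordOne x)‖ ^ 2 + ‖Dab ε e f i x (coordOne x)‖ ^ 2 +
      (‖Da1 ε e f i x (coordI x)‖ ^ 2 + ‖Dab ε e f i x (coordI x)‖ ^ 2) =
      2 * ‖phiOne ε x‖ ^ 2 * (‖a11 ε e f i x‖ ^ 2 + ‖a1b ε e f i x‖ ^ 2 +
      (‖ab1 ε e f i x‖ ^ 2 + ‖abb ε e f i x‖ ^ 2)) := by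
    intro i
    have h2 := normSq_add_normSq_I (phiOne ε x) (a11 ε e f i x) (a1b ε e f i x)
    have h3 := normSq_add_normSq_I (phiOne ε x) (ab1 ε e f i x) (abb ε e f i x)
    rw [Da1_eq ε e f i hx, Dab_eq ε e f i hx, Da1_eq ε e f i hx, Dab_eq ε e f i hx, h1, phi_coordI]
    linear_combination h2 + h3
  simp only [e1, ← Finset.mul_sum, smul_eq_mul]
  field_simp

end StructureEquation

/-! ### Comparison of coefficients and the Leibniz rule for torsion contractions. -/

theorem hol_eq {ℓ : ℂ →L[ℝ] ℂ} {a b : ℂ} (h : ∀ v, ℓ v = a * v + b * conj v) : hol ℓ = a := by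
  simp only [hol_apply, h, map_one, Complex.conj_I]
  linear_combination (b - a) / 2 * Complex.I_sq

theorem anti_eq {ℓ : ℂ →L[ℝ] ℂ} {a b : ℂ} (h : ∀ v, ℓ v = a * v + b * conj v) : anti ℓ = b := by
  simp only [anti_apply, h, map_one, Complex.conj_I]
  linear_combination (a - b) / 2 * Complex.I_sq

/-- The Leibniz rule for the contraction of a torsion tensor with two sections. -/
theorem leibniz_torsion {n : Type*} [Fintype n] (L dL : n → n → n → ℂ) (a da b db : n → ℂ)
    (t : n → n → ℂ) (r : ℂ) (i : n) :
    ∑ j, ∑ k, (dL i j k * a j * b k + L i j k * da j * b k + L i j k * a j * db k) +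
      ∑ m, t i m * ∑ j, ∑ k, L m j k * a j * b k =
    ∑ j, ∑ k, ((dL i j k + ∑ m, (L m j k * t i m - L i m k * t m j - L i j m * t m k)) * a j * b k +
      L i j k * (da j - r * a j + ∑ m, a m * t j m) * b k +
      L i j k * a j * (db k + r * b k + ∑ m, b m * t k m)) := by
  have h1 : ∑ m, t i m * ∑ j, ∑ k, L m j k * a j * b k =
      ∑ j, ∑ k, ∑ m, L m j k * t i m * a j * b k := by
    simp only [Finset.mul_sum]
    rw [Finset.sum_comm]
    refine Finset.sum_congr rfl fun j _ => ?_
    rw [Finset.sum_comm]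
    exact Finset.sum_congr rfl fun k _ => Finset.sum_congr rfl fun m _ => by ring
  -- Renaming summation indices moves the connection from a lower index of `L` to the section
  -- contracted with it, where it cancels. The terms in `r` cancel because `a` and `b` carry
  -- opposite twists.
  have h2 : ∑ j, ∑ k, ∑ m, L i m k * t m j * a j * b k =
      ∑ j, ∑ k, ∑ m, L i j k * (a m * t j m) * b k := by
    rw [Finset.sum_comm, Finset.sum_comm (f := fun j k => ∑ m, L i j k * (a m * t j m) * b k)]
    refine Finset.sum_congr rfl fun k _ => ?_
    rw [Finset.sum_comm]
    exact Finset.sum_congr rfl fun j _ => Finset.sum_congr rfl fun m _ => by ring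
  have h3 : ∑ j, ∑ k, ∑ m, L i j m * t m k * a j * b k =
      ∑ j, ∑ k, ∑ m, L i j k * a j * (b m * t k m) := by
    refine Finset.sum_congr rfl fun j _ => ?_
    rw [Finset.sum_comm]
    exact Finset.sum_congr rfl fun k _ => Finset.sum_congr rfl fun m _ => by ring
  have h4 : ∀ j k, (dL i j k + ∑ m, (L m j k * t i m - L i m k * t m j - L i j m * t m k)) *
      a j * b k + L i j k * (da j - r * a j + ∑ m, a m * t j m) * b k +
      L i j k * a j * (db k + r * b k + ∑ m, b m * t k m) =
      (dL i j k * a j * b k + L i j k * da j * b k + L i j k * a j * db k) +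
      ∑ m, L m j k * t i m * a j * b k - ∑ m, L i m k * t m j * a j * b k -
      ∑ m, L i j m * t m k * a j * b k + ∑ m, L i j k * (a m * t j m) * b k +
      ∑ m, L i j k * a j * (b m * t k m) := by
    intro j k
    simp only [← Finset.mul_sum, ← Finset.sum_mul, Finset.sum_sub_distrib]
    ring
  rw [h1]
  simp only [h4]
  simp only [Finset.sum_add_distrib, Finset.sum_sub_distrib, h2, h3]
  ring

/-! ### The conformal coefficient `λ` and the Gaussian curvature in a chart. -/

section Charts

variable {S : Type*} [TopologicalSpace S] [ChartedSpace ℂ S] [IsManifold 𝓘(ℂ, ℂ) ω S]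
  {g : HermitianMetric ℂ S}

/-- The coefficient of `dz` in the unitary coframe, in the preferred chart at `x`. -/
def coframeCoeff (ε : UnitaryFrame Unit g) (x : S) (z : ℂ) : ℂ := chartForm x (ε.dual ()) z 1

theorem chartForm_phi (ε : UnitaryFrame Unit g) {x : S} {z : ℂ}
    (hz : z ∈ (extChartAt 𝓘(ℝ, ℂ) x).target) (v : ℂ) :
    chartForm x (ε.dual ()) z v = coframeCoeff ε x z * v := by
  have h1 : chartForm x (ε.dual ()) z Complex.I = Complex.I * coframeCoeff ε x z := by
    have := chartForm_I_smul (ε.dual_J ()) hz (1 : ℂ)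
    rw [smul_eq_mul, mul_one] at this
    exact this
  have h2 : ∀ w, chartForm x (ε.dual ()) z w = coframeCoeff ε x z * w + 0 * conj w := by
    intro w
    have h0 : chartForm x (ε.dual ()) z 1 = coframeCoeff ε x z := rfl
    rw [apply_eq_hol_anti, hol_apply, anti_apply, h0, h1]
    linear_combination (coframeCoeff ε x z * (conj w - w) / 2) * Complex.I_sq
  simpa using h2 v

theorem coframeCoeff_self (ε : UnitaryFrame Unit g) (x : S) :
    coframeCoeff ε x (extChartAt 𝓘(ℝ, ℂ) x x) = phiOne ε x :=
  chartForm_self (ε.dual ()) x 1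

theorem differentiableAt_coframeCoeff (ε : UnitaryFrame Unit g) {x : S} (hx : x ∈ ε.domain) :
    DifferentiableAt ℝ (coframeCoeff ε x) (extChartAt 𝓘(ℝ, ℂ) x x) :=
  ((ε.contDiffAt_dual () (ε.mem_chartDomain_self hx)).differentiableAt (by simp)).clm_apply
    (differentiableAt_const _)

/-- The `dz ∧ conj dz` coefficient of `dφ = -iρ ∧ φ` for `φ = λ dz`. It says that `λ` is holomorphic
for the connection `iρ`, so factors of `λ` compensate the twists by `ρ`. -/
theorem anti_fderiv_coframeCoeff (ε : UnitaryFrame Unit g) {x : S} (hx : x ∈ ε.domain) :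
    anti (fderiv ℝ (coframeCoeff ε x) (extChartAt 𝓘(ℝ, ℂ) x x)) =
      -Complex.I * anti (chartForm x (rho ε) (extChartAt 𝓘(ℝ, ℂ) x x)) *
        coframeCoeff ε x (extChartAt 𝓘(ℝ, ℂ) x x) := by
  have hz := ε.mem_chartDomain_self hx
  have hd := (ε.contDiffAt_dual () hz).differentiableAt (by simp)
  have h1 := extD_one_I hd
  have h2 : extD (chartForm x (ε.dual ())) (extChartAt 𝓘(ℝ, ℂ) x x) 1 Complex.I =
      -Complex.I * wedge (chartForm x (rho ε) (extChartAt 𝓘(ℝ, ℂ) x x))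
        (chartForm x (ε.dual ()) (extChartAt 𝓘(ℝ, ℂ) x x)) 1 Complex.I := by
    simp only [wedge, chartForm_self]
    exact dForm_phi ε hx (coordOne x) (coordI x)
  have hf : ∀ z ∈ (extChartAt 𝓘(ℝ, ℂ) x).target, ∀ v, chartForm x (ε.dual ()) z v =
      coframeCoeff ε x z * v + 0 * conj v := fun z hz v => by rw [chartForm_phi ε hz]; ring
  have h3 : (fun z => hol (chartForm x (ε.dual ()) z)) =ᶠ[nhds (extChartAt 𝓘(ℝ, ℂ) x x)]
      coframeCoeff ε x :=
    (eventually_extChartAt_symm_mem hz.1).mono fun z hz => hol_eq (hf z hz)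
  have h4 : (fun z => anti (chartForm x (ε.dual ()) z)) =ᶠ[nhds (extChartAt 𝓘(ℝ, ℂ) x x)]
      fun _ => 0 :=
    (eventually_extChartAt_symm_mem hz.1).mono fun z hz => anti_eq (hf z hz)
  have h5 := wedge_one_I (chartForm x (rho ε) (extChartAt 𝓘(ℝ, ℂ) x x))
    (chartForm x (ε.dual ()) (extChartAt 𝓘(ℝ, ℂ) x x))
  rw [hol_eq (hf _ hz.1), anti_eq (hf _ hz.1)] at h5
  rw [h2, h3.fderiv_eq, h4.fderiv_eq] at h1
  simp only [fderiv_fun_const, Pi.zero_apply, map_zero, zero_sub] at h1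
  linear_combination h1 + Complex.I * h5

omit [IsManifold 𝓘(ℂ, ℂ) ω S] in
theorem extD_chartForm_real {α : ∀ y : S, TangentSpace 𝓘(ℝ, ℂ) y →L[ℝ] ℂ}
    (hα : ∀ y v, conj (α y v) = α y v) {x : S}
    (hd : DifferentiableAt ℝ (chartForm x α) (extChartAt 𝓘(ℝ, ℂ) x x)) (v w : ℂ) :
    conj (extD (chartForm x α) (extChartAt 𝓘(ℝ, ℂ) x x) v w) =
      extD (chartForm x α) (extChartAt 𝓘(ℝ, ℂ) x x) v w :=
  extD_real hd (Filter.Eventually.of_forall fun _ _ => hα _ _) v w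

theorem contDiffAt_rho (ε : UnitaryFrame Unit g) {x : S} {z : ℂ} (hz : z ∈ ε.chartDomain x) :
    ContDiffAt ℝ ∞ (chartForm x (rho ε)) z :=
  ContDiffAt.const_smul (-Complex.I) (ε.contDiffAt_conn () () hz)

/-- A `2`-form on the Riemann surface in terms of the coframe. -/
theorem twoForm_coord (ε : UnitaryFrame Unit g) {x : S} (hx : x ∈ ε.domain)
    {η : TangentSpace 𝓘(ℝ, ℂ) x → TangentSpace 𝓘(ℝ, ℂ) x → ℂ} (hη : IsTwoForm η) :
    η (coordOne x) (coordI x) =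
      -2 * Complex.I * ‖phiOne ε x‖ ^ 2 * ev11 η (ε.vec () x) (ε.vec () x) := by
  have e1 := hη.skew (ε.vec () x) (ε.vec () x)
  have e2 := hη.skew (ε.vec () x) (J (ε.vec () x))
  have e3 := hη.skew (J (ε.vec () x)) (J (ε.vec () x))
  have h20 : ev20 η (ε.vec () x) (ε.vec () x) = 0 := by
    simp only [ev20, holPart]
    linear_combination e1 / 8 - Complex.I / 4 * e2 + Complex.I ^ 2 / 8 * e3
  have h02 : ev02 η (ε.vec () x) (ε.vec () x) = 0 := by
    simp only [ev02, antiPart]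
    linear_combination e1 / 8 + Complex.I / 4 * e2 + Complex.I ^ 2 / 8 * e3
  have h1 := ε.twoForm_eq_sum (by simp) hx hη (coordOne x) (coordI x)
  have hI : ε.dual () x (coordI x) = Complex.I * phiOne ε x := phi_coordI ε x
  have h11 : ε.dual () x (coordOne x) = phiOne ε x := rfl
  simp only [Finset.univ_unique, Finset.sum_singleton, PUnit.default_eq_unit, h20, h02, hI, h11,
    zero_mul, zero_add, add_zero, map_mul, Complex.conj_I] at h1
  rw [h1, ← Complex.mul_conj']
  ring

/-- Since `ρ` is real, so is `dρ(∂_x, ∂_y)`, which by `twoForm_coord` is `-2|λ|²` times the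
right-hand side. -/
theorem gaussK_eq (ε : UnitaryFrame Unit g) {x : S} (hx : x ∈ ε.domain) :
    (gaussK ε x : ℂ) = Complex.I * ev11 (dForm (rho ε) x) (ε.vec () x) (ε.vec () x) := by
  have hr : conj (dForm (rho ε) x (coordOne x) (coordI x)) =
      dForm (rho ε) x (coordOne x) (coordI x) :=
    extD_chartForm_real (rho_real ε)
      ((contDiffAt_rho ε (ε.mem_chartDomain_self hx)).differentiableAt (by simp)) 1 Complex.I
  have hn : (‖phiOne ε x‖ ^ 2 : ℂ) ≠ 0 := by
    simpa using phiOne_ne_zero ε hx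
  rw [twoForm_coord ε hx (isTwoForm_dForm (rho ε) x)] at hr
  rw [gaussK, ← Complex.conj_eq_iff_re]
  apply mul_right_cancel₀ hn
  simp only [map_mul, map_neg, map_pow, Complex.conj_I, Complex.conj_ofReal, map_ofNat] at hr ⊢
  linear_combination -hr / 2

/-- `dρ` has coefficient `-i K` with respect to `φ ∧ conj φ`. -/
theorem extD_rho (ε : UnitaryFrame Unit g) {x : S} (hx : x ∈ ε.domain) :
    Complex.I / 2 * extD (chartForm x (rho ε)) (extChartAt 𝓘(ℝ, ℂ) x x) 1 Complex.I =
      -Complex.I * gaussK ε x * ‖phiOne ε x‖ ^ 2 := by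
  have h : extD (chartForm x (rho ε)) (extChartAt 𝓘(ℝ, ℂ) x x) 1 Complex.I =
      -2 * Complex.I * ‖phiOne ε x‖ ^ 2 * ev11 (dForm (rho ε) x) (ε.vec () x) (ε.vec () x) :=
    twoForm_coord ε hx (isTwoForm_dForm (rho ε) x)
  rw [h, gaussK_eq ε hx]
  ring

end Charts

/-! ### The Bochner formula for twisted sections over a domain in `ℂ`. -/

section FlatBochner

variable {n : Type*} [Fintype n]

/-- The `dz ∧ conj dz` coefficient of `extD_covD`: the commutator of `∇_z` and `∇_{\bar z}` is the
curvature. -/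
theorem hol_anti_ricci {s : n → ℂ → ℂ} {θ : n → n → ℂ → ℂ →L[ℝ] ℂ} {z : ℂ}
    (hs : ∀ i, ContDiffAt ℝ 2 (s i) z) (hθ : ∀ i j, DifferentiableAt ℝ (θ i j) z) (i : n) :
    (hol (fderiv ℝ (fun w => anti (covD s θ i w)) z) + ∑ j, anti (covD s θ j z) * hol (θ i j z)) -
      (anti (fderiv ℝ (fun w => hol (covD s θ i w)) z) + ∑ j, hol (covD s θ j z) * anti (θ i j z)) =
    ∑ j, s j z * (Complex.I / 2 *
      (extD (θ i j) z 1 Complex.I + ∑ k, wedge (θ i k z) (θ k j z) 1 Complex.I)) := by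
  have h1 := extD_covD hs hθ i 1 Complex.I
  have h2 := extD_one_I (differentiableAt_covD hs hθ i)
  have h3 : ∀ j, Complex.I / 2 * wedge (θ i j z) (covD s θ j z) 1 Complex.I =
      anti (covD s θ j z) * hol (θ i j z) - hol (covD s θ j z) * anti (θ i j z) := fun j => by
    rw [wedge_one_I]; ring
  have h4 : ∑ j, s j z * (Complex.I / 2 *
      (extD (θ i j) z 1 Complex.I + ∑ k, wedge (θ i k z) (θ k j z) 1 Complex.I)) =
      Complex.I / 2 * ∑ j, s j z *
      (extD (θ i j) z 1 Complex.I + ∑ k, wedge (θ i k z) (θ k j z) 1 Complex.I) := by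
    rw [Finset.mul_sum]
    exact Finset.sum_congr rfl fun j _ => by ring
  rw [h4, ← h1, mul_add, h2, Finset.mul_sum, Finset.sum_congr rfl fun j _ => h3 j,
    Finset.sum_sub_distrib]
  ring

/-- The Bochner formula in terms of the `(1,0)`-derivative of the `(0,1)`-derivative. -/
theorem laplacian_normSq_hol_anti {s : n → ℂ → ℂ} {θ : n → n → ℂ → ℂ →L[ℝ] ℂ} {z : ℂ}
    (hs : ∀ i, ContDiffAt ℝ 2 (s i) z) (hθ : ∀ i j, DifferentiableAt ℝ (θ i j) z)
    (hskew : ∀ᶠ w in nhds z, ∀ i j v, θ j i w v + conj (θ i j w v) = 0) {Y : n → ℂ}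
    (hY : ∀ i, hol (fderiv ℝ (fun w => anti (covD s θ i w)) z) +
      ∑ j, anti (covD s θ j z) * hol (θ i j z) = Y i) {R : n → n → ℂ}
    (hR : ∀ i j, Complex.I / 2 * (extD (θ i j) z 1 Complex.I +
      ∑ k, wedge (θ i k z) (θ k j z) 1 Complex.I) = R i j) :
    (Laplacian.laplacian (fun w => ∑ i, ‖s i w‖ ^ 2) z : ℂ) =
      4 * ∑ i, (((‖hol (covD s θ i z)‖ ^ 2 + ‖anti (covD s θ i z)‖ ^ 2 : ℝ) : ℂ) +
        (Y i * conj (s i z) + s i z * conj (Y i)) - ∑ j, conj (s i z) * s j z * R i j) := by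
  rw [laplacian_normSq_section hs hθ hskew]
  congr 1
  refine Finset.sum_congr rfl fun i _ => ?_
  have h := hol_anti_ricci hs hθ i
  simp only [hY, hR] at h ⊢
  have h2 : ∑ j, conj (s i z) * s j z * R i j = conj (s i z) * ∑ j, s j z * R i j := by
    rw [Finset.mul_sum]
    exact Finset.sum_congr rfl fun j _ => by ring
  rw [h2, ← h]
  ring

/-- The Bochner formula in terms of the `(0,1)`-derivative of the `(1,0)`-derivative. -/
theorem laplacian_normSq_anti_hol {s : n → ℂ → ℂ} {θ : n → n → ℂ → ℂ →L[ℝ] ℂ} {z : ℂ}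
    (hs : ∀ i, ContDiffAt ℝ 2 (s i) z) (hθ : ∀ i j, DifferentiableAt ℝ (θ i j) z)
    (hskew : ∀ᶠ w in nhds z, ∀ i j v, θ j i w v + conj (θ i j w v) = 0) {X : n → ℂ}
    (hX : ∀ i, anti (fderiv ℝ (fun w => hol (covD s θ i w)) z) +
      ∑ j, hol (covD s θ j z) * anti (θ i j z) = X i) {R : n → n → ℂ}
    (hR : ∀ i j, Complex.I / 2 * (extD (θ i j) z 1 Complex.I +
      ∑ k, wedge (θ i k z) (θ k j z) 1 Complex.I) = R i j) :
    (Laplacian.laplacian (fun w => ∑ i, ‖s i w‖ ^ 2) z : ℂ) =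
      4 * ∑ i, (((‖hol (covD s θ i z)‖ ^ 2 + ‖anti (covD s θ i z)‖ ^ 2 : ℝ) : ℂ) +
        (X i * conj (s i z) + s i z * conj (X i)) + ∑ j, conj (s i z) * s j z * R i j) := by
  -- The Laplacian is real, so the formula may be conjugated; then the curvature appears
  -- unconjugated and its skew-Hermitian symmetry is not needed.
  rw [← Complex.conj_ofReal, laplacian_normSq_section hs hθ hskew, map_mul, map_ofNat, map_sum]
  congr 1
  refine Finset.sum_congr rfl fun i _ => ?_
  have h := hol_anti_ricci hs hθ i
  simp only [hX, hR] at h ⊢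
  have h2 : ∑ j, conj (s i z) * s j z * R i j = conj (s i z) * ∑ j, s j z * R i j := by
    rw [Finset.mul_sum]
    exact Finset.sum_congr rfl fun j _ => by ring
  rw [h2, ← h]
  simp only [map_add, map_mul, Complex.conj_conj, Complex.conj_ofReal]
  ring

variable [DecidableEq n]

/-- The connection forms `Θ` twisted by the multiple `c` of the scalar form `P`. -/
def twist (Θ : n → n → ℂ → ℂ →L[ℝ] ℂ) (P : ℂ → ℂ →L[ℝ] ℂ) (c : ℂ) (i j : n) (z : ℂ) : ℂ →L[ℝ] ℂ :=
  Θ i j z + (if i = j then c else 0) • P z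

variable {Θ : n → n → ℂ → ℂ →L[ℝ] ℂ} {P : ℂ → ℂ →L[ℝ] ℂ} {z : ℂ}

omit [Fintype n] in
theorem differentiableAt_twist (hΘ : ∀ i j, DifferentiableAt ℝ (Θ i j) z)
    (hP : DifferentiableAt ℝ P z) (c : ℂ) (i j : n) : DifferentiableAt ℝ (twist Θ P c i j) z :=
  (hΘ i j).add (hP.const_smul (if i = j then c else 0))

omit [Fintype n] in
theorem twist_skew (hΘ : ∀ w i j v, Θ j i w v + conj (Θ i j w v) = 0)
    (hP : ∀ w v, conj (P w v) = P w v) {c : ℂ} (hc : conj c = -c) (w : ℂ) (i j : n) (v : ℂ) :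
    twist Θ P c j i w v + conj (twist Θ P c i j w v) = 0 := by
  have h := hΘ w i j v
  simp only [twist, _root_.add_apply, _root_.smul_apply, smul_eq_mul, map_add, map_mul, hP,
    apply_ite conj, hc, map_zero, eq_comm (a := j)]
  split_ifs <;> linear_combination h

theorem sum_mul_hol_twist (a : n → ℂ) (c : ℂ) (i : n) :
    ∑ j, a j * hol (twist Θ P c i j z) = c * hol (P z) * a i + ∑ j, a j * hol (Θ i j z) := by
  simp only [twist, map_add, hol_smul, mul_add, Finset.sum_add_distrib, ite_mul, zero_mul, mul_ite,
    mul_zero, Finset.sum_ite_eq, Finset.mem_univ, if_true]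
  ring

theorem sum_mul_anti_twist (a : n → ℂ) (c : ℂ) (i : n) :
    ∑ j, a j * anti (twist Θ P c i j z) = c * anti (P z) * a i + ∑ j, a j * anti (Θ i j z) := by
  simp only [twist, map_add, anti_smul, mul_add, Finset.sum_add_distrib, ite_mul, zero_mul, mul_ite,
    mul_zero, Finset.sum_ite_eq, Finset.mem_univ, if_true]
  ring

theorem hol_covD_twist (s : n → ℂ → ℂ) (c : ℂ) (i : n) :
    hol (covD s (twist Θ P c) i z) =
      hol (fderiv ℝ (s i) z) + c * hol (P z) * s i z + ∑ j, s j z * hol (Θ i j z) := by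
  simp only [covD, map_add, map_sum, hol_smul, sum_mul_hol_twist]
  ring

theorem anti_covD_twist (s : n → ℂ → ℂ) (c : ℂ) (i : n) :
    anti (covD s (twist Θ P c) i z) =
      anti (fderiv ℝ (s i) z) + c * anti (P z) * s i z + ∑ j, s j z * anti (Θ i j z) := by
  simp only [covD, map_add, map_sum, anti_smul, sum_mul_anti_twist]
  ring

theorem covD_twist_apply (s : n → ℂ → ℂ) (c : ℂ) (i : n) (v : ℂ) :
    covD s (twist Θ P c) i z v =
      fderiv ℝ (s i) z v + c * P z v * s i z + ∑ j, s j z * Θ i j z v := by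
  simp only [covD, twist, _root_.add_apply, _root_.sum_apply, _root_.smul_apply, smul_eq_mul,
    mul_add, Finset.sum_add_distrib, ite_mul, zero_mul, mul_ite, mul_zero, Finset.sum_ite_eq,
    Finset.mem_univ, if_true]
  ring

/-- The twist is a scalar matrix: the two kinds of cross terms `P ∧ Θ` and `Θ ∧ P` cancel, `P ∧ P =
0`, and only `c dP` on the diagonal is left. -/
theorem curvature_twist (hΘ : ∀ i j, DifferentiableAt ℝ (Θ i j) z) (hP : DifferentiableAt ℝ P z)
    (c : ℂ) (i j : n) (v w : ℂ) :
    extD (twist Θ P c i j) z v w + ∑ k, wedge (twist Θ P c i k z) (twist Θ P c k j z) v w =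
      extD (Θ i j) z v w + ∑ k, wedge (Θ i k z) (Θ k j z) v w +
        if i = j then c * extD P z v w else 0 := by
  have h1 : extD (twist Θ P c i j) z v w =
      extD (Θ i j) z v w + if i = j then c * extD P z v w else 0 := by
    have h0 : HasFDerivAt (twist Θ P c i j)
        (fderiv ℝ (Θ i j) z + (if i = j then c else 0) • fderiv ℝ P z) z :=
      (hΘ i j).hasFDerivAt.add (hP.hasFDerivAt.const_smul (if i = j then c else 0))
    simp only [extD, h0.fderiv, _root_.add_apply, _root_.smul_apply, smul_eq_mul]
    split_ifs <;> ring
  have h2 : ∀ k, wedge (twist Θ P c i k z) (twist Θ P c k j z) v w =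
      wedge (Θ i k z) (Θ k j z) v w + ((if i = k then c * wedge (P z) (Θ k j z) v w else 0) +
        if k = j then c * wedge (Θ i k z) (P z) v w else 0) := by
    intro k
    simp only [wedge, twist, _root_.add_apply, _root_.smul_apply, smul_eq_mul]
    split_ifs <;> ring
  rw [h1, Finset.sum_congr rfl fun k _ => h2 k]
  simp only [Finset.sum_add_distrib, Finset.sum_ite_eq, Finset.sum_ite_eq', Finset.mem_univ,
    if_true, wedge]
  ring

variable {A B : n → ℂ → ℂ} {L : n → n → n → ℂ → ℂ} {lam : ℂ → ℂ}

/-- The contraction of the torsion with two sections. -/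
def contract (L : n → n → n → ℂ → ℂ) (A B : n → ℂ → ℂ) (i : n) (z : ℂ) : ℂ :=
  ∑ j, ∑ k, L i j k z * A j z * B k z

omit [DecidableEq n] in
theorem hasFDerivAt_contract (hL : ∀ i j k, DifferentiableAt ℝ (L i j k) z)
    (hA : ∀ i, DifferentiableAt ℝ (A i) z) (hB : ∀ i, DifferentiableAt ℝ (B i) z) (i : n) :
    HasFDerivAt (contract L A B i) (∑ j, ∑ k, ((L i j k z * A j z) • fderiv ℝ (B k) z +
      B k z • (L i j k z • fderiv ℝ (A j) z + A j z • fderiv ℝ (L i j k) z))) z :=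
  HasFDerivAt.fun_sum fun j _ => HasFDerivAt.fun_sum fun k _ =>
    ((hL i j k).hasFDerivAt.mul (hA j).hasFDerivAt).mul (hB k).hasFDerivAt

/-- The twists `-i` of `A` and `+i` of `B` cancel in the product, so the contraction is
differentiated with the untwisted forms `Θ`. -/
theorem hol_contract (hL : ∀ i j k, DifferentiableAt ℝ (L i j k) z)
    (hA : ∀ i, DifferentiableAt ℝ (A i) z) (hB : ∀ i, DifferentiableAt ℝ (B i) z) (i : n) :
    hol (fderiv ℝ (contract L A B i) z) + ∑ m, contract L A B m z * hol (Θ i m z) =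
      ∑ j, ∑ k, ((hol (fderiv ℝ (L i j k) z) + ∑ m, (L m j k z * hol (Θ i m z) -
        L i m k z * hol (Θ m j z) - L i j m z * hol (Θ m k z))) * A j z * B k z +
        L i j k z * hol (covD A (twist Θ P (-Complex.I)) j z) * B k z +
        L i j k z * A j z * hol (covD B (twist Θ P Complex.I) k z)) := by
  have h := leibniz_torsion (fun i j k => L i j k z) (fun i j k => hol (fderiv ℝ (L i j k) z))
    (fun i => A i z) (fun i => hol (fderiv ℝ (A i) z)) (fun i => B i z)
    (fun i => hol (fderiv ℝ (B i) z)) (fun i m => hol (Θ i m z)) (Complex.I * hol (P z)) i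
  simp only [hol_covD_twist, neg_mul, ← sub_eq_add_neg]
  rw [← h, (hasFDerivAt_contract hL hA hB i).fderiv]
  simp only [map_sum, map_add, hol_smul]
  congr 1
  · exact Finset.sum_congr rfl fun j _ => Finset.sum_congr rfl fun k _ => by ring
  · exact Finset.sum_congr rfl fun m _ => mul_comm _ _

theorem anti_contract (hL : ∀ i j k, DifferentiableAt ℝ (L i j k) z)
    (hA : ∀ i, DifferentiableAt ℝ (A i) z) (hB : ∀ i, DifferentiableAt ℝ (B i) z) (i : n) :
    anti (fderiv ℝ (contract L A B i) z) + ∑ m, contract L A B m z * anti (Θ i m z) =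
      ∑ j, ∑ k, ((anti (fderiv ℝ (L i j k) z) + ∑ m, (L m j k z * anti (Θ i m z) -
        L i m k z * anti (Θ m j z) - L i j m z * anti (Θ m k z))) * A j z * B k z +
        L i j k z * anti (covD A (twist Θ P (-Complex.I)) j z) * B k z +
        L i j k z * A j z * anti (covD B (twist Θ P Complex.I) k z)) := by
  have h := leibniz_torsion (fun i j k => L i j k z) (fun i j k => anti (fderiv ℝ (L i j k) z))
    (fun i => A i z) (fun i => anti (fderiv ℝ (A i) z)) (fun i => B i z)
    (fun i => anti (fderiv ℝ (B i) z)) (fun i m => anti (Θ i m z)) (Complex.I * anti (P z)) i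
  simp only [anti_covD_twist, neg_mul, ← sub_eq_add_neg]
  rw [← h, (hasFDerivAt_contract hL hA hB i).fderiv]
  simp only [map_sum, map_add, anti_smul]
  congr 1
  · exact Finset.sum_congr rfl fun j _ => Finset.sum_congr rfl fun k _ => by ring
  · exact Finset.sum_congr rfl fun m _ => mul_comm _ _

/-- The second derivative of the section `A` if its `(0,1)`-derivative is `-conj lam * W`. -/
theorem hol_anti_of_anti_eq {W : n → ℂ → ℂ} (hlam : DifferentiableAt ℝ lam z)
    (hW : ∀ i, DifferentiableAt ℝ (W i) z) (hP : ∀ v, conj (P z v) = P z v)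
    (hstr : anti (fderiv ℝ lam z) = -Complex.I * anti (P z) * lam z)
    (hD : ∀ᶠ w in nhds z, ∀ i, anti (covD A (twist Θ P (-Complex.I)) i w) = -conj (lam w) * W i w)
    (i : n) :
    hol (fderiv ℝ (fun w => anti (covD A (twist Θ P (-Complex.I)) i w)) z) +
      ∑ j, anti (covD A (twist Θ P (-Complex.I)) j z) * hol (twist Θ P (-Complex.I) i j z) =
    -conj (lam z) * (hol (fderiv ℝ (W i) z) + ∑ j, W j z * hol (Θ i j z)) := by
  have h1 : HasFDerivAt (fun w => conj (lam w))
      ((Complex.conjCLE : ℂ →L[ℝ] ℂ).comp (fderiv ℝ lam z)) z :=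
    (Complex.conjCLE : ℂ →L[ℝ] ℂ).hasFDerivAt.comp z hlam.hasFDerivAt
  have h2 := h1.fun_neg.fun_mul (hW i).hasFDerivAt
  have h3 : (fun w => anti (covD A (twist Θ P (-Complex.I)) i w)) =ᶠ[nhds z]
      fun w => -conj (lam w) * W i w := hD.mono fun w hw => hw i
  -- Conjugating `hstr`, with `P` real, gives `∂_z (conj lam) = i P_z conj lam`; this cancels the
  -- twist `-i` of `A`.
  have h4 : hol ((Complex.conjCLE : ℂ →L[ℝ] ℂ).comp (fderiv ℝ lam z)) =
      Complex.I * hol (P z) * conj (lam z) := by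
    have h5 : hol (P z) = conj (anti (P z)) := conj_hol fun v => (hP v).symm
    rw [conj_hol (ℓ := fderiv ℝ lam z) fun v => rfl, hstr, h5]
    simp
  have h6 : ∀ j, -conj (lam z) * W j z * hol (Θ i j z) =
    -conj (lam z) * (W j z * hol (Θ i j z)) := fun j => by ring
  rw [h3.fderiv_eq, h2.fderiv, sum_mul_hol_twist]
  simp only [hD.self_of_nhds, map_add, map_neg, hol_smul, h4, h6, ← Finset.mul_sum]
  ring

/-- The second derivative of the section `B` if its `(1,0)`-derivative is `lam * W`. -/
theorem anti_hol_of_hol_eq {W : n → ℂ → ℂ} (hlam : DifferentiableAt ℝ lam z)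
    (hW : ∀ i, DifferentiableAt ℝ (W i) z)
    (hstr : anti (fderiv ℝ lam z) = -Complex.I * anti (P z) * lam z)
    (hD : ∀ᶠ w in nhds z, ∀ i, hol (covD B (twist Θ P Complex.I) i w) = lam w * W i w)
    (i : n) :
    anti (fderiv ℝ (fun w => hol (covD B (twist Θ P Complex.I) i w)) z) +
      ∑ j, hol (covD B (twist Θ P Complex.I) j z) * anti (twist Θ P Complex.I i j z) =
    lam z * (anti (fderiv ℝ (W i) z) + ∑ j, W j z * anti (Θ i j z)) := by
  have h2 := hlam.hasFDerivAt.fun_mul (hW i).hasFDerivAt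
  have h3 : (fun w => hol (covD B (twist Θ P Complex.I) i w)) =ᶠ[nhds z]
      fun w => lam w * W i w := hD.mono fun w hw => hw i
  have h6 : ∀ j, lam z * W j z * anti (Θ i j z) =
    lam z * (W j z * anti (Θ i j z)) := fun j => by ring
  -- By `hstr` the derivative of `lam` cancels the twist `+i` of `B`.
  rw [h3.fderiv_eq, h2.fderiv, sum_mul_anti_twist]
  simp only [hD.self_of_nhds, map_add, anti_smul, hstr, h6, ← Finset.mul_sum]
  ring

end FlatBochner

/-! ### Covariant derivatives and curvature along `f` in a chart of the surface. -/

section Maps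

/-- A pulled-back coframe form has values `p + q` and `i (p - q)` on `∂_x`, `∂_y`, with `p`, `q` its
`dz` and `conj dz` coefficients. Against skew coefficients only `p ∧ q` survives. -/
theorem sum_skew_add_sub {n : Type*} [Fintype n] {L : n → n → ℂ} (hL : ∀ j k, L k j = -L j k)
    (p q : n → ℂ) : ∑ j, ∑ k, L j k * ((p j + q j) * (p k - q k)) =
      -2 * ∑ j, ∑ k, L j k * p j * q k := by
  have e1 : ∀ j k, L j k * ((p j + q j) * (p k - q k)) = L j k * p j * p k - L j k * p j * q k +
    L j k * q j * p k - L j k * q j * q k := fun j k => by ring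
  simp only [e1, Finset.sum_add_distrib, Finset.sum_sub_distrib]
  linear_combination sum_skew_mul hL p q + sum_skew_mul hL p p / 2 - sum_skew_mul hL q q / 2

variable {S : Type*} [TopologicalSpace S] [ChartedSpace ℂ S] [IsManifold 𝓘(ℂ, ℂ) ω S]
  {g : HermitianMetric ℂ S}
  {E : Type*} [NormedAddCommGroup E] [NormedSpace ℝ E] [NormedSpace ℂ E]
  [IsScalarTower ℝ ℂ E] [FiniteDimensional ℝ E]
  {M : Type*} [TopologicalSpace M] [ChartedSpace E M] [IsManifold 𝓘(ℂ, E) ω M]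
  {h : HermitianMetric E M} {ι : Type} [DecidableEq ι] [Fintype ι]

omit [FiniteDimensional ℝ E] in
theorem UnitaryFrame.R20_skew (e : UnitaryFrame ι h) (i j k l : ι) (y : M) :
    e.R20 i j l k y = -e.R20 i j k l y := by
  have hη := e.isTwoForm_curv i j y
  simp only [R20, ev20, holPart]
  rw [hη.skew (e.vec l y), hη.skew (e.vec l y), hη.skew (J (e.vec l y)), hη.skew (J (e.vec l y))]
  ring

omit [FiniteDimensional ℝ E] in
theorem UnitaryFrame.R02_skew (e : UnitaryFrame ι h) (i j k l : ι) (y : M) :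
    e.R02 i j l k y = -e.R02 i j k l y := by
  have hη := e.isTwoForm_curv i j y
  simp only [R02, ev02, antiPart]
  rw [hη.skew (e.vec l y), hη.skew (e.vec l y), hη.skew (J (e.vec l y)), hη.skew (J (e.vec l y))]
  ring

/-- The connection forms along `f`, read in the preferred chart at `x`. -/
def connChart (e : UnitaryFrame ι h) (f : S → M) (x : S) (i j : ι) : ℂ → ℂ →L[ℝ] ℂ :=
  chartForm x (pullForm f (e.conn i j))

theorem contDiffAt_connChart {f : S → M} (hf : ContMDiff 𝓘(ℝ, ℂ) 𝓘(ℝ, E) ∞ f)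
    (ε : UnitaryFrame Unit g) (e : UnitaryFrame ι h) (hfr : Set.MapsTo f ε.domain e.domain)
    (i j : ι) {x : S} {z : ℂ} (hz : z ∈ ε.chartDomain x) :
    ContDiffAt ℝ ∞ (connChart e f x i j) z :=
  contDiffAt_chartForm_pullForm hf hz.1 (mem_extChartAt_source _)
    (e.contDiffAt_conn i j (e.mem_chartDomain_self (hfr hz.2)))

theorem covD_a1_apply {f : S → M} (hf : ContMDiff 𝓘(ℝ, ℂ) 𝓘(ℝ, E) ∞ f)
    (ε : UnitaryFrame Unit g) (e : UnitaryFrame ι h) (hfr : Set.MapsTo f ε.domain e.domain) (i : ι)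
    {x : S} {z : ℂ} (hz : z ∈ ε.chartDomain x) (v : ℂ) :
    covD (fun i w => a1 ε e f i ((extChartAt 𝓘(ℝ, ℂ) x).symm w))
      (twist (connChart e f x) (chartForm x (rho ε)) (-Complex.I)) i z v =
    coframeCoeff ε x z * a11 ε e f i ((extChartAt 𝓘(ℝ, ℂ) x).symm z) * v +
      conj (coframeCoeff ε x z) * a1b ε e f i ((extChartAt 𝓘(ℝ, ℂ) x).symm z) * conj v := by
  rw [covD_twist_apply, fderiv_comp_extChartAt_symm hz.1 (mdifferentiableAt_a1 hf ε e hfr i hz.2)]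
  have h1 := Da1_apply ε e f i ((extChartAt 𝓘(ℝ, ℂ) x).symm z) (chartInv x z v)
  have h2 := Da1_eq ε e f i hz.2 (chartInv x z v)
  have h3 : phi ε ((extChartAt 𝓘(ℝ, ℂ) x).symm z) (chartInv x z v) = coframeCoeff ε x z * v :=
    chartForm_phi ε hz.1 v
  rw [h3, h1, map_mul] at h2
  have h4 : ∀ a b c d : ℂ, a + -Complex.I * b * c + d = a - Complex.I * b * c + d := by
    intros
    ring
  exact Eq.trans (h4 _ _ _ _) (h2.trans (by ring))

theorem covD_ab_apply {f : S → M} (hf : ContMDiff 𝓘(ℝ, ℂ) 𝓘(ℝ, E) ∞ f)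
    (ε : UnitaryFrame Unit g) (e : UnitaryFrame ι h) (hfr : Set.MapsTo f ε.domain e.domain) (i : ι)
    {x : S} {z : ℂ} (hz : z ∈ ε.chartDomain x) (v : ℂ) :
    covD (fun i w => ab ε e f i ((extChartAt 𝓘(ℝ, ℂ) x).symm w))
      (twist (connChart e f x) (chartForm x (rho ε)) Complex.I) i z v =
    coframeCoeff ε x z * ab1 ε e f i ((extChartAt 𝓘(ℝ, ℂ) x).symm z) * v +
      conj (coframeCoeff ε x z) * abb ε e f i ((extChartAt 𝓘(ℝ, ℂ) x).symm z) * conj v := by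
  rw [covD_twist_apply, fderiv_comp_extChartAt_symm hz.1 (mdifferentiableAt_ab hf ε e hfr i hz.2)]
  have h1 := Dab_apply ε e f i ((extChartAt 𝓘(ℝ, ℂ) x).symm z) (chartInv x z v)
  have h2 := Dab_eq ε e f i hz.2 (chartInv x z v)
  have h3 : phi ε ((extChartAt 𝓘(ℝ, ℂ) x).symm z) (chartInv x z v) = coframeCoeff ε x z * v :=
    chartForm_phi ε hz.1 v
  rw [h3, h1, map_mul] at h2
  exact Eq.trans rfl (h2.trans (by ring))

omit [FiniteDimensional ℝ E] in
theorem covL_apply (e : UnitaryFrame ι h) (i j k : ι) (y : M) (v : TangentSpace 𝓘(ℝ, E) y) :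
    e.covL i j k y v = dFun (e.L i j k) y v + ∑ m, (e.L m j k y * e.conn i m y v -
      e.L i m k y * e.conn m j y v - e.L i j m y * e.conn m k y v) := rfl

theorem covL_eq_sum (hcard : Fintype.card ι = Module.finrank ℂ E) (e : UnitaryFrame ι h)
    (i j k : ι) {y : M} (hy : y ∈ e.domain) (v : TangentSpace 𝓘(ℝ, E) y) :
    e.covL i j k y v = ∑ l, (e.Lhol i j k l y * e.dual l y v +
      e.Lanti i j k l y * conj (e.dual l y v)) := by
  refine e.form_eq_sum hcard hy (fun a b => ?_) (fun r a => ?_) v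
  · simp only [covL_apply, map_add, mul_add, Finset.sum_add_distrib, Finset.sum_sub_distrib]
    ring
  · simp only [covL_apply, map_smul, Complex.real_smul, mul_left_comm _ (r : ℂ), ← mul_sub,
      ← Finset.mul_sum]
    ring

/-- Pull-back of `covL_eq_sum`. Conjugation exchanges the types, so `conj ω^l` contributes `conj
a^l_{\bar 1}` to the `φ`-part and `conj a^l_1` to the `conj φ`-part. -/
theorem covL_chart (hcard : Fintype.card ι = Module.finrank ℂ E) {f : S → M}
    (hf : ContMDiff 𝓘(ℝ, ℂ) 𝓘(ℝ, E) ∞ f)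
    (ε : UnitaryFrame Unit g) (e : UnitaryFrame ι h) (hfr : Set.MapsTo f ε.domain e.domain)
    (i j k : ι) {x : S} {z : ℂ} (hz : z ∈ ε.chartDomain x) (v : ℂ) :
    fderiv ℝ (fun w => e.L i j k (f ((extChartAt 𝓘(ℝ, ℂ) x).symm w))) z v +
      ∑ m, (e.L m j k (f ((extChartAt 𝓘(ℝ, ℂ) x).symm z)) * connChart e f x i m z v -
        e.L i m k (f ((extChartAt 𝓘(ℝ, ℂ) x).symm z)) * connChart e f x m j z v -
        e.L i j m (f ((extChartAt 𝓘(ℝ, ℂ) x).symm z)) * connChart e f x m k z v) =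
    coframeCoeff ε x z * (∑ l, (e.Lhol i j k l (f ((extChartAt 𝓘(ℝ, ℂ) x).symm z)) *
        a1 ε e f l ((extChartAt 𝓘(ℝ, ℂ) x).symm z) +
      e.Lanti i j k l (f ((extChartAt 𝓘(ℝ, ℂ) x).symm z)) *
        conj (ab ε e f l ((extChartAt 𝓘(ℝ, ℂ) x).symm z)))) * v +
    conj (coframeCoeff ε x z) * (∑ l, (e.Lhol i j k l (f ((extChartAt 𝓘(ℝ, ℂ) x).symm z)) *
        ab ε e f l ((extChartAt 𝓘(ℝ, ℂ) x).symm z) +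
      e.Lanti i j k l (f ((extChartAt 𝓘(ℝ, ℂ) x).symm z)) *
        conj (a1 ε e f l ((extChartAt 𝓘(ℝ, ℂ) x).symm z)))) * conj v := by
  have hL := e.mdifferentiableAt_L i j k (hfr hz.2)
  have hfd := (hf ((extChartAt 𝓘(ℝ, ℂ) x).symm z)).mdifferentiableAt (by simp)
  have h1 := fderiv_comp_extChartAt_symm (F := e.L i j k ∘ f) hz.1 (hL.comp _ hfd) v
  rw [mfderiv_comp _ hL hfd] at h1
  have h2 := covL_eq_sum hcard e i j k (hfr hz.2)
    (mfderiv 𝓘(ℝ, ℂ) 𝓘(ℝ, E) f ((extChartAt 𝓘(ℝ, ℂ) x).symm z) (chartInv x z v))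
  have h3 : phi ε ((extChartAt 𝓘(ℝ, ℂ) x).symm z) (chartInv x z v) = coframeCoeff ε x z * v :=
    chartForm_phi ε hz.1 v
  have h4 : ∀ l, e.dual l (f ((extChartAt 𝓘(ℝ, ℂ) x).symm z))
      (mfderiv 𝓘(ℝ, ℂ) 𝓘(ℝ, E) f ((extChartAt 𝓘(ℝ, ℂ) x).symm z) (chartInv x z v)) =
      a1 ε e f l ((extChartAt 𝓘(ℝ, ℂ) x).symm z) * (coframeCoeff ε x z * v) +
      ab ε e f l ((extChartAt 𝓘(ℝ, ℂ) x).symm z) * conj (coframeCoeff ε x z * v) := fun l => by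
    rw [← h3]
    exact pullForm_dual ε e f l hz.2 (chartInv x z v)
  rw [Function.comp_def] at h1
  rw [h1]
  refine Eq.trans rfl (h2.trans ?_)
  simp only [h4, map_add, map_mul, Complex.conj_conj, Finset.mul_sum, Finset.sum_mul]
  rw [← Finset.sum_add_distrib]
  exact Finset.sum_congr rfl fun l _ => by ring

/-- Because `d` commutes with pull-back, the curvature of the pulled-back connection is `f^* Ω`. The
factor `|λ|²` comes from `φ ∧ conj φ = |λ|² dz ∧ conj dz`. -/
theorem curvature_chart (hcard : Fintype.card ι = Module.finrank ℂ E) {f : S → M}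
    (hf : ContMDiff 𝓘(ℝ, ℂ) 𝓘(ℝ, E) ∞ f)
    (ε : UnitaryFrame Unit g) (e : UnitaryFrame ι h) (hfr : Set.MapsTo f ε.domain e.domain)
    (i j : ι) {x : S} (hx : x ∈ ε.domain) :
    Complex.I / 2 * (extD (connChart e f x i j) (extChartAt 𝓘(ℝ, ℂ) x x) 1 Complex.I +
      ∑ k, wedge (connChart e f x i k (extChartAt 𝓘(ℝ, ℂ) x x))
        (connChart e f x k j (extChartAt 𝓘(ℝ, ℂ) x x)) 1 Complex.I) =
    ‖phiOne ε x‖ ^ 2 * curvCoeff ε e f i j x := by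
  have h1 := dForm_pullForm (α := e.conn i j) hf (x := x) ((e.contDiffAt_conn i j
    (e.mem_chartDomain_self (hfr hx))).differentiableAt (by simp)) (coordOne x) (coordI x)
  have h2 := e.twoForm_eq_sum hcard (hfr hx) (e.isTwoForm_curv i j (f x))
    (mfderiv 𝓘(ℝ, ℂ) 𝓘(ℝ, E) f x (coordOne x)) (mfderiv 𝓘(ℝ, ℂ) 𝓘(ℝ, E) f x (coordI x))
  have h3 : extD (connChart e f x i j) (extChartAt 𝓘(ℝ, ℂ) x x) 1 Complex.I +
      ∑ k, wedge (connChart e f x i k (extChartAt 𝓘(ℝ, ℂ) x x))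
        (connChart e f x k j (extChartAt 𝓘(ℝ, ℂ) x x)) 1 Complex.I =
      e.curv i j (f x) (mfderiv 𝓘(ℝ, ℂ) 𝓘(ℝ, E) f x (coordOne x))
        (mfderiv 𝓘(ℝ, ℂ) 𝓘(ℝ, E) f x (coordI x)) := by
    simp only [wedge, connChart, chartForm_self]
    exact congrArg (· + _) h1
  have hp1 : ∀ l, e.dual l (f x) (mfderiv 𝓘(ℝ, ℂ) 𝓘(ℝ, E) f x (coordOne x)) =
      a1 ε e f l x * phiOne ε x + ab ε e f l x * conj (phiOne ε x) := fun l =>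
    pullForm_dual ε e f l hx (coordOne x)
  have hpI : ∀ l, e.dual l (f x) (mfderiv 𝓘(ℝ, ℂ) 𝓘(ℝ, E) f x (coordI x)) =
      Complex.I * (a1 ε e f l x * phiOne ε x - ab ε e f l x * conj (phiOne ε x)) := fun l => by
    have := pullForm_dual ε e f l hx (coordI x)
    rw [phi_coordI, map_mul, Complex.conj_I] at this
    refine Eq.trans ?_ (this.trans (by ring))
    rfl
  rw [h3, h2]
  simp only [hp1, hpI]
  have s20 := sum_skew_add_sub (fun k l => e.R20_skew i j k l (f x))
    (fun l => a1 ε e f l x * phiOne ε x) (fun l => ab ε e f l x * conj (phiOne ε x))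
  -- The `dz` coefficient of `f^* (conj ω^k)` is `conj a^k_{\bar 1} λ`, hence the exchanged roles.
  have s02 := sum_skew_add_sub (fun k l => e.R02_skew i j k l (f x))
    (fun l => conj (ab ε e f l x) * phiOne ε x) (fun l => conj (a1 ε e f l x) * conj (phiOne ε x))
  have e1 : ∀ k l, ev20 (e.curv i j (f x)) (e.vec k (f x)) (e.vec l (f x)) =
    2 * e.R20 i j k l (f x) := fun k l => by rw [UnitaryFrame.R20]; ring
  have e2 : ∀ k l, ev02 (e.curv i j (f x)) (e.vec k (f x)) (e.vec l (f x)) =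
    2 * e.R02 i j k l (f x) := fun k l => by rw [UnitaryFrame.R02]; ring
  have e3 : ∀ k l, ev11 (e.curv i j (f x)) (e.vec k (f x)) (e.vec l (f x)) =
    e.R11 i j k l (f x) := fun k l => rfl
  simp only [e1, e2, e3]
  have key : ∀ k l, 2 * e.R20 i j k l (f x) *
        (a1 ε e f k x * phiOne ε x + ab ε e f k x * conj (phiOne ε x)) *
        (Complex.I * (a1 ε e f l x * phiOne ε x - ab ε e f l x * conj (phiOne ε x))) +
      e.R11 i j k l (f x) *
        ((a1 ε e f k x * phiOne ε x + ab ε e f k x * conj (phiOne ε x)) *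
          conj (Complex.I * (a1 ε e f l x * phiOne ε x - ab ε e f l x * conj (phiOne ε x))) -
        Complex.I * (a1 ε e f k x * phiOne ε x - ab ε e f k x * conj (phiOne ε x)) *
          conj (a1 ε e f l x * phiOne ε x + ab ε e f l x * conj (phiOne ε x))) +
      2 * e.R02 i j k l (f x) *
        conj (a1 ε e f k x * phiOne ε x + ab ε e f k x * conj (phiOne ε x)) *
        conj (Complex.I * (a1 ε e f l x * phiOne ε x - ab ε e f l x * conj (phiOne ε x))) =
      2 * Complex.I * (e.R20 i j k l (f x) * (
        (a1 ε e f k x * phiOne ε x + ab ε e f k x * conj (phiOne ε x)) *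
        (a1 ε e f l x * phiOne ε x - ab ε e f l x * conj (phiOne ε x)))) +
      (-2 * Complex.I * (phiOne ε x * conj (phiOne ε x))) * (e.R11 i j k l (f x) *
        (a1 ε e f k x * conj (a1 ε e f l x) - ab ε e f k x * conj (ab ε e f l x))) +
      2 * Complex.I * (e.R02 i j k l (f x) * (
        (conj (ab ε e f k x) * phiOne ε x + conj (a1 ε e f k x) * conj (phiOne ε x)) *
        (conj (ab ε e f l x) * phiOne ε x - conj (a1 ε e f l x) * conj (phiOne ε x)))) := by
    intro k l
    simp only [map_mul, map_add, map_sub, Complex.conj_I, Complex.conj_conj]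
    ring
  simp only [key, Finset.sum_add_distrib, ← Finset.mul_sum, s20, s02]
  rw [curvCoeff, ← Complex.mul_conj']
  have key2 : ∀ k l, 2 * e.R20 i j k l (f x) * a1 ε e f k x * ab ε e f l x +
      e.R11 i j k l (f x) *
        (a1 ε e f k x * conj (a1 ε e f l x) - ab ε e f k x * conj (ab ε e f l x)) +
      2 * e.R02 i j k l (f x) * conj (ab ε e f k x) * conj (a1 ε e f l x) =
      2 * (e.R20 i j k l (f x) * a1 ε e f k x * ab ε e f l x) +
      e.R11 i j k l (f x) *
        (a1 ε e f k x * conj (a1 ε e f l x) - ab ε e f k x * conj (ab ε e f l x)) +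
      2 * (e.R02 i j k l (f x) * conj (ab ε e f k x) * conj (a1 ε e f l x)) := fun k l => by ring
  have key3 : ∑ k, ∑ l, e.R20 i j k l (f x) * (a1 ε e f k x * phiOne ε x) *
      (ab ε e f l x * conj (phiOne ε x)) = phiOne ε x * conj (phiOne ε x) *
      ∑ k, ∑ l, e.R20 i j k l (f x) * a1 ε e f k x * ab ε e f l x := by
    simp only [Finset.mul_sum]
    exact Finset.sum_congr rfl fun k _ => Finset.sum_congr rfl fun l _ => by ring
  have key4 : ∑ k, ∑ l, e.R02 i j k l (f x) * (conj (ab ε e f k x) * phiOne ε x) *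
      (conj (a1 ε e f l x) * conj (phiOne ε x)) = phiOne ε x * conj (phiOne ε x) *
      ∑ k, ∑ l, e.R02 i j k l (f x) * conj (ab ε e f k x) * conj (a1 ε e f l x) := by
    simp only [Finset.mul_sum]
    exact Finset.sum_congr rfl fun k _ => Finset.sum_congr rfl fun l _ => by ring
  simp only [key2, Finset.sum_add_distrib, ← Finset.mul_sum, key3, key4]
  linear_combination (-2 * (phiOne ε x * conj (phiOne ε x)) *
    (∑ k, ∑ l, e.R20 i j k l (f x) * a1 ε e f k x * ab ε e f l x) -
    (phiOne ε x * conj (phiOne ε x)) * (∑ k, ∑ l, e.R11 i j k l (f x) *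
        (a1 ε e f k x * conj (a1 ε e f l x) - ab ε e f k x * conj (ab ε e f l x))) -
    2 * (phiOne ε x * conj (phiOne ε x)) *
    (∑ k, ∑ l, e.R02 i j k l (f x) * conj (ab ε e f k x) * conj (a1 ε e f l x))) * Complex.I_sq

end Maps

/-! ### The two Laplacians for a Chern-harmonic map. -/

section Bochner

variable {S : Type*} [TopologicalSpace S] [ChartedSpace ℂ S] [IsManifold 𝓘(ℂ, ℂ) ω S]
  {g : HermitianMetric ℂ S}
  {E : Type*} [NormedAddCommGroup E] [NormedSpace ℝ E] [NormedSpace ℂ E]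
  [IsScalarTower ℝ ℂ E] [FiniteDimensional ℝ E]
  {M : Type*} [TopologicalSpace M] [ChartedSpace E M] [IsManifold 𝓘(ℂ, E) ω M]
  {h : HermitianMetric E M} {ι : Type} [DecidableEq ι] [Fintype ι]

/-- The `φ`-component of the covariant derivative of the torsion along `f`. -/
def covL1 (ε : UnitaryFrame Unit g) (e : UnitaryFrame ι h) (f : S → M) (i j k : ι) (x : S) : ℂ :=
  ∑ l, (e.Lhol i j k l (f x) * a1 ε e f l x + e.Lanti i j k l (f x) * conj (ab ε e f l x))

/-- The `conj φ`-component of the covariant derivative of the torsion along `f`. -/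
def covLb (ε : UnitaryFrame Unit g) (e : UnitaryFrame ι h) (f : S → M) (i j k : ι) (x : S) : ℂ :=
  ∑ l, (e.Lhol i j k l (f x) * ab ε e f l x + e.Lanti i j k l (f x) * conj (a1 ε e f l x))

/-- The `φ`-component of the covariant derivative of `∑ j k, L^i_{jk} a^j_1 a^k_{\bar 1}`. -/
def torsion1 (ε : UnitaryFrame Unit g) (e : UnitaryFrame ι h) (f : S → M) (i : ι) (x : S) : ℂ :=
  ∑ j, ∑ k, (covL1 ε e f i j k x * a1 ε e f j x * ab ε e f k x + e.L i j k (f x) *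
    (a11 ε e f j x * ab ε e f k x + a1 ε e f j x * ab1 ε e f k x))

/-- The `conj φ`-component of the covariant derivative of
`∑ j k, L^i_{jk} a^j_1 a^k_{\bar 1}`. -/
def torsionb (ε : UnitaryFrame Unit g) (e : UnitaryFrame ι h) (f : S → M) (i : ι) (x : S) : ℂ :=
  ∑ j, ∑ k, (covLb ε e f i j k x * a1 ε e f j x * ab ε e f k x + e.L i j k (f x) *
    (a1b ε e f j x * ab ε e f k x + a1 ε e f j x * abb ε e f k x))

/-- `a^i_1` in the preferred chart at `x`. -/
def a1Chart (ε : UnitaryFrame Unit g) (e : UnitaryFrame ι h) (f : S → M) (x : S) (i : ι) (z : ℂ) :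
    ℂ :=
  a1 ε e f i ((extChartAt 𝓘(ℝ, ℂ) x).symm z)

/-- `a^i_{\bar 1}` in the preferred chart at `x`. -/
def abChart (ε : UnitaryFrame Unit g) (e : UnitaryFrame ι h) (f : S → M) (x : S) (i : ι) (z : ℂ) :
    ℂ :=
  ab ε e f i ((extChartAt 𝓘(ℝ, ℂ) x).symm z)

/-- The torsion along `f` in the preferred chart at `x`. -/
def LChart (e : UnitaryFrame ι h) (f : S → M) (x : S) (i j k : ι) (z : ℂ) : ℂ :=
  e.L i j k (f ((extChartAt 𝓘(ℝ, ℂ) x).symm z))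

/-- The forms `f^* ω^i_j - i δ_{ij} ρ`. -/
def theta1 (ε : UnitaryFrame Unit g) (e : UnitaryFrame ι h) (f : S → M) (x : S) :
    ι → ι → ℂ → ℂ →L[ℝ] ℂ :=
  twist (connChart e f x) (chartForm x (rho ε)) (-Complex.I)

/-- The forms `f^* ω^i_j + i δ_{ij} ρ`. -/
def thetab (ε : UnitaryFrame Unit g) (e : UnitaryFrame ι h) (f : S → M) (x : S) :
    ι → ι → ℂ → ℂ →L[ℝ] ℂ :=
  twist (connChart e f x) (chartForm x (rho ε)) Complex.I

variable {f : S → M} (hf : ContMDiff 𝓘(ℝ, ℂ) 𝓘(ℝ, E) ∞ f)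
  (ε : UnitaryFrame Unit g) (e : UnitaryFrame ι h) (hfr : Set.MapsTo f ε.domain e.domain)
  {x : S}

include hf hfr

omit [Fintype ι] in
theorem contDiffAt_a1Chart (i : ι) {z : ℂ} (hz : z ∈ ε.chartDomain x) :
    ContDiffAt ℝ 2 (a1Chart ε e f x i) z :=
  contDiffAt_infty.1 (contDiffAt_a1 hf ε e hfr i hz) 2

omit [Fintype ι] in
theorem contDiffAt_abChart (i : ι) {z : ℂ} (hz : z ∈ ε.chartDomain x) :
    ContDiffAt ℝ 2 (abChart ε e f x i) z :=
  contDiffAt_infty.1 (contDiffAt_ab hf ε e hfr i hz) 2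

theorem hol_covD_a1 (i : ι) {z : ℂ} (hz : z ∈ ε.chartDomain x) :
    hol (covD (a1Chart ε e f x) (theta1 ε e f x) i z) =
      coframeCoeff ε x z * a11 ε e f i ((extChartAt 𝓘(ℝ, ℂ) x).symm z) :=
  hol_eq (covD_a1_apply hf ε e hfr i hz)

theorem anti_covD_a1 (i : ι) {z : ℂ} (hz : z ∈ ε.chartDomain x) :
    anti (covD (a1Chart ε e f x) (theta1 ε e f x) i z) =
      conj (coframeCoeff ε x z) * a1b ε e f i ((extChartAt 𝓘(ℝ, ℂ) x).symm z) :=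
  anti_eq (covD_a1_apply hf ε e hfr i hz)

theorem hol_covD_ab (i : ι) {z : ℂ} (hz : z ∈ ε.chartDomain x) :
    hol (covD (abChart ε e f x) (thetab ε e f x) i z) =
      coframeCoeff ε x z * ab1 ε e f i ((extChartAt 𝓘(ℝ, ℂ) x).symm z) :=
  hol_eq (covD_ab_apply hf ε e hfr i hz)

theorem anti_covD_ab (i : ι) {z : ℂ} (hz : z ∈ ε.chartDomain x) :
    anti (covD (abChart ε e f x) (thetab ε e f x) i z) =
      conj (coframeCoeff ε x z) * abb ε e f i ((extChartAt 𝓘(ℝ, ℂ) x).symm z) :=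
  anti_eq (covD_ab_apply hf ε e hfr i hz)

theorem hol_covL (hcard : Fintype.card ι = Module.finrank ℂ E) (i j k : ι) {z : ℂ}
    (hz : z ∈ ε.chartDomain x) :
    hol (fderiv ℝ (LChart e f x i j k) z) + ∑ m, (LChart e f x m j k z *
      hol (connChart e f x i m z) - LChart e f x i m k z * hol (connChart e f x m j z) -
      LChart e f x i j m z * hol (connChart e f x m k z)) =
    coframeCoeff ε x z * covL1 ε e f i j k ((extChartAt 𝓘(ℝ, ℂ) x).symm z) := by
  have h1 := hol_eq (ℓ := fderiv ℝ (LChart e f x i j k) z + ∑ m, (LChart e f x m j k z •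
      connChart e f x i m z - LChart e f x i m k z • connChart e f x m j z -
      LChart e f x i j m z • connChart e f x m k z)) (fun v => by
    simp only [_root_.add_apply, _root_.sum_apply, _root_.sub_apply, _root_.smul_apply, smul_eq_mul]
    exact covL_chart hcard hf ε e hfr i j k hz v)
  simp only [map_add, map_sum, map_sub, hol_smul] at h1
  exact h1

theorem anti_covL (hcard : Fintype.card ι = Module.finrank ℂ E) (i j k : ι) {z : ℂ}
    (hz : z ∈ ε.chartDomain x) :
    anti (fderiv ℝ (LChart e f x i j k) z) + ∑ m, (LChart e f x m j k z *
      anti (connChart e f x i m z) - LChart e f x i m k z * anti (connChart e f x m j z) -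
      LChart e f x i j m z * anti (connChart e f x m k z)) =
    conj (coframeCoeff ε x z) * covLb ε e f i j k ((extChartAt 𝓘(ℝ, ℂ) x).symm z) := by
  have h1 := anti_eq (ℓ := fderiv ℝ (LChart e f x i j k) z + ∑ m, (LChart e f x m j k z •
      connChart e f x i m z - LChart e f x i m k z • connChart e f x m j z -
      LChart e f x i j m z • connChart e f x m k z)) (fun v => by
    simp only [_root_.add_apply, _root_.sum_apply, _root_.sub_apply, _root_.smul_apply, smul_eq_mul]
    exact covL_chart hcard hf ε e hfr i j k hz v)
  simp only [map_add, map_sum, map_sub, anti_smul] at h1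
  exact h1

theorem differentiableAt_LChart (i j k : ι) {z : ℂ} (hz : z ∈ ε.chartDomain x) :
    DifferentiableAt ℝ (LChart e f x i j k) z :=
  (((e.mdifferentiableAt_L i j k (hfr hz.2)).comp _ ((hf _).mdifferentiableAt (by simp))).comp z
    (mdifferentiableAt_extChartAt_symm hz.1)).differentiableAt

theorem differentiableAt_contract (i : ι) {z : ℂ} (hz : z ∈ ε.chartDomain x) :
    DifferentiableAt ℝ (contract (LChart e f x) (a1Chart ε e f x) (abChart ε e f x) i) z :=
  (hasFDerivAt_contract (fun i j k => differentiableAt_LChart hf ε e hfr i j k hz)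
    (fun i => (contDiffAt_a1Chart hf ε e hfr i hz).differentiableAt (by simp))
    (fun i => (contDiffAt_abChart hf ε e hfr i hz).differentiableAt (by simp)) i).differentiableAt

theorem hol_contract_chart (hcard : Fintype.card ι = Module.finrank ℂ E) (i : ι) {z : ℂ}
    (hz : z ∈ ε.chartDomain x) :
    hol (fderiv ℝ (contract (LChart e f x) (a1Chart ε e f x) (abChart ε e f x) i) z) +
      ∑ m, contract (LChart e f x) (a1Chart ε e f x) (abChart ε e f x) m z *
        hol (connChart e f x i m z) =
      coframeCoeff ε x z * torsion1 ε e f i ((extChartAt 𝓘(ℝ, ℂ) x).symm z) := by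
  rw [hol_contract (L := LChart e f x) (P := chartForm x (rho ε))
    (fun i j k => differentiableAt_LChart hf ε e hfr i j k hz)
    (fun i => (contDiffAt_a1Chart hf ε e hfr i hz).differentiableAt (by simp))
    (fun i => (contDiffAt_abChart hf ε e hfr i hz).differentiableAt (by simp)) i, torsion1]
  simp only [hol_covL hf ε e hfr hcard _ _ _ hz, Finset.mul_sum]
  refine Finset.sum_congr rfl fun j _ => Finset.sum_congr rfl fun k _ => ?_
  rw [← theta1, ← thetab, hol_covD_a1 hf ε e hfr j hz, hol_covD_ab hf ε e hfr k hz]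
  simp only [LChart, a1Chart, abChart]
  ring

theorem anti_contract_chart (hcard : Fintype.card ι = Module.finrank ℂ E) (i : ι) {z : ℂ}
    (hz : z ∈ ε.chartDomain x) :
    anti (fderiv ℝ (contract (LChart e f x) (a1Chart ε e f x) (abChart ε e f x) i) z) +
      ∑ m, contract (LChart e f x) (a1Chart ε e f x) (abChart ε e f x) m z *
        anti (connChart e f x i m z) =
      conj (coframeCoeff ε x z) * torsionb ε e f i ((extChartAt 𝓘(ℝ, ℂ) x).symm z) := by
  rw [anti_contract (L := LChart e f x) (P := chartForm x (rho ε))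
    (fun i j k => differentiableAt_LChart hf ε e hfr i j k hz)
    (fun i => (contDiffAt_a1Chart hf ε e hfr i hz).differentiableAt (by simp))
    (fun i => (contDiffAt_abChart hf ε e hfr i hz).differentiableAt (by simp)) i, torsionb]
  simp only [anti_covL hf ε e hfr hcard _ _ _ hz, Finset.mul_sum]
  refine Finset.sum_congr rfl fun j _ => Finset.sum_congr rfl fun k _ => ?_
  rw [← theta1, ← thetab, anti_covD_a1 hf ε e hfr j hz, anti_covD_ab hf ε e hfr k hz]
  simp only [LChart, a1Chart, abChart]
  ring

/-- The diagonal term is `c dρ` with `dρ = -iK φ ∧ conj φ`. For `c = -i` it subtracts `K`, for `c =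
i` it adds `K`. -/
theorem curvature_theta (hcard : Fintype.card ι = Module.finrank ℂ E) (hx : x ∈ ε.domain) (c : ℂ)
    (i j : ι) :
    Complex.I / 2 * (extD (twist (connChart e f x) (chartForm x (rho ε)) c i j)
        (extChartAt 𝓘(ℝ, ℂ) x x) 1 Complex.I +
      ∑ k, wedge (twist (connChart e f x) (chartForm x (rho ε)) c i k (extChartAt 𝓘(ℝ, ℂ) x x))
        (twist (connChart e f x) (chartForm x (rho ε)) c k j (extChartAt 𝓘(ℝ, ℂ) x x)) 1
        Complex.I) =
    ‖phiOne ε x‖ ^ 2 * (curvCoeff ε e f i j x -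
      if i = j then Complex.I * c * gaussK ε x else 0) := by
  have hz := ε.mem_chartDomain_self hx
  rw [curvature_twist
    (fun i j => (contDiffAt_connChart hf ε e hfr i j hz).differentiableAt (by simp))
    ((contDiffAt_rho ε hz).differentiableAt (by simp)), mul_add,
    curvature_chart hcard hf ε e hfr i j hx]
  have h1 := extD_rho ε hx
  split_ifs
  · linear_combination c * h1
  · ring

omit [IsManifold 𝓘(ℂ, ℂ) ω S] [FiniteDimensional ℝ E] hf hfr in
theorem connChart_skew (e : UnitaryFrame ι h) (f : S → M) (x : S) (w : ℂ) (i j : ι) (v : ℂ) :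
    connChart e f x j i w v + conj (connChart e f x i j w v) = 0 :=
  e.conn_skew i j _ _

omit [IsManifold 𝓘(ℂ, ℂ) ω S] hf hfr in
theorem chartForm_real {α : ∀ y : S, TangentSpace 𝓘(ℝ, ℂ) y →L[ℝ] ℂ}
    (hα : ∀ y v, conj (α y v) = α y v) (x : S) (w v : ℂ) :
    conj (chartForm x α w v) = chartForm x α w v :=
  hα _ _

omit hf hfr in
theorem chartForm_rho_real (ε : UnitaryFrame Unit g) (x : S) (w v : ℂ) :
    conj (chartForm x (rho ε) w v) = chartForm x (rho ε) w v :=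
  chartForm_real (rho_real ε) x w v

variable (hharm : ∀ x ∈ ε.domain, ∀ i, a1b ε e f i x + ab1 ε e f i x = 0)

include hharm

/-- Harmonicity fixes the sum of the two mixed components and the structure equation their
difference, so each is determined by the torsion and `df`. -/
theorem ab1_eq_of_harmonic (hcard : Fintype.card ι = Module.finrank ℂ E) {x : S}
    (hx : x ∈ ε.domain) (i : ι) :
    ab1 ε e f i x = ∑ j, ∑ k, e.L i j k (f x) * a1 ε e f j x * ab ε e f k x := by
  linear_combination ab1_sub_a1b hcard hf ε e hfr i hx / 2 + hharm x hx i / 2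

theorem a1b_eq_of_harmonic (hcard : Fintype.card ι = Module.finrank ℂ E) {x : S}
    (hx : x ∈ ε.domain) (i : ι) :
    a1b ε e f i x = -∑ j, ∑ k, e.L i j k (f x) * a1 ε e f j x * ab ε e f k x := by
  linear_combination hharm x hx i / 2 - ab1_sub_a1b hcard hf ε e hfr i hx / 2

/-- The Laplacian of `∑ i, |a^i_1|²`. -/
theorem laplacian_normSq_a1 (hcard : Fintype.card ι = Module.finrank ℂ E) (hx : x ∈ ε.domain) :
    (Laplacian.laplacian (fun w => ∑ i, ‖a1Chart ε e f x i w‖ ^ 2)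
      (extChartAt 𝓘(ℝ, ℂ) x x) : ℂ) =
    4 * ‖phiOne ε x‖ ^ 2 * ∑ i, (((‖a11 ε e f i x‖ ^ 2 + ‖a1b ε e f i x‖ ^ 2 +
      gaussK ε x * ‖a1 ε e f i x‖ ^ 2 : ℝ) : ℂ) -
      (torsion1 ε e f i x * conj (a1 ε e f i x) + a1 ε e f i x * conj (torsion1 ε e f i x)) -
      ∑ j, conj (a1 ε e f i x) * a1 ε e f j x * curvCoeff ε e f i j x) := by
  have hz := ε.mem_chartDomain_self hx
  have hxx : (extChartAt 𝓘(ℝ, ℂ) x).symm (extChartAt 𝓘(ℝ, ℂ) x x) = x := extChartAt_to_inv x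
  have hD : ∀ᶠ w in nhds (extChartAt 𝓘(ℝ, ℂ) x x), ∀ i,
      anti (covD (a1Chart ε e f x) (theta1 ε e f x) i w) = -conj (coframeCoeff ε x w) *
        contract (LChart e f x) (a1Chart ε e f x) (abChart ε e f x) i w := by
    filter_upwards [(ε.isOpen_chartDomain x).mem_nhds hz] with w hw i
    rw [anti_covD_a1 hf ε e hfr i hw, a1b_eq_of_harmonic hf ε e hfr hharm hcard hw.2]
    rw [mul_neg, neg_mul]
    rfl
  -- For `a_1` the `(0,1)`-derivative is the one known near the base point, so the mixed derivative
  -- taken is `∇_z ∇_{\bar z}`.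
  have hY := hol_anti_of_anti_eq (differentiableAt_coframeCoeff ε hx)
    (fun i => differentiableAt_contract hf ε e hfr i hz)
    (chartForm_rho_real ε x _) (anti_fderiv_coframeCoeff ε hx) hD
  have hdΘ : ∀ i j, DifferentiableAt ℝ (theta1 ε e f x i j) (extChartAt 𝓘(ℝ, ℂ) x x) :=
    differentiableAt_twist
      (fun i j => (contDiffAt_connChart hf ε e hfr i j hz).differentiableAt (by simp))
      ((contDiffAt_rho ε hz).differentiableAt (by simp)) _
  rw [laplacian_normSq_hol_anti (fun i => contDiffAt_a1Chart hf ε e hfr i hz) hdΘ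
    (Filter.Eventually.of_forall
      (twist_skew (connChart_skew e f x) (chartForm_rho_real ε x) (by simp)))
    hY (curvature_theta hf ε e hfr hcard hx _)]
  simp only [hol_covD_a1 hf ε e hfr _ hz, anti_covD_a1 hf ε e hfr _ hz,
    hol_contract_chart hf ε e hfr hcard _ hz, coframeCoeff_self, hxx, a1Chart, mul_assoc (4 : ℂ)]
  congr 1
  rw [Finset.mul_sum]
  refine Finset.sum_congr rfl fun i _ => ?_
  -- The diagonal of the twisted curvature splits off the term in `K`; here `i · (-i) = 1`.
  have h1 : ∑ j, conj (a1 ε e f i x) * a1 ε e f j x * (‖phiOne ε x‖ ^ 2 * (curvCoeff ε e f i j x -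
      if i = j then Complex.I * -Complex.I * gaussK ε x else 0)) =
      ‖phiOne ε x‖ ^ 2 * ∑ j, conj (a1 ε e f i x) * a1 ε e f j x * curvCoeff ε e f i j x -
      ‖phiOne ε x‖ ^ 2 * (conj (a1 ε e f i x) * a1 ε e f i x * gaussK ε x) := by
    have h2 : ∀ j, conj (a1 ε e f i x) * a1 ε e f j x * (‖phiOne ε x‖ ^ 2 * (curvCoeff ε e f i j x -
      if i = j then Complex.I * -Complex.I * gaussK ε x else 0)) =
      ‖phiOne ε x‖ ^ 2 * (conj (a1 ε e f i x) * a1 ε e f j x * curvCoeff ε e f i j x) -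
      if i = j then ‖phiOne ε x‖ ^ 2 * (conj (a1 ε e f i x) * a1 ε e f j x * gaussK ε x) else 0 := by
      intro j
      split_ifs
      · linear_combination (‖phiOne ε x‖ ^ 2 * (conj (a1 ε e f i x) * a1 ε e f j x *
          gaussK ε x)) * Complex.I_sq
      · ring
    simp only [h2, Finset.sum_sub_distrib, ← Finset.mul_sum, Finset.sum_ite_eq, Finset.mem_univ,
      if_true]
  rw [h1]
  simp only [norm_mul, Complex.norm_conj, mul_pow, Complex.ofReal_add, Complex.ofReal_mul,
    Complex.ofReal_pow, map_mul, map_neg, Complex.conj_conj, ← Complex.conj_mul']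
  ring

/-- The Laplacian of `∑ i, |a^i_{\bar 1}|²`. -/
theorem laplacian_normSq_ab (hcard : Fintype.card ι = Module.finrank ℂ E) (hx : x ∈ ε.domain) :
    (Laplacian.laplacian (fun w => ∑ i, ‖abChart ε e f x i w‖ ^ 2)
      (extChartAt 𝓘(ℝ, ℂ) x x) : ℂ) =
    4 * ‖phiOne ε x‖ ^ 2 * ∑ i, (((‖ab1 ε e f i x‖ ^ 2 + ‖abb ε e f i x‖ ^ 2 +
      gaussK ε x * ‖ab ε e f i x‖ ^ 2 : ℝ) : ℂ) +
      (torsionb ε e f i x * conj (ab ε e f i x) + ab ε e f i x * conj (torsionb ε e f i x)) +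
      ∑ j, conj (ab ε e f i x) * ab ε e f j x * curvCoeff ε e f i j x) := by
  have hz := ε.mem_chartDomain_self hx
  have hxx : (extChartAt 𝓘(ℝ, ℂ) x).symm (extChartAt 𝓘(ℝ, ℂ) x x) = x := extChartAt_to_inv x
  have hD : ∀ᶠ w in nhds (extChartAt 𝓘(ℝ, ℂ) x x), ∀ i,
      hol (covD (abChart ε e f x) (thetab ε e f x) i w) = coframeCoeff ε x w *
        contract (LChart e f x) (a1Chart ε e f x) (abChart ε e f x) i w := by
    filter_upwards [(ε.isOpen_chartDomain x).mem_nhds hz] with w hw i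
    rw [hol_covD_ab hf ε e hfr i hw, ab1_eq_of_harmonic hf ε e hfr hharm hcard hw.2]
    rfl
  have hX := anti_hol_of_hol_eq (differentiableAt_coframeCoeff ε hx)
    (fun i => differentiableAt_contract hf ε e hfr i hz) (anti_fderiv_coframeCoeff ε hx) hD
  have hdΘ : ∀ i j, DifferentiableAt ℝ (thetab ε e f x i j) (extChartAt 𝓘(ℝ, ℂ) x x) :=
    differentiableAt_twist
      (fun i j => (contDiffAt_connChart hf ε e hfr i j hz).differentiableAt (by simp))
      ((contDiffAt_rho ε hz).differentiableAt (by simp)) _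
  rw [laplacian_normSq_anti_hol (fun i => contDiffAt_abChart hf ε e hfr i hz) hdΘ
    (Filter.Eventually.of_forall
      (twist_skew (connChart_skew e f x) (chartForm_rho_real ε x) (by simp)))
    hX (curvature_theta hf ε e hfr hcard hx _)]
  simp only [hol_covD_ab hf ε e hfr _ hz, anti_covD_ab hf ε e hfr _ hz,
    anti_contract_chart hf ε e hfr hcard _ hz, coframeCoeff_self, hxx, abChart, mul_assoc (4 : ℂ)]
  congr 1
  rw [Finset.mul_sum]
  refine Finset.sum_congr rfl fun i _ => ?_
  have h1 : ∑ j, conj (ab ε e f i x) * ab ε e f j x * (‖phiOne ε x‖ ^ 2 * (curvCoeff ε e f i j x -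
      if i = j then Complex.I * Complex.I * gaussK ε x else 0)) =
      ‖phiOne ε x‖ ^ 2 * ∑ j, conj (ab ε e f i x) * ab ε e f j x * curvCoeff ε e f i j x +
      ‖phiOne ε x‖ ^ 2 * (conj (ab ε e f i x) * ab ε e f i x * gaussK ε x) := by
    have h2 : ∀ j, conj (ab ε e f i x) * ab ε e f j x * (‖phiOne ε x‖ ^ 2 * (curvCoeff ε e f i j x -
      if i = j then Complex.I * Complex.I * gaussK ε x else 0)) =
      ‖phiOne ε x‖ ^ 2 * (conj (ab ε e f i x) * ab ε e f j x * curvCoeff ε e f i j x) +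
      if i = j then ‖phiOne ε x‖ ^ 2 * (conj (ab ε e f i x) * ab ε e f j x * gaussK ε x) else 0 := by
      intro j
      split_ifs
      · linear_combination (-‖phiOne ε x‖ ^ 2 * (conj (ab ε e f i x) * ab ε e f j x *
          gaussK ε x)) * Complex.I_sq
      · ring
    simp only [h2, Finset.sum_add_distrib, ← Finset.mul_sum, Finset.sum_ite_eq, Finset.mem_univ,
      if_true]
  rw [h1]
  simp only [norm_mul, Complex.norm_conj, mul_pow, Complex.ofReal_add, Complex.ofReal_mul,
    Complex.ofReal_pow, map_mul, Complex.conj_conj, ← Complex.conj_mul']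
  ring

/-- The Laplacian of the energy density. -/
theorem laplaceBeltrami_energyDensity (hcard : Fintype.card ι = Module.finrank ℂ E)
    (hx : x ∈ ε.domain) :
    (laplaceBeltrami g (energyDensity g h f) x : ℂ) =
    2 * ∑ i, (((‖a11 ε e f i x‖ ^ 2 + ‖a1b ε e f i x‖ ^ 2 +
      gaussK ε x * ‖a1 ε e f i x‖ ^ 2 : ℝ) : ℂ) -
      (torsion1 ε e f i x * conj (a1 ε e f i x) + a1 ε e f i x * conj (torsion1 ε e f i x)) -
      ∑ j, conj (a1 ε e f i x) * a1 ε e f j x * curvCoeff ε e f i j x) +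
    2 * ∑ i, (((‖ab1 ε e f i x‖ ^ 2 + ‖abb ε e f i x‖ ^ 2 +
      gaussK ε x * ‖ab ε e f i x‖ ^ 2 : ℝ) : ℂ) +
      (torsionb ε e f i x * conj (ab ε e f i x) + ab ε e f i x * conj (torsionb ε e f i x)) +
      ∑ j, conj (ab ε e f i x) * ab ε e f j x * curvCoeff ε e f i j x) := by
  have hz := ε.mem_chartDomain_self hx
  have hev : (fun z => energyDensity g h f ((extChartAt 𝓘(ℝ, ℂ) x).symm z))
      =ᶠ[nhds (extChartAt 𝓘(ℝ, ℂ) x x)] (fun w => ∑ i, ‖a1Chart ε e f x i w‖ ^ 2) +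
        fun w => ∑ i, ‖abChart ε e f x i w‖ ^ 2 := by
    filter_upwards [(ε.isOpen_chartDomain x).mem_nhds hz] with w hw
    rw [energyDensity_eq hcard ε e hw.2 (hfr hw.2), Finset.sum_add_distrib]
    rfl
  have h1 : ContDiffAt ℝ 2 (fun w => ∑ i, ‖a1Chart ε e f x i w‖ ^ 2) (extChartAt 𝓘(ℝ, ℂ) x x) :=
    ContDiffAt.sum fun i _ => (contDiffAt_a1Chart hf ε e hfr i hz).norm_sq ℝ
  have h2 : ContDiffAt ℝ 2 (fun w => ∑ i, ‖abChart ε e f x i w‖ ^ 2) (extChartAt 𝓘(ℝ, ℂ) x x) :=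
    ContDiffAt.sum fun i _ => (contDiffAt_abChart hf ε e hfr i hz).norm_sq ℝ
  -- The conformal factor `2|λ|²` against the `4|λ|²` of the two Laplacians leaves the overall
  -- factor 2.
  have h3 : g.inner x (1 : ℂ) (1 : ℂ) = 2 * ‖phiOne ε x‖ ^ 2 := inner_coordOne ε hx
  have h0 : (‖phiOne ε x‖ : ℂ) ≠ 0 := by simpa using phiOne_ne_zero ε hx
  rw [laplaceBeltrami, h3, (InnerProductSpace.laplacian_congr_nhds hev).self_of_nhds,
    h1.laplacian_add h2, Complex.ofReal_mul, Complex.ofReal_add,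
    laplacian_normSq_a1 hf ε e hfr hharm hcard hx, laplacian_normSq_ab hf ε e hfr hharm hcard hx]
  push_cast
  field_simp
  ring

end Bochner

/-! ### Rewriting the torsion terms as real parts. -/

section TorsionTerms

variable {S : Type*} [TopologicalSpace S] [ChartedSpace ℂ S] [IsManifold 𝓘(ℂ, ℂ) ω S]
  {g : HermitianMetric ℂ S}
  {E : Type*} [NormedAddCommGroup E] [NormedSpace ℝ E] [NormedSpace ℂ E]
  [IsScalarTower ℝ ℂ E]
  {M : Type*} [TopologicalSpace M] [ChartedSpace E M] [IsManifold 𝓘(ℂ, E) ω M]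
  {h : HermitianMetric E M} {ι : Type} [DecidableEq ι] [Fintype ι]

theorem mul_conj_torsion1 (ε : UnitaryFrame Unit g) (e : UnitaryFrame ι h) (f : S → M) (i : ι)
    (x : S) (c : ℂ) :
    c * conj (torsion1 ε e f i x) = ∑ j, ∑ k,
      (c * (∑ l, (conj (e.Lhol i j k l (f x)) * conj (a1 ε e f l x)
          + conj (e.Lanti i j k l (f x)) * ab ε e f l x))
        * conj (a1 ε e f j x) * conj (ab ε e f k x)
        + c * conj (e.L i j k (f x)) * (conj (a11 ε e f j x) * conj (ab ε e f k x)
          + conj (a1 ε e f j x) * conj (ab1 ε e f k x))) := by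
  simp only [torsion1, covL1, map_sum, map_add, map_mul, Complex.conj_conj]
  rw [Finset.mul_sum]
  refine Finset.sum_congr rfl fun j _ => ?_
  rw [Finset.mul_sum]
  exact Finset.sum_congr rfl fun k _ => by ring

theorem mul_conj_torsionb (ε : UnitaryFrame Unit g) (e : UnitaryFrame ι h) (f : S → M) (i : ι)
    (x : S) (c : ℂ) :
    c * conj (torsionb ε e f i x) = ∑ j, ∑ k,
      (c * (∑ l, (conj (e.Lhol i j k l (f x)) * conj (ab ε e f l x)
          + conj (e.Lanti i j k l (f x)) * a1 ε e f l x))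
        * conj (a1 ε e f j x) * conj (ab ε e f k x)
        + c * conj (e.L i j k (f x)) * (conj (a1b ε e f j x) * conj (ab ε e f k x)
          + conj (a1 ε e f j x) * conj (abb ε e f k x))) := by
  simp only [torsionb, covLb, map_sum, map_add, map_mul, Complex.conj_conj]
  rw [Finset.mul_sum]
  refine Finset.sum_congr rfl fun j _ => ?_
  rw [Finset.mul_sum]
  exact Finset.sum_congr rfl fun k _ => by ring

theorem sum_mul_conj_add {n : Type*} [Fintype n] (a t : n → ℂ) :
    ∑ i, (t i * conj (a i) + a i * conj (t i)) = 2 * ((∑ i, a i * conj (t i)).re : ℂ) := by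
  rw [Complex.re_eq_add_conj, mul_div_cancel₀ _ two_ne_zero, map_sum, add_comm,
    ← Finset.sum_add_distrib]
  simp only [map_mul, Complex.conj_conj]
  exact Finset.sum_congr rfl fun i _ => by ring

end TorsionTerms

end ChernHarmonic

end

/-! ### Assembly of the Bochner formula. -/

theorem theorem2p2
    {S : Type*} [TopologicalSpace S] [ChartedSpace ℂ S] [IsManifold 𝓘(ℂ, ℂ) ω S]
    {M : Type*} [TopologicalSpace M] [ChartedSpace (EuclideanSpace ℂ (Fin 2)) M]
    [IsManifold 𝓘(ℂ, EuclideanSpace ℂ (Fin 2)) ω M]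
    (g : HermitianMetric ℂ S) (h : HermitianMetric (EuclideanSpace ℂ (Fin 2)) M)
    (f : S → M) (hf : IsChernHarmonic g h f)
    (ε : UnitaryFrame Unit g) (e : UnitaryFrame (Fin 2) h)
    (hfr : Set.MapsTo f ε.domain e.domain) (x : S) (hx : x ∈ ε.domain) :
    energyDensity g h f x = ∑ i, (‖a1 ε e f i x‖ ^ 2 + ‖ab ε e f i x‖ ^ 2) ∧
    normSqA ε e f x = normSqNablaDf ε e f x / 2 ∧
    (laplaceBeltrami g (energyDensity g h f) x : ℂ) =
      2 * normSqA ε e f x + 2 * gaussK ε x * energyDensity g h f x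
      - 2 * ∑ i, ∑ j, conj (a1 ε e f i x) * a1 ε e f j x * curvCoeff ε e f i j x
      + 2 * ∑ i, ∑ j, ab ε e f i x * conj (ab ε e f j x) * curvCoeff ε e f j i x
      - 4 * ((∑ i, ∑ j, ∑ k,
          (a1 ε e f i x
              * (∑ l, (conj (e.Lhol i j k l (f x)) * conj (a1 ε e f l x)
                  + conj (e.Lanti i j k l (f x)) * ab ε e f l x))
              * conj (a1 ε e f j x) * conj (ab ε e f k x)
            + a1 ε e f i x * conj (e.L i j k (f x))
              * (conj (a11 ε e f j x) * conj (ab ε e f k x)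
                  + conj (a1 ε e f j x) * conj (ab1 ε e f k x)))).re : ℂ)
      + 4 * ((∑ i, ∑ j, ∑ k,
          (ab ε e f i x
              * (∑ l, (conj (e.Lhol i j k l (f x)) * conj (ab ε e f l x)
                  + conj (e.Lanti i j k l (f x)) * a1 ε e f l x))
              * conj (a1 ε e f j x) * conj (ab ε e f k x)
            + ab ε e f i x * conj (e.L i j k (f x))
              * (conj (a1b ε e f j x) * conj (ab ε e f k x)
                  + conj (a1 ε e f j x) * conj (abb ε e f k x)))).re : ℂ) := by
  have hcard : Fintype.card (Fin 2) = Module.finrank ℂ (EuclideanSpace ℂ (Fin 2)) := by simp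
  have hy := hfr hx
  have hharm : ∀ x ∈ ε.domain, ∀ i, a1b ε e f i x + ab1 ε e f i x = 0 := fun x hx i => by
    rw [← dual_trace_nablaDf ε e hx (hfr hx) i, hf.2 ε e hfr x hx, map_zero]
  -- The two mixed components have equal length; this is the coefficient 2 of `|a^i_{1 \bar 1}|²` in
  -- `|A|²`.
  have hn : ∀ i, ‖ab1 ε e f i x‖ = ‖a1b ε e f i x‖ := fun i => by
    rw [eq_neg_of_add_eq_zero_right (hharm x hx i), norm_neg]
  refine ⟨energyDensity_eq hcard ε e hx hy, ?_, ?_⟩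
  · rw [normSqNablaDf_eq hcard ε e hx hy, normSqA, mul_div_cancel_left₀ _ two_ne_zero]
    exact Finset.sum_congr rfl fun i _ => by rw [hn]; ring
  · rw [laplaceBeltrami_energyDensity hf.1 ε e hfr hharm hcard hx, energyDensity_eq hcard ε e hx hy,
      normSqA]
    simp only [← mul_conj_torsion1, ← mul_conj_torsionb, hn]
    -- The second curvature term is stated with `i` and `j` interchanged relative to
    -- `laplaceBeltrami_energyDensity`.
    have hB : ∑ i, ∑ j, ab ε e f i x * conj (ab ε e f j x) * curvCoeff ε e f j i x =
        ∑ i, ∑ j, conj (ab ε e f i x) * ab ε e f j x * curvCoeff ε e f i j x := by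
      rw [Finset.sum_comm]
      exact Finset.sum_congr rfl fun i _ => Finset.sum_congr rfl fun j _ => by ring
    have h1 := sum_mul_conj_add (fun i => a1 ε e f i x) fun i => torsion1 ε e f i x
    have h2 := sum_mul_conj_add (fun i => ab ε e f i x) fun i => torsionb ε e f i x
    rw [hB]
    push_cast
    simp only [Finset.sum_add_distrib, Finset.sum_sub_distrib, ← Finset.mul_sum] at h1 h2 ⊢
    linear_combination 2 * h2 - 2 * h1
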